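/- Let $n\in\mathbb N$, $a_0\ge 0$, and let $a:(0,\infty)\to\mathbb R$ be measurable, integrable on $(0,1)$ and essentially bounded on $[\varepsilon,\infty)$ for every $\varepsilon>0$. Let $\tilde a(p)=\int_0^\infty e^{-pt}a(t)\,dt$ ($\operatorname{Re}p>0$), $A(t)=a_0+\int_0^t a(\tau)\,d\tau$, and $(f*g)(t)=\int_0^t f(t-\tau)g(\tau)\,d\tau$. Assume that for every $\omega\in\mathbb R$ the limit $$\lim_{h\downarrow 0}\bigl(a_0+\operatorname{Re}\tilde a(i\omega+h)\bigr)$$ exists in $(-\infty,+\infty]$ and is $\ge 0$. Let $s\in\mathbb R$ and $u_0\in H^s(\mathbb R^n)$. Then for every $\lambda\ge 0$ the scalar Volterra equation $$z(\lambda,t)+\lambda\,(A*z(\lambda,\cdot))(t)=1\qquad(t\ge 0)$$ has a unique continuous solution $z(\lambda,\cdot):[0,\infty)\to\mathbb R$, and there is a unique $u\in C([0,\infty),H^s(\mathbb R^n))$ with $u(\cdot,0)=u_0$ that solves $u_t=a_0\Delta u+a*\Delta u$ in the sense of distributions, that is, for all $\Phi\in C_c^\infty(\mathbb R^n\times[0,\infty))$,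 $$\int_0^\infty\Bigl(\langle u(\cdot,t),\Phi_t(\cdot,t)+a_0\Delta\Phi(\cdot,t)\rangle+\int_t^\infty a(r-t)\,\langle u(\cdot,t),\Delta\Phi(\cdot,r)\rangle\,dr\Bigr)dt+\langle u(\cdot,0),\Phi(\cdot,0)\rangle=0 .$$ The Fourier transforms (normalised as $\hat f(\xi)=\int_{\mathbb R^n}e^{-i x\cdot\xi}f(x)\,dx$ and extended to tempered distributions) of $u_0$ and of $u(\cdot,t)$ are functions, and for every $t\ge 0$ $$\hat u(\xi,t)=z(|\xi|^2,t)\,\hat u_0(\xi)\qquad\text{for almost every }\xi\in\mathbb R^n .$$ -/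

import Mathlib

open MeasureTheory Set Filter Topology
open scoped SchwartzMap FourierTransform Laplacian LineDeriv ContDiff Distributions

namespace VolterraDiffusion

/-- Kernels `a : (0, ∞) → ℝ` that are measurable, integrable on `(0, 1)` and (essentially) bounded
on every half line `[ε, ∞)`, `ε > 0`. Values of `a` outside `(0, ∞)` are irrelevant. -/
structure IsAdmissibleKernel (a : ℝ → ℝ) : Prop where
  aestronglyMeasurable : AEStronglyMeasurable a (volume.restrict (Ioi 0))
  integrableOn : IntegrableOn a (Ioo 0 1)
  bounded : ∀ ε : ℝ, 0 < ε → ∃ C : ℝ, ∀ᵐ t ∂(volume.restrict (Ici ε)), |a t| ≤ C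

/-- The Laplace transform `ã(p) = ∫₀^∞ e^{-pt} a(t) dt`. -/
noncomputable def laplaceTransform (a : ℝ → ℝ) (p : ℂ) : ℂ :=
  ∫ t in Ioi (0 : ℝ), Complex.exp (-p * t) * (a t : ℂ)

/-- For every real frequency `w`, the limit of `a₀ + Re ã(iw + h)` as `h ↓ 0` exists in the
extended reals and is nonnegative (the value `+∞` is allowed). -/
def NonnegBoundaryLimit (a₀ : ℝ) (a : ℝ → ℝ) : Prop :=
  ∀ w : ℝ, ∃ L : EReal, 0 ≤ L ∧
    Tendsto (fun h : ℝ => ((a₀ + (laplaceTransform a (Complex.I * w + h)).re : ℝ) : EReal))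
      (𝓝[>] 0) (𝓝 L)

/-- The integrated kernel `A(t) = a₀ + ∫₀ᵗ a(τ) dτ`. -/
noncomputable def integratedKernel (a₀ : ℝ) (a : ℝ → ℝ) (t : ℝ) : ℝ :=
  a₀ + ∫ τ in (0 : ℝ)..t, a τ

/-- `z` is a continuous solution on `[0, ∞)` of the scalar Volterra equation `z + l A * z = 1`. -/
def IsScalarSolution (a₀ : ℝ) (a : ℝ → ℝ) (l : ℝ) (z : ℝ → ℝ) : Prop :=
  ContinuousOn z (Ici 0) ∧
    ∀ t : ℝ, 0 ≤ t → z t + l * ∫ τ in (0 : ℝ)..t, integratedKernel a₀ a (t - τ) * z τ = 1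

section Space

variable {E : Type*} [NormedAddCommGroup E] [InnerProductSpace ℝ E]

/-- The slice `x ↦ Φ(x, t)` of a test function `Φ ∈ C_c^∞(E × ℝ)`, as a Schwartz function. -/
noncomputable def slice (Φ : 𝓓((⊤ : TopologicalSpace.Opens (E × ℝ)), ℂ)) (t : ℝ) : 𝓢(E, ℂ) :=
  HasCompactSupport.toSchwartzMap (f := fun x : E => Φ (x, t))
    (Φ.hasCompactSupport.comp_isClosedEmbedding
      (Function.LeftInverse.isClosedEmbedding (f := Prod.fst) (fun _ => rfl)
        continuous_fst (by fun_prop)))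
    (Φ.contDiff.comp (contDiff_prodMk_left t))

@[simp]
theorem slice_apply (Φ : 𝓓((⊤ : TopologicalSpace.Opens (E × ℝ)), ℂ)) (t : ℝ) (x : E) :
    slice Φ t x = Φ (x, t) := rfl

variable [FiniteDimensional ℝ E]

/-- The weak form of `u_t = a₀ Δu + a * Δu` with initial value `u 0`. The test functions are the
restrictions to `E × [0, ∞)` of functions `Φ ∈ C_c^∞(E × ℝ)`, that is, all smooth compactly
supported functions on `E × [0, ∞)`. The equation is
`∫₀^∞ (⟨u(s), Φ_t(s) + a₀ ΔΦ(s)⟩ + ∫ₛ^∞ a(t-s) ⟨u(s), ΔΦ(t)⟩ dt) ds + ⟨u(0), Φ(0)⟩ = 0`. -/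
def SolvesWeakly (a₀ : ℝ) (a : ℝ → ℝ) (u : ℝ → 𝓢'(E, ℂ)) : Prop :=
  ∀ Φ : 𝓓((⊤ : TopologicalSpace.Opens (E × ℝ)), ℂ),
    (∫ s in Ioi (0 : ℝ),
      (u s (slice (∂_{((0 : E), (1 : ℝ))} Φ) s + (a₀ : ℂ) • Δ (slice Φ s))
        + ∫ t in Ioi s, (a (t - s) : ℂ) * u s (Δ (slice Φ t))))
      + u 0 (slice Φ 0) = 0

variable [MeasurableSpace E] [BorelSpace E]

/-- `u ∈ C([0, ∞), H^s)`: for each `t ≥ 0` the Bessel potential of order `s` maps `u(t)` to an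
`L²` function, and this `L²` function depends continuously on `t ≥ 0` in the `L²` norm. -/
def ContinuousInSobolev (s : ℝ) (u : ℝ → 𝓢'(E, ℂ)) : Prop :=
  ∃ U : ℝ → Lp ℂ 2 (volume : Measure E), ContinuousOn U (Ici 0) ∧
    ∀ t : ℝ, 0 ≤ t → TemperedDistribution.besselPotential E ℂ s (u t) = (U t : 𝓢'(E, ℂ))

/-- `u ∈ C([0, ∞), H^s)` is a distributional solution of `u_t = a₀ Δu + a * Δu`, `u(0) = u₀`.
Only the values of `u` on `[0, ∞)` matter. -/
structure IsSobolevSolution (s a₀ : ℝ) (a : ℝ → ℝ) (u₀ : 𝓢'(E, ℂ)) (u : ℝ → 𝓢'(E, ℂ)) :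
    Prop where
  continuous : ContinuousInSobolev s u
  weak : SolvesWeakly a₀ a u
  initial : u 0 = u₀

/-- The Fourier transform `φ̂(ξ) = ∫ e^{-i⟨x, ξ⟩} φ(x) dx` of a Schwartz function, obtained from
Mathlib's transform (which has `e^{-2πi⟨x, ξ⟩}`) by a dilation. -/
noncomputable def angularFourier (φ : 𝓢(E, ℂ)) : 𝓢(E, ℂ) :=
  SchwartzMap.compCLMOfContinuousLinearEquiv ℂ
    (ContinuousLinearEquiv.smulLeft (Units.mk0 (2 * Real.pi)⁻¹ (by positivity)) : E ≃L[ℝ] E) (𝓕 φ)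

theorem angularFourier_apply (φ : 𝓢(E, ℂ)) (ξ : E) :
    angularFourier φ ξ = ∫ x : E, Complex.exp (-Complex.I * (inner ℝ x ξ : ℝ)) * φ x := by
  have h : angularFourier φ ξ = 𝓕 (φ : E → ℂ) ((2 * Real.pi)⁻¹ • ξ) := rfl
  rw [h, Real.fourier_eq']
  congr 1
  ext x
  rw [smul_eq_mul, inner_smul_right]
  congr 2
  have hp : (Real.pi : ℂ) ≠ 0 := by exact_mod_cast Real.pi_ne_zero
  push_cast
  field_simp

/-- The Fourier transform `T̂`, defined by `⟨T̂, φ⟩ = ⟨T, φ̂⟩` for Schwartz functions `φ`, is the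
function `g`. -/
def HasFourierTransform (T : 𝓢'(E, ℂ)) (g : E → ℂ) : Prop :=
  ∀ φ : 𝓢(E, ℂ), Integrable (fun ξ => g ξ * φ ξ) ∧ T (angularFourier φ) = ∫ ξ, g ξ * φ ξ

end Space

end VolterraDiffusion

/-! The Fourier transform decouples the equation: at frequency ξ, with λ = |ξ|², the density of u
satisfies y' = -λ(a₀y + a * y), so it is z(λ, t) times the initial density. The scalar equation is
solved by the Neumann series of a Volterra operator, whose iterates decay like tⁿ/n!. The boundary
hypothesis supplies the bound |z(λ, t)| ≤ 1 for all λ ≥ 0 (`abs_resolvent_le_one`), which makes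
multiplication by z a contraction on H^s. Since (z²)' = -2λ z(a₀z + a * z), it suffices that the
quadratic form ∫₀ᵀ z(a₀z + a * z) is nonnegative (`integral_memoryTerm_mul_nonneg`).

The boundary limits are only pointwise and the kernel need not be integrable at infinity, so
positivity cannot be read off a Fourier transform directly. Put g(w) = a₀w²/2 + ∫ a(t)(1 - cos
wt)/t² dt. Its second differences with step δ, divided by δ², are the Fejér means a₀ + ∫ a(t)
cos(wt) fejer(δt) dt. A comparison of Rajchman type (`exists_fejer_mean_gt`) shows that nonnegative
lower limits of the Abel means prevent the Fejér means from staying below a negative constant as δ →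
0; it works because ((1 - e^{-x})/x)² is both an average of exponentials and an average of Fejér
kernels. A maximum principle (`midpoint_convex_of_symmetric_deriv`) then makes g midpoint convex, so
the Fejér means are nonnegative for every δ > 0 (`fejer_mean_nonneg`). The kernels a(t) fejer(δt)
are integrable, Plancherel turns their nonnegative cosine transforms into nonnegative quadratic
forms (`autocorrelation_form_nonneg`), and δ → 0 gives the claim.

Existence follows by multiplying the initial density by z: domination gives continuity in H^s, and
the weak equation is Fubini together with the fundamental theorem of calculus at each frequency.
Uniqueness needs no positivity. Product test functions show that the difference w of two solutions
satisfies ⟨w, φ⟩ = V⟨w, Δφ⟩ with V the Volterra operator. For band-limited φ the functions Δⁿφ grow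
only geometrically, so the factorial gain of the iterates of V forces ⟨w, φ⟩ = 0, and such φ are
dense. -/

namespace VolterraDiffusion

/-! ### Volterra operators: factorial estimates and the scalar resolvent. -/

section Volterra

variable {F : Type*} [NormedAddCommGroup F] [NormedSpace ℝ F]

/-- The causal convolution `∫₀ᵗ k(σ) Y(t - σ) dσ`. -/
noncomputable def causalConv (k : ℝ → ℝ) (Y : ℝ → F) (t : ℝ) : F :=
  ∫ σ in (0 : ℝ)..t, k σ • Y (t - σ)

/-- The memory term `a₀ Y + k * Y`. -/
noncomputable def memoryTerm (a₀ : ℝ) (k : ℝ → ℝ) (Y : ℝ → F) (t : ℝ) : F :=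
  a₀ • Y t + causalConv k Y t

/-- The primitive of the memory term, which is the Volterra operator with integrated kernel. -/
noncomputable def volterraOp (a₀ : ℝ) (k : ℝ → ℝ) (Y : ℝ → F) (t : ℝ) : F :=
  ∫ s in (0 : ℝ)..t, memoryTerm a₀ k Y s

variable {a₀ : ℝ} {k : ℝ → ℝ}

theorem continuous_causalConv (hk : ∀ s t, IntervalIntegrable k volume s t) {Y : ℝ → F}
    (hY : Continuous Y) : Continuous (causalConv k Y) := by
  rw [continuous_iff_continuousAt]
  intro t₀
  set R : ℝ := |t₀| + 1 with hR
  have ht₀ : t₀ ∈ Ioo (-R) R := by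
    rw [hR]; constructor <;> linarith [neg_abs_le t₀, le_abs_self t₀]
  have h0 : (0 : ℝ) ∈ Ioo (-R) R := by
    rw [hR]; constructor <;> linarith [abs_nonneg t₀]
  obtain ⟨C, hC⟩ := (isCompact_Icc (a := -(2 * R)) (b := 2 * R)).exists_bound_of_continuousOn
    hY.continuousOn
  have key := intervalIntegral.continuousAt_parametric_primitive_of_dominated (μ := volume)
    (F := fun t σ => k σ • Y (t - σ)) (a₀ := 0) (b₀ := t₀) (x₀ := t₀)
    (fun σ => |k σ| * C) (-R) R
    (fun t => (hk (-R) R).aestronglyMeasurable_restrict_uIoc.smul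
      (hY.comp (by fun_prop : Continuous fun σ : ℝ => t - σ)).aestronglyMeasurable)
    ?_ ((hk (-R) R).abs.mul_const C)
    (Eventually.of_forall fun σ => by fun_prop) h0 ht₀ (by simp)
  -- The parameter and the upper limit are both t: joint continuity is restricted to the diagonal.
  · exact key.comp (f := fun t : ℝ => (t, t)) (by fun_prop)
  · filter_upwards [Ioo_mem_nhds ht₀.1 ht₀.2] with t ht
    refine (ae_restrict_iff' measurableSet_uIoc).2 (Eventually.of_forall fun σ hσ => ?_)
    rw [uIoc_of_le (by linarith [h0.2])] at hσ
    rw [norm_smul, Real.norm_eq_abs]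
    exact mul_le_mul_of_nonneg_left (hC _ ⟨by linarith [ht.1, hσ.2], by linarith [ht.2, hσ.1]⟩)
      (abs_nonneg _)

theorem continuous_memoryTerm (a₀ : ℝ) (hk : ∀ s t, IntervalIntegrable k volume s t) {Y : ℝ → F}
    (hY : Continuous Y) : Continuous (memoryTerm a₀ k Y) := by
  have := continuous_causalConv hk hY
  unfold memoryTerm
  fun_prop

theorem continuous_volterraOp (a₀ : ℝ) (hk : ∀ s t, IntervalIntegrable k volume s t) {Y : ℝ → F}
    (hY : Continuous Y) : Continuous (volterraOp a₀ k Y) :=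
  intervalIntegral.continuous_primitive
    (fun _ _ => (continuous_memoryTerm a₀ hk hY).intervalIntegrable _ _) 0

theorem hasDerivAt_volterraOp [CompleteSpace F] (a₀ : ℝ)
    (hk : ∀ s t, IntervalIntegrable k volume s t)
    {Y : ℝ → F} (hY : Continuous Y) (t : ℝ) :
    HasDerivAt (volterraOp a₀ k Y) (memoryTerm a₀ k Y t) t :=
  (continuous_memoryTerm a₀ hk hY).integral_hasStrictDerivAt 0 t |>.hasDerivAt

theorem causalConv_congr {X Y : ℝ → F} {t : ℝ} (ht : 0 ≤ t) (h : ∀ s ∈ Icc 0 t, X s = Y s) :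
    causalConv k X t = causalConv k Y t := by
  refine intervalIntegral.integral_congr fun σ hσ => ?_
  rw [uIcc_of_le ht] at hσ
  rw [h (t - σ) ⟨by linarith [hσ.2], by linarith [hσ.1]⟩]

theorem memoryTerm_congr {X Y : ℝ → F} {t : ℝ} (ht : 0 ≤ t) (h : ∀ s ∈ Icc 0 t, X s = Y s) :
    memoryTerm a₀ k X t = memoryTerm a₀ k Y t := by
  rw [memoryTerm, memoryTerm, causalConv_congr ht h, h t ⟨ht, le_rfl⟩]

theorem volterraOp_congr {X Y : ℝ → F} {t : ℝ} (ht : 0 ≤ t) (h : ∀ s ∈ Icc 0 t, X s = Y s) :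
    volterraOp a₀ k X t = volterraOp a₀ k Y t := by
  refine intervalIntegral.integral_congr fun s hs => ?_
  rw [uIcc_of_le ht] at hs
  exact memoryTerm_congr hs.1 fun r hr => h r ⟨hr.1, hr.2.trans hs.2⟩

theorem causalConv_integrand_intervalIntegrable (hk : ∀ s t, IntervalIntegrable k volume s t)
    {Y : ℝ → F} (hY : Continuous Y) (r s t : ℝ) :
    IntervalIntegrable (fun σ => k σ • Y (r - σ)) volume s t :=
  (hk s t).smul_continuousOn (by fun_prop)

theorem volterraOp_sub (hk : ∀ s t, IntervalIntegrable k volume s t) {X Y : ℝ → F}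
    (hX : Continuous X) (hY : Continuous Y) (t : ℝ) :
    volterraOp a₀ k (fun s => X s - Y s) t = volterraOp a₀ k X t - volterraOp a₀ k Y t := by
  rw [volterraOp, volterraOp, volterraOp, ← intervalIntegral.integral_sub
    ((continuous_memoryTerm a₀ hk hX).intervalIntegrable _ _)
    ((continuous_memoryTerm a₀ hk hY).intervalIntegrable _ _)]
  congr 1
  ext s
  have : causalConv k (fun s => X s - Y s) s = causalConv k X s - causalConv k Y s := by
    rw [causalConv, causalConv, causalConv, ← intervalIntegral.integral_sub
      (causalConv_integrand_intervalIntegrable hk hX _ _ _)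
      (causalConv_integrand_intervalIntegrable hk hY _ _ _)]
    simp only [smul_sub]
  rw [memoryTerm, memoryTerm, memoryTerm, this, smul_sub]
  abel

theorem volterraOp_const_smul (c : ℝ) (Y : ℝ → F) (t : ℝ) :
    volterraOp a₀ k (fun s => c • Y s) t = c • volterraOp a₀ k Y t := by
  simp only [volterraOp, memoryTerm, causalConv, smul_comm _ c, ← smul_add,
    intervalIntegral.integral_smul]

/-- The size of the memory term on `[0, T]` relative to the supremum of its argument. -/
noncomputable def memoryBound (a₀ : ℝ) (k : ℝ → ℝ) (T : ℝ) : ℝ :=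
  |a₀| + ∫ σ in (0 : ℝ)..T, |k σ|

theorem memoryBound_nonneg {T : ℝ} (hT : 0 ≤ T) : 0 ≤ memoryBound a₀ k T :=
  add_nonneg (abs_nonneg _) (intervalIntegral.integral_nonneg hT fun _ _ => abs_nonneg _)

theorem norm_memoryTerm_le (hk : ∀ s t, IntervalIntegrable k volume s t) {Y : ℝ → F}
    {B t T : ℝ} (ht : 0 ≤ t) (htT : t ≤ T) (hB : ∀ s ∈ Icc 0 t, ‖Y s‖ ≤ B) :
    ‖memoryTerm a₀ k Y t‖ ≤ memoryBound a₀ k T * B := by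
  have hB0 : 0 ≤ B := (norm_nonneg _).trans (hB t ⟨ht, le_rfl⟩)
  have h1 : ‖causalConv k Y t‖ ≤ ∫ σ in (0 : ℝ)..t, |k σ| * B := by
    refine intervalIntegral.norm_integral_le_of_norm_le ht
      (Eventually.of_forall fun σ hσ => ?_) ((hk 0 t).abs.mul_const B)
    rw [norm_smul, Real.norm_eq_abs]
    exact mul_le_mul_of_nonneg_left (hB _ ⟨by linarith [hσ.2], by linarith [hσ.1]⟩) (abs_nonneg _)
  have h2 : ∫ σ in (0 : ℝ)..t, |k σ| ≤ ∫ σ in (0 : ℝ)..T, |k σ| :=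
    intervalIntegral.integral_mono_interval le_rfl ht htT
      (Eventually.of_forall fun _ => abs_nonneg _) (hk 0 T).abs
  rw [intervalIntegral.integral_mul_const] at h1
  calc ‖memoryTerm a₀ k Y t‖ ≤ ‖a₀ • Y t‖ + ‖causalConv k Y t‖ := norm_add_le _ _
    _ ≤ |a₀| * B + (∫ σ in (0 : ℝ)..T, |k σ|) * B := by
        rw [norm_smul, Real.norm_eq_abs]
        gcongr
        · exact hB t ⟨ht, le_rfl⟩
        · exact h1.trans (by gcongr)
    _ = _ := by rw [memoryBound]; ring

/-- The memory term costs the factor `memoryBound`, and the outer integration raises sⁿ/n! to the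
next power with its factorial. Iteration therefore beats any geometric growth. -/
theorem norm_volterraOp_le (hk : ∀ s t, IntervalIntegrable k volume s t) {Y : ℝ → F}
    {B T : ℝ} (hB0 : 0 ≤ B) (n : ℕ)
    (hB : ∀ s ∈ Icc 0 T, ‖Y s‖ ≤ B * (s ^ n / n.factorial)) {t : ℝ} (ht : t ∈ Icc 0 T) :
    ‖volterraOp a₀ k Y t‖ ≤
      memoryBound a₀ k T * B * (t ^ (n + 1) / (n + 1).factorial) := by
  have h : ‖volterraOp a₀ k Y t‖ ≤
      ∫ s in (0 : ℝ)..t, memoryBound a₀ k T * B * (s ^ n / n.factorial) := by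
    refine intervalIntegral.norm_integral_le_of_norm_le ht.1
      (Eventually.of_forall fun s hs => ?_) (Continuous.intervalIntegrable (by fun_prop) _ _)
    have hs0 : 0 ≤ s := hs.1.le
    rw [mul_assoc]
    refine norm_memoryTerm_le hk hs0 (hs.2.trans ht.2) fun r hr => ?_
    refine (hB r ⟨hr.1, hr.2.trans (hs.2.trans ht.2)⟩).trans ?_
    have := hr.1
    have := hr.2
    gcongr
  refine h.trans (le_of_eq ?_)
  rw [intervalIntegral.integral_const_mul, intervalIntegral.integral_div, integral_pow,
    Nat.factorial_succ]
  push_cast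
  have : (n.factorial : ℝ) ≠ 0 := by positivity
  field_simp
  ring

theorem norm_le_of_eq_volterraOp (hk : ∀ s t, IntervalIntegrable k volume s t) {Y : ℕ → ℝ → F}
    {C T : ℝ} (hC : 0 ≤ C) (N : ℕ) (hT : 0 ≤ T)
    (hY : ∀ n < N, ∀ t ∈ Icc 0 T, Y n t = volterraOp a₀ k (Y (n + 1)) t)
    (hb : ∀ t ∈ Icc 0 T, ‖Y N t‖ ≤ C) (m : ℕ) (hm : m ≤ N) (t : ℝ) (ht : t ∈ Icc 0 T) :
    ‖Y (N - m) t‖ ≤ memoryBound a₀ k T ^ m * C * (t ^ m / m.factorial) := by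
  induction m generalizing t with
  | zero => simpa using hb t ht
  | succ m ih =>
    rw [hY (N - (m + 1)) (by omega) t ht, pow_succ', mul_assoc (memoryBound a₀ k T)]
    refine norm_volterraOp_le hk (mul_nonneg (pow_nonneg (memoryBound_nonneg hT) _) hC) m
      (fun s hs => ?_) ht
    have : N - (m + 1) + 1 = N - m := by omega
    rw [this]
    exact ih (by omega) s hs

/-- Going back N steps along the chain bounds Y 0 by C (Mρt)^N / N! with M the memory bound, which
tends to 0. Both uniqueness proofs rest on this: the scalar one with Y n = (-l)ⁿ(x - y), the
distributional one with Y n the pairing of a difference of solutions with Δⁿφ. -/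
theorem eq_zero_of_eq_volterraOp (hk : ∀ s t, IntervalIntegrable k volume s t) {Y : ℕ → ℝ → F}
    {C ρ T : ℝ} (hC : 0 ≤ C) (hρ : 0 ≤ ρ)
    (hY : ∀ n, ∀ t ∈ Icc 0 T, Y n t = volterraOp a₀ k (Y (n + 1)) t)
    (hb : ∀ n, ∀ t ∈ Icc 0 T, ‖Y n t‖ ≤ C * ρ ^ n) {t : ℝ} (ht : t ∈ Icc 0 T) : Y 0 t = 0 := by
  have hT : 0 ≤ T := ht.1.trans ht.2
  have h : ∀ N : ℕ, ‖Y 0 t‖ ≤ C * ((memoryBound a₀ k T * ρ * t) ^ N / N.factorial) := fun N => by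
    have := norm_le_of_eq_volterraOp (a₀ := a₀) hk (mul_nonneg hC (pow_nonneg hρ N)) N hT
      (fun n _ => hY n) (hb N) N le_rfl t ht
    rw [Nat.sub_self] at this
    refine this.trans (le_of_eq ?_)
    rw [mul_pow, mul_pow]; ring
  have h2 := (FloorSemiring.tendsto_pow_div_factorial_atTop
    (memoryBound a₀ k T * ρ * t)).const_mul C
  rw [mul_zero] at h2
  exact norm_le_zero_iff.1 (ge_of_tendsto' h2 h)

/-- The Volterra operator is convolution with the integrated kernel. -/
theorem volterraOp_eq_integral [CompleteSpace F] (hk : ∀ s t, IntervalIntegrable k volume s t)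
    {Y : ℝ → F} (hY : Continuous Y) {t : ℝ} (ht : 0 ≤ t) :
    volterraOp a₀ k Y t = ∫ τ in (0 : ℝ)..t, integratedKernel a₀ k (t - τ) • Y τ := by
  -- Cut off to (0, t], both factors are integrable on the line, and their convolution integrand is
  -- integrable on the plane; this justifies the exchange of integrals below.
  have hkI : Integrable (indicator (Ioc 0 t) k) :=
    (integrable_indicator_iff measurableSet_Ioc).2 (hk 0 t).1
  have hYI : Integrable (indicator (Ioc 0 t) Y) :=
    (integrable_indicator_iff measurableSet_Ioc).2 (hY.intervalIntegrable 0 t).1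
  have hint := (hYI.convolution_integrand (ContinuousLinearMap.lsmul ℝ ℝ).flip hkI)
  have hconv : ∀ s ∈ Ioc 0 t, causalConv k Y s =
      ∫ τ, indicator (Ioc 0 t) k (s - τ) • indicator (Ioc 0 t) Y τ := fun s hs => by
    have h1 : causalConv k Y s = ∫ τ in (0 : ℝ)..s, k (s - τ) • Y τ := by
      have := intervalIntegral.integral_comp_sub_left (a := 0) (b := s)
        (fun τ => k (s - τ) • Y τ) s
      simpa [causalConv] using this
    -- The open interval is needed because at τ = s the cut-off kernel is evaluated at 0, where it
    -- vanishes.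
    rw [h1, intervalIntegral.integral_of_le hs.1.le, integral_Ioc_eq_integral_Ioo,
      ← integral_indicator measurableSet_Ioo]
    congr 1
    ext τ
    by_cases hτ : τ ∈ Ioo 0 s
    · rw [indicator_of_mem hτ, indicator_of_mem (show s - τ ∈ Ioc 0 t from
        ⟨by linarith [hτ.2], by linarith [hτ.1, hs.2]⟩),
        indicator_of_mem (show τ ∈ Ioc 0 t from ⟨hτ.1, hτ.2.le.trans hs.2⟩)]
    · rw [indicator_of_notMem hτ]
      by_cases h0 : 0 < τ
      · rw [indicator_of_notMem (show s - τ ∉ Ioc 0 t from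
          fun h => hτ ⟨h0, by linarith [h.1]⟩), zero_smul]
      · rw [indicator_of_notMem (show τ ∉ Ioc 0 t from fun h => h0 h.1), smul_zero]
  have hA : ∀ τ, IntervalIntegrable (fun σ => k (σ - τ)) volume τ t := fun τ => by
    simpa using (hk 0 (t - τ)).comp_sub_right τ
  have hconvI : ∫ s in (0 : ℝ)..t, causalConv k Y s =
      ∫ τ in (0 : ℝ)..t, (∫ σ in (0 : ℝ)..(t - τ), k σ) • Y τ := by
    rw [intervalIntegral.integral_of_le ht, intervalIntegral.integral_of_le ht,
      setIntegral_congr_fun measurableSet_Ioc hconv, integral_integral_swap]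
    · rw [← integral_indicator measurableSet_Ioc]
      congr 1
      ext τ
      rw [integral_smul_const]
      by_cases hτ : τ ∈ Ioc 0 t
      · rw [indicator_of_mem hτ, indicator_of_mem hτ]
        congr 1
        have h1 := intervalIntegral.integral_comp_sub_right (a := τ) (b := t) k τ
        rw [sub_self] at h1
        rw [← h1, intervalIntegral.integral_of_le hτ.2, ← integral_indicator measurableSet_Ioc,
          ← integral_indicator measurableSet_Ioc]
        congr 1
        ext s
        by_cases hs : s ∈ Ioc τ t
        · rw [indicator_of_mem hs, indicator_of_mem (show s ∈ Ioc 0 t from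
            ⟨hτ.1.trans hs.1, hs.2⟩), indicator_of_mem]
          exact ⟨by linarith [hs.1], by linarith [hs.2, hτ.1]⟩
        · rw [indicator_of_notMem hs]
          by_cases hs0 : s ∈ Ioc 0 t
          · rw [indicator_of_mem hs0, indicator_of_notMem]
            exact fun h => hs ⟨by linarith [h.1], hs0.2⟩
          · rw [indicator_of_notMem hs0]
      · rw [indicator_of_notMem hτ, indicator_of_notMem hτ, smul_zero]
    · refine Integrable.mono_measure (ν := volume.prod volume) ?_
        (Measure.prod_mono Measure.restrict_le_self le_rfl)
      simpa [Function.uncurry_def] using hint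
  have hprim : Continuous fun r : ℝ => ∫ σ in (0 : ℝ)..r, k σ :=
    intervalIntegral.continuous_primitive hk 0
  have hc : Continuous fun τ => (∫ σ in (0 : ℝ)..(t - τ), k σ) • Y τ :=
    (hprim.comp (by fun_prop : Continuous fun τ : ℝ => t - τ)).smul hY
  simp only [volterraOp, memoryTerm, integratedKernel, add_smul]
  have ha : Continuous fun s => a₀ • Y s := hY.const_smul a₀
  rw [intervalIntegral.integral_add (ha.intervalIntegrable _ _)
    ((continuous_causalConv hk hY).intervalIntegrable _ _),
    intervalIntegral.integral_add (ha.intervalIntegrable _ _)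
    (hc.intervalIntegrable _ _), hconvI]

/-! ### The scalar resolvent as a power series in the parameter -/

/-- The iterated Volterra operator applied to the constant `1`. -/
noncomputable def resolventCoeff (a₀ : ℝ) (k : ℝ → ℝ) : ℕ → ℝ → ℝ
  | 0 => fun _ => 1
  | n + 1 => volterraOp a₀ k (resolventCoeff a₀ k n)

/-- The solution `z(l, t)` of `z + l V z = 1`, extended to `t < 0` by its value at `t = 0`. -/
noncomputable def resolvent (a₀ : ℝ) (k : ℝ → ℝ) (l t : ℝ) : ℝ :=
  ∑' n : ℕ, (-l) ^ n * resolventCoeff a₀ k n (max t 0)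

theorem continuous_resolventCoeff (hk : ∀ s t, IntervalIntegrable k volume s t) (n : ℕ) :
    Continuous (resolventCoeff a₀ k n) := by
  induction n with
  | zero => exact continuous_const
  | succ n ih => exact continuous_volterraOp a₀ hk ih

theorem abs_resolventCoeff_le (hk : ∀ s t, IntervalIntegrable k volume s t) (n : ℕ) {t T : ℝ}
    (ht : t ∈ Icc 0 T) :
    |resolventCoeff a₀ k n t| ≤ memoryBound a₀ k T ^ n * (t ^ n / n.factorial) := by
  have hT : 0 ≤ T := ht.1.trans ht.2
  induction n generalizing t with
  | zero => simp [resolventCoeff]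
  | succ n ih =>
    rw [pow_succ']
    exact norm_volterraOp_le (Y := resolventCoeff a₀ k n) hk
      (pow_nonneg (memoryBound_nonneg hT) _) n (fun s hs => ih hs) ht

theorem abs_resolvent_term_le (hk : ∀ s t, IntervalIntegrable k volume s t) (n : ℕ) {l t R T : ℝ}
    (ht : t ∈ Icc 0 T) (hl : |l| ≤ R) :
    |(-l) ^ n * resolventCoeff a₀ k n t| ≤ (R * memoryBound a₀ k T * T) ^ n / n.factorial := by
  have hT : 0 ≤ T := ht.1.trans ht.2
  have hM := memoryBound_nonneg (a₀ := a₀) (k := k) hT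
  rw [abs_mul, abs_pow, abs_neg]
  calc |l| ^ n * |resolventCoeff a₀ k n t|
      ≤ R ^ n * (memoryBound a₀ k T ^ n * (T ^ n / n.factorial)) := by
        have h0 := ht.1
        have h1 := ht.2
        have hR : 0 ≤ R := (abs_nonneg l).trans hl
        gcongr
        exact (abs_resolventCoeff_le hk n ht).trans (by gcongr)
    _ = _ := by rw [mul_pow, mul_pow]; ring

/-- The series converges uniformly for bounded l and t by comparison with an exponential series.
Continuity jointly in l and t later gives measurability of the Fourier symbol in ξ and t. -/
theorem continuous_resolvent (hk : ∀ s t, IntervalIntegrable k volume s t) :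
    Continuous fun p : ℝ × ℝ => resolvent a₀ k p.1 p.2 := by
  rw [continuous_iff_continuousAt]
  intro p
  set R := |p.1| + 1
  set T := |p.2| + 1
  have hc : ContinuousOn (fun p : ℝ × ℝ => resolvent a₀ k p.1 p.2)
      {q | |q.1| < R ∧ |q.2| < T} := by
    have hsum := Real.summable_pow_div_factorial (R * memoryBound a₀ k T * T)
    refine continuousOn_tsum (fun n => ?_) hsum fun n q hq => ?_
    · have h1 : Continuous fun q : ℝ × ℝ => resolventCoeff a₀ k n (max q.2 0) :=
        (continuous_resolventCoeff hk n).comp (continuous_snd.max continuous_const)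
      exact ((continuous_fst.neg.pow n).mul h1).continuousOn
    · have hm : max q.2 0 ∈ Icc 0 T :=
        ⟨le_max_right _ _, max_le ((le_abs_self _).trans hq.2.le) (by positivity)⟩
      rw [Real.norm_eq_abs]
      exact abs_resolvent_term_le hk n hm hq.1.le
  refine hc.continuousAt (IsOpen.mem_nhds ?_ ⟨lt_add_one _, lt_add_one _⟩)
  exact (isOpen_lt continuous_fst.abs continuous_const).inter
    (isOpen_lt continuous_snd.abs continuous_const)

theorem continuous_resolvent_right (hk : ∀ s t, IntervalIntegrable k volume s t) (l : ℝ) :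
    Continuous (resolvent a₀ k l) :=
  (continuous_resolvent hk).comp (by fun_prop : Continuous fun t : ℝ => (l, t))

/-- The partial sums satisfy S (N + 1) = 1 - l V (S N) and converge uniformly on [0, t]; the
operator V is continuous for uniform convergence, so the recursion passes to the limit. -/
theorem resolvent_add_volterraOp (hk : ∀ s t, IntervalIntegrable k volume s t) (l : ℝ) {t : ℝ}
    (ht : 0 ≤ t) : resolvent a₀ k l t + l * volterraOp a₀ k (resolvent a₀ k l) t = 1 := by
  set S : ℕ → ℝ → ℝ := fun N s => ∑ n ∈ Finset.range N, (-l) ^ n * resolventCoeff a₀ k n s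
  have hScont : ∀ N, Continuous (S N) := fun N => by
    have := continuous_resolventCoeff (a₀ := a₀) hk
    fun_prop
  have hsucc : ∀ N, ∀ s, S (N + 1) s = 1 - l * volterraOp a₀ k (S N) s := fun N => by
    induction N with
    | zero =>
      intro s
      have : volterraOp a₀ k (S 0) s = 0 := by
        simp [S, volterraOp, memoryTerm, causalConv]
      rw [this]; simp [S, resolventCoeff]
    | succ N ih =>
      intro s
      have h1 : S (N + 2) s = S (N + 1) s + (-l) ^ (N + 1) * resolventCoeff a₀ k (N + 1) s :=
        Finset.sum_range_succ _ _
      have h2 : S N = fun s => S (N + 1) s - (-l) ^ N • resolventCoeff a₀ k N s := by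
        ext s
        have : S (N + 1) s = S N s + (-l) ^ N * resolventCoeff a₀ k N s :=
          Finset.sum_range_succ _ _
        rw [this, smul_eq_mul]; ring
      have h3 := ih s
      have hc : Continuous fun s => (-l) ^ N • resolventCoeff a₀ k N s :=
        (continuous_resolventCoeff hk N).const_smul ((-l) ^ N)
      rw [h2, volterraOp_sub hk (hScont _) hc, volterraOp_const_smul] at h3
      rw [h1, h3, resolventCoeff, smul_eq_mul]
      ring
  have hsum : ∀ s ∈ Icc 0 t, resolvent a₀ k l s =
      ∑' n : ℕ, (-l) ^ n * resolventCoeff a₀ k n s := fun s hs => by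
    rw [resolvent, max_eq_left hs.1]
  have hunif : TendstoUniformlyOn S (resolvent a₀ k l) atTop (Icc 0 t) := by
    refine (tendstoUniformlyOn_tsum_nat (Real.summable_pow_div_factorial
      (|l| * memoryBound a₀ k t * t))
      fun n s hs => abs_resolvent_term_le hk n hs le_rfl).congr_right ?_
    intro s hs
    exact (hsum s hs).symm
  have hV : Tendsto (fun N => volterraOp a₀ k (S N) t) atTop
      (𝓝 (volterraOp a₀ k (resolvent a₀ k l) t)) := by
    have hlim : Tendsto (fun n : ℕ => (1 : ℝ) / (n + 1)) atTop (𝓝 0) :=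
      tendsto_one_div_add_atTop_nhds_zero_nat
    rw [Metric.tendsto_atTop]
    intro ε hε
    set K := memoryBound a₀ k t * t
    have hK : 0 ≤ K := mul_nonneg (memoryBound_nonneg ht) ht
    obtain ⟨N, hN⟩ := eventually_atTop.1
      (Metric.tendstoUniformlyOn_iff.1 hunif (ε / (K + 1)) (by positivity))
    refine ⟨N, fun n hn => ?_⟩
    rw [dist_comm, dist_eq_norm, ← volterraOp_sub hk (continuous_resolvent_right hk l) (hScont n)]
    -- The case n = 0 of the factorial estimate is boundedness of V in the supremum norm. The
    -- tolerance ε / (K + 1) keeps the denominator positive when K = 0.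
    have := norm_volterraOp_le (a₀ := a₀) (Y := fun s => resolvent a₀ k l s - S n s)
      (B := ε / (K + 1)) hk (by positivity) 0 (T := t) (fun s hs => by
        simpa [dist_eq_norm] using (hN n hn s hs).le) ⟨ht, le_rfl⟩
    refine this.trans_lt ?_
    have h2 : memoryBound a₀ k t * (ε / (K + 1)) * (t ^ (0 + 1) / ((0 + 1).factorial : ℝ))
        = K * ε / (K + 1) := by simp [K]; ring
    rw [h2, div_lt_iff₀ (by positivity)]
    nlinarith
  have h1 := (hunif.tendsto_at ⟨ht, le_rfl⟩).comp (tendsto_add_atTop_nat 1)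
  have h2 : Tendsto (fun N => S (N + 1) t) atTop
      (𝓝 (1 - l * volterraOp a₀ k (resolvent a₀ k l) t)) := by
    simp only [hsucc]
    exact (hV.const_mul l).const_sub 1
  linarith [tendsto_nhds_unique h1 h2]

theorem hasDerivAt_resolvent (hk : ∀ s t, IntervalIntegrable k volume s t) (l : ℝ) {t : ℝ}
    (ht : 0 < t) :
    HasDerivAt (resolvent a₀ k l) (-l * memoryTerm a₀ k (resolvent a₀ k l) t) t := by
  have h := ((hasDerivAt_volterraOp a₀ hk (continuous_resolvent_right (a₀ := a₀) hk l)
    t).const_mul l).const_sub 1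
  rw [neg_mul]
  refine h.congr_of_eventuallyEq ?_
  filter_upwards [Ioi_mem_nhds ht] with s hs
  linarith [resolvent_add_volterraOp (a₀ := a₀) hk l (le_of_lt hs)]

theorem resolvent_zero_right (hk : ∀ s t, IntervalIntegrable k volume s t) (l : ℝ) :
    resolvent a₀ k l 0 = 1 := by
  have := resolvent_add_volterraOp (a₀ := a₀) hk l le_rfl
  simpa [volterraOp] using this

/-- Uniqueness for the homogeneous scalar Volterra equation. -/
theorem eq_of_add_volterraOp_eq (hk : ∀ s t, IntervalIntegrable k volume s t) (l : ℝ)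
    {x y : ℝ → ℝ} (hx : Continuous x) (hy : Continuous y)
    (h : ∀ t, 0 ≤ t → x t + l * volterraOp a₀ k x t = y t + l * volterraOp a₀ k y t) {t : ℝ}
    (ht : 0 ≤ t) : x t = y t := by
  obtain ⟨C, hC⟩ := (isCompact_Icc (a := 0) (b := t)).exists_bound_of_continuousOn
    (hx.sub hy).continuousOn
  have hC0 : 0 ≤ C := (norm_nonneg _).trans (hC t ⟨ht, le_rfl⟩)
  -- The difference d satisfies d = -l V d, so in the sequence (-l)ⁿ d each member is the Volterra
  -- image of the next.
  have key := eq_zero_of_eq_volterraOp (a₀ := a₀) hk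
    (Y := fun n s => (-l) ^ n • (x s - y s)) hC0 (abs_nonneg l) (T := t)
    (fun n s hs => ?_) (fun n s hs => ?_) ⟨ht, le_rfl⟩
  · simpa [sub_eq_zero] using key
  · rw [volterraOp_const_smul, volterraOp_sub hk hx hy, pow_succ, mul_smul]
    congr 1
    rw [smul_eq_mul]
    linarith [h s hs.1]
  · rw [norm_smul, norm_pow, norm_neg, Real.norm_eq_abs, mul_comm]
    exact mul_le_mul_of_nonneg_right (hC s hs) (by positivity)

end Volterra

/-! ### Fejér kernels, averaged exponentials and the mixture identity. -/

section Positivity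

theorem fourier_exp_neg_abs (v : ℝ) :
    𝓕 (fun t : ℝ => Complex.exp (-(|t| : ℝ))) v = 2 / (1 + (2 * Real.pi * v) ^ 2 : ℝ) := by
  rw [Real.fourier_real_eq_integral_exp_smul]
  set b : ℂ := 2 * Real.pi * v * Complex.I with hb
  have hbre : b.re = 0 := by simp [hb]
  have hr1 : 0 < (1 - b).re := by simp [hbre]
  have hr2 : (-1 - b).re < 0 := by simp [hbre]
  have e1 : EqOn (fun t : ℝ => Complex.exp ((-2 * Real.pi * t * v : ℝ) * Complex.I) •
      Complex.exp (-(|t| : ℝ))) (fun t => Complex.exp ((1 - b) * t)) (Iic 0) := fun t ht => by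
    simp only [smul_eq_mul, abs_of_nonpos (mem_Iic.1 ht), ← Complex.exp_add, hb]
    congr 1; push_cast; ring
  have e2 : EqOn (fun t : ℝ => Complex.exp ((-2 * Real.pi * t * v : ℝ) * Complex.I) •
      Complex.exp (-(|t| : ℝ))) (fun t => Complex.exp ((-1 - b) * t)) (Ioi 0) := fun t ht => by
    simp only [smul_eq_mul, abs_of_pos (mem_Ioi.1 ht), ← Complex.exp_add, hb]
    congr 1; push_cast; ring
  have i1 := (integrableOn_exp_mul_complex_Iic hr1 0).congr_fun e1.symm measurableSet_Iic
  have i2 := (integrableOn_exp_mul_complex_Ioi hr2 0).congr_fun e2.symm measurableSet_Ioi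
  rw [← intervalIntegral.integral_Iic_add_Ioi i1 i2, setIntegral_congr_fun measurableSet_Iic e1,
    setIntegral_congr_fun measurableSet_Ioi e2, integral_exp_mul_complex_Iic hr1,
    integral_exp_mul_complex_Ioi hr2]
  have h1 : 1 - b ≠ 0 := fun h => by rw [h] at hr1; simp at hr1
  have h2 : -1 - b ≠ 0 := fun h => by rw [h] at hr2; simp at hr2
  have h3 : ((1 + (2 * Real.pi * v) ^ 2 : ℝ) : ℂ) = -((1 - b) * (-1 - b)) := by
    rw [hb]; push_cast; ring_nf; rw [Complex.I_sq]; ring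
  rw [h3]
  simp only [Complex.ofReal_zero, mul_zero, Complex.exp_zero]
  field_simp
  ring

/-- This is Fourier inversion for the continuous function e^{-|t|}, whose transform is integrable;
evenness folds the line onto the half line. -/
theorem integral_cos_mul_inv_one_add_sq (x : ℝ) :
    ∫ u in Ioi (0 : ℝ), Real.cos (x * u) * (1 + u ^ 2)⁻¹ =
      Real.pi / 2 * Real.exp (-|x|) := by
  have hpi := Real.pi_pos
  set f : ℝ → ℂ := fun t => Complex.exp (-(|t| : ℝ)) with hf
  have hfc : Continuous f := by fun_prop
  have hfi : Integrable f := by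
    rw [← integrableOn_univ, ← Iic_union_Ioi (a := (0 : ℝ))]
    refine IntegrableOn.union ?_ ?_
    · refine (integrableOn_exp_mul_complex_Iic (a := 1) (by simp) 0).congr_fun (fun t ht => ?_)
        measurableSet_Iic
      simp [hf, abs_of_nonpos (mem_Iic.1 ht)]
    · refine (integrableOn_exp_mul_complex_Ioi (a := -1) (by simp) 0).congr_fun (fun t ht => ?_)
        measurableSet_Ioi
      simp [hf, abs_of_pos (mem_Ioi.1 ht)]
  have hF : 𝓕 f = fun v => ((2 * (1 + (2 * Real.pi * v) ^ 2)⁻¹ : ℝ) : ℂ) := by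
    ext v; rw [fourier_exp_neg_abs]; push_cast; rw [div_eq_mul_inv]
  have hFr : Integrable fun v : ℝ => 2 * (1 + (2 * Real.pi * v) ^ 2)⁻¹ :=
    ((integrable_inv_one_add_sq.comp_mul_left' (by positivity : 2 * Real.pi ≠ 0))).const_mul 2
  have hFi : Integrable (𝓕 f) := by rw [hF]; exact hFr.ofReal
  have h := congrFun (hfc.fourierInv_fourier_eq hfi hFi) x
  rw [Real.fourierInv_eq', hF] at h
  have h2 := congrArg Complex.re h
  have hi : Integrable fun v : ℝ => Complex.exp ((2 * Real.pi * inner ℝ v x : ℝ) * Complex.I) •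
      ((2 * (1 + (2 * Real.pi * v) ^ 2)⁻¹ : ℝ) : ℂ) := by
    refine hFr.ofReal.bdd_mul (c := 1) (by fun_prop) (Eventually.of_forall fun v => ?_)
    rw [Complex.norm_exp_ofReal_mul_I]
  have h3 := integral_re hi
  simp only [RCLike.re_eq_complex_re] at h3
  rw [← h3] at h2
  -- Absolute values are inserted so that the integrand is visibly a function of |u| and the
  -- integral over the line is twice that over the half line.
  have h4 : ∀ v : ℝ, (Complex.exp ((2 * Real.pi * inner ℝ v x : ℝ) * Complex.I) •
      ((2 * (1 + (2 * Real.pi * v) ^ 2)⁻¹ : ℝ) : ℂ)).re =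
      (fun u => 2 * (Real.cos (x * |u|) * (1 + |u| ^ 2)⁻¹)) (2 * Real.pi * v) := fun v => by
    have : Real.cos (x * |2 * Real.pi * v|) = Real.cos (x * (2 * Real.pi * v)) := by
      rcases abs_cases (2 * Real.pi * v) with h | h
      · rw [h.1]
      · rw [h.1, mul_neg, Real.cos_neg]
    simp only [this, sq_abs]
    rw [smul_eq_mul, Complex.re_mul_ofReal, Complex.exp_ofReal_mul_I_re]
    simp only [RCLike.inner_apply, conj_trivial]
    rw [show 2 * Real.pi * (x * v) = x * (2 * Real.pi * v) by ring]
    ring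
  rw [integral_congr_ae (Eventually.of_forall h4), Measure.integral_comp_mul_left
    (fun u => 2 * (Real.cos (x * |u|) * (1 + |u| ^ 2)⁻¹)),
    integral_comp_abs (f := fun u => 2 * (Real.cos (x * u) * (1 + u ^ 2)⁻¹)),
    integral_const_mul, hf] at h2
  simp only [← Complex.ofReal_neg, ← Complex.ofReal_exp, Complex.ofReal_re] at h2
  rw [smul_eq_mul,
    abs_of_pos (by positivity)] at h2
  rw [← h2]
  field_simp

theorem integral_cos_mul_inv_four_add_sq {x : ℝ} (hx : 0 ≤ x) :
    ∫ u in Ioi (0 : ℝ), Real.cos (x * u) * (4 + u ^ 2)⁻¹ =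
      Real.pi / 4 * Real.exp (-(2 * x)) := by
  have h := integral_comp_mul_left_Ioi
    (fun u => Real.cos (x * u) * (4 + u ^ 2)⁻¹) 0 (b := 2) (by norm_num)
  have h2 : ∀ u : ℝ, Real.cos (x * (2 * u)) * (4 + (2 * u) ^ 2)⁻¹ =
      1 / 4 * (Real.cos (2 * x * u) * (1 + u ^ 2)⁻¹) := fun u => by
    rw [show x * (2 * u) = 2 * x * u by ring, show 4 + (2 * u) ^ 2 = 4 * (1 + u ^ 2) by ring,
      mul_inv]
    ring
  simp only [h2, mul_zero, smul_eq_mul] at h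
  rw [integral_const_mul, integral_cos_mul_inv_one_add_sq, abs_of_nonneg (by positivity)] at h
  linarith

theorem integrable_inv_four_add_sq : Integrable fun u : ℝ => (4 + u ^ 2)⁻¹ := by
  refine integrable_inv_one_add_sq.mono' (by fun_prop) (Eventually.of_forall fun u => ?_)
  rw [Real.norm_eq_abs, abs_of_pos (by positivity)]
  gcongr
  norm_num

/-- The Fejér-type kernel `2 (1 - cos x) / x²`. -/
noncomputable def fejer (x : ℝ) : ℝ := 2 * (1 - Real.cos x) / x ^ 2

/-- The averaged exponential `(1 - e^{-x}) / x`. -/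
noncomputable def expMean (x : ℝ) : ℝ := (1 - Real.exp (-x)) / x

/-- The probability density through which `expMean ^ 2` is a mixture of dilated `fejer` kernels. -/
noncomputable def mixDensity (u : ℝ) : ℝ :=
  2 / Real.pi * (4 * (4 + u ^ 2)⁻¹ - (1 + u ^ 2)⁻¹)

theorem fejer_nonneg (x : ℝ) : 0 ≤ fejer x :=
  div_nonneg (by linarith [Real.cos_le_one x]) (sq_nonneg _)

theorem fejer_le_one (x : ℝ) : fejer x ≤ 1 := by
  rcases eq_or_ne x 0 with rfl | hx
  · simp [fejer]
  · rw [fejer, div_le_one (by positivity)]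
    linarith [Real.one_sub_sq_div_two_le_cos (x := x)]

theorem fejer_mul_sq_le (x : ℝ) : fejer x * x ^ 2 ≤ 4 := by
  rcases eq_or_ne x 0 with rfl | hx
  · simp
  · rw [fejer, div_mul_cancel₀ _ (by positivity)]
    linarith [Real.neg_one_le_cos x]

theorem fejer_mul_le {δ : ℝ} (hδ : δ ≠ 0) (t : ℝ) :
    fejer (δ * t) ≤ (1 + 4 / δ ^ 2) * (1 + t ^ 2)⁻¹ := by
  rw [← div_eq_mul_inv, le_div_iff₀ (by positivity)]
  have h1 := fejer_le_one (δ * t)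
  have h2 := fejer_mul_sq_le (δ * t)
  have h3 : fejer (δ * t) * t ^ 2 ≤ 4 / δ ^ 2 := by
    rw [le_div_iff₀ (by positivity)]
    calc _ = fejer (δ * t) * (δ * t) ^ 2 := by ring
      _ ≤ 4 := h2
  linarith

theorem measurable_fejer : Measurable fejer := by unfold fejer; fun_prop

/-- This form shows nonnegativity, and its factor u² cancels the singularity of `fejer` at 0. -/
theorem mixDensity_eq (u : ℝ) :
    mixDensity u = 6 / Real.pi * (u ^ 2 * ((4 + u ^ 2)⁻¹ * (1 + u ^ 2)⁻¹)) := by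
  rw [mixDensity]
  have : 4 + u ^ 2 ≠ 0 := by positivity
  have : 1 + u ^ 2 ≠ 0 := by positivity
  field_simp
  ring

theorem mixDensity_nonneg (u : ℝ) : 0 ≤ mixDensity u := by
  have := Real.pi_pos
  rw [mixDensity_eq]; positivity

theorem integrable_mixDensity : Integrable mixDensity :=
  ((integrable_inv_four_add_sq.const_mul 4).sub integrable_inv_one_add_sq).const_mul _

theorem measurable_mixDensity : Measurable mixDensity := by unfold mixDensity; fun_prop

theorem integral_mixDensity : ∫ u in Ioi (0 : ℝ), mixDensity u = 1 := by
  have h1 := integral_cos_mul_inv_one_add_sq 0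
  have h4 := integral_cos_mul_inv_four_add_sq le_rfl
  simp only [zero_mul, Real.cos_zero, one_mul, abs_zero, neg_zero, Real.exp_zero, mul_one,
    mul_zero] at h1 h4
  simp only [mixDensity]
  rw [integral_const_mul, integral_sub (integrable_inv_four_add_sq.const_mul 4).integrableOn
    integrable_inv_one_add_sq.integrableOn, integral_const_mul, h1, h4]
  have := Real.pi_pos
  field_simp
  norm_num

/-- Partial fractions reduce the integral to the two cosine integrals above, which combine to 1 -
2e^{-x} + e^{-2x} = (1 - e^{-x})². No nonnegative density could represent e^{-x} itself in this way,
because x²e^{-x} → 0 as x → ∞; this is why the square of the averaged exponential is used. -/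
theorem integral_fejer_mul_mixDensity {x : ℝ} (hx : 0 < x) :
    ∫ u in Ioi (0 : ℝ), fejer (x * u) * mixDensity u = expMean x ^ 2 := by
  have hpi := Real.pi_pos
  have e : ∀ u ∈ Ioi (0 : ℝ), fejer (x * u) * mixDensity u = 4 / (Real.pi * x ^ 2) *
      (((1 + u ^ 2)⁻¹ - (4 + u ^ 2)⁻¹) -
        (Real.cos (x * u) * (1 + u ^ 2)⁻¹ - Real.cos (x * u) * (4 + u ^ 2)⁻¹)) := fun u hu => by
    have hu : 0 < u := hu
    rw [mixDensity_eq, fejer]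
    have : 4 + u ^ 2 ≠ 0 := by positivity
    have : 1 + u ^ 2 ≠ 0 := by positivity
    field_simp
    ring
  have c1 : Integrable fun u : ℝ => Real.cos (x * u) * (1 + u ^ 2)⁻¹ :=
    integrable_inv_one_add_sq.bdd_mul (c := 1) (by fun_prop)
      (Eventually.of_forall fun u => Real.abs_cos_le_one _)
  have c4 : Integrable fun u : ℝ => Real.cos (x * u) * (4 + u ^ 2)⁻¹ :=
    integrable_inv_four_add_sq.bdd_mul (c := 1) (by fun_prop)
      (Eventually.of_forall fun u => Real.abs_cos_le_one _)
  have h1 := integral_cos_mul_inv_one_add_sq 0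
  have h4 := integral_cos_mul_inv_four_add_sq le_rfl
  simp only [zero_mul, Real.cos_zero, one_mul, abs_zero, neg_zero, Real.exp_zero, mul_one,
    mul_zero] at h1 h4
  have d1 : Integrable fun u : ℝ => (1 + u ^ 2)⁻¹ - (4 + u ^ 2)⁻¹ :=
    integrable_inv_one_add_sq.sub integrable_inv_four_add_sq
  have d4 : Integrable fun u : ℝ =>
      Real.cos (x * u) * (1 + u ^ 2)⁻¹ - Real.cos (x * u) * (4 + u ^ 2)⁻¹ := c1.sub c4
  rw [setIntegral_congr_fun measurableSet_Ioi e, integral_const_mul, integral_sub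
    d1.integrableOn d4.integrableOn, integral_sub integrable_inv_one_add_sq.integrableOn
    integrable_inv_four_add_sq.integrableOn, integral_sub c1.integrableOn c4.integrableOn,
    h1, h4, integral_cos_mul_inv_one_add_sq, integral_cos_mul_inv_four_add_sq hx.le,
    abs_of_pos hx, expMean, show -(2 * x) = -x + -x by ring, Real.exp_add]
  field_simp
  ring

theorem integrableOn_fejer_mul_mixDensity (x : ℝ) :
    IntegrableOn (fun u => fejer (x * u) * mixDensity u) (Ioi 0) :=
  integrable_mixDensity.integrableOn.bdd_mul (c := 1)
    (measurable_fejer.comp (measurable_const_mul x)).aestronglyMeasurable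
    (Eventually.of_forall fun u => by
      rw [Real.norm_eq_abs, abs_of_nonneg (fejer_nonneg _)]; exact fejer_le_one _)

theorem integral_exp_neg_mul_Ioc {x : ℝ} (hx : x ≠ 0) :
    ∫ s in Ioc (0 : ℝ) 1, Real.exp (-(x * s)) = expMean x := by
  rw [← intervalIntegral.integral_of_le zero_le_one]
  have h := intervalIntegral.integral_comp_mul_left (a := 0) (b := 1) (fun s => Real.exp s)
    (neg_ne_zero.2 hx)
  simp only [neg_mul, mul_zero, mul_one, integral_exp, Real.exp_zero, smul_eq_mul] at h
  rw [h, expMean]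
  field_simp
  ring

theorem expMean_nonneg {x : ℝ} (hx : 0 < x) : 0 ≤ expMean x :=
  div_nonneg (by rw [sub_nonneg, Real.exp_le_one_iff]; linarith) hx.le

theorem expMean_sq_mul_le {h t : ℝ} (hh : 0 < h) (ht : 0 < t) :
    expMean (h * t) ^ 2 ≤ (1 + 1 / h ^ 2) * (1 + t ^ 2)⁻¹ := by
  have hx : 0 < h * t := mul_pos hh ht
  have h0 := expMean_nonneg hx
  have h1 : expMean (h * t) ≤ 1 := by
    rw [expMean, div_le_one hx]
    linarith [Real.add_one_le_exp (-(h * t))]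
  have h2 : expMean (h * t) * (h * t) ≤ 1 := by
    rw [expMean, div_mul_cancel₀ _ hx.ne']
    linarith [Real.exp_pos (-(h * t))]
  rw [← div_eq_mul_inv, le_div_iff₀ (by positivity)]
  have h3 : expMean (h * t) ^ 2 * t ^ 2 ≤ 1 / h ^ 2 := by
    rw [le_div_iff₀ (by positivity)]
    calc _ = (expMean (h * t) * (h * t)) ^ 2 := by ring
      _ ≤ 1 := pow_le_one₀ (by positivity) h2
  nlinarith

/-- Fubini for averages of `∫ β(t) K(x, t) dt` with a nonnegative kernel `K`. -/
theorem integral_mixture {X : Type*} [MeasurableSpace X] {μ : Measure X} [SFinite μ]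
    {β κ : ℝ → ℝ} {K : X → ℝ → ℝ} {C : ℝ}
    (hβ : IntegrableOn (fun t => β t * (1 + t ^ 2)⁻¹) (Ioi 0))
    (hK : Measurable (Function.uncurry K)) (hpos : ∀ x, ∀ t, 0 < t → 0 ≤ K x t)
    (hint : ∀ t, 0 < t → Integrable (fun x => K x t) μ)
    (hκ : ∀ t, 0 < t → ∫ x, K x t ∂μ = κ t)
    (hC : ∀ t, 0 < t → κ t ≤ C * (1 + t ^ 2)⁻¹) :
    Integrable (fun x => ∫ t in Ioi (0 : ℝ), β t * K x t) μ ∧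
      ∫ x, (∫ t in Ioi (0 : ℝ), β t * K x t) ∂μ = ∫ t in Ioi (0 : ℝ), β t * κ t := by
  -- Only the weighted function is known to be integrable; multiplying the weight back recovers
  -- measurability.
  have hβm : AEStronglyMeasurable β (volume.restrict (Ioi 0)) := by
    have h := hβ.aestronglyMeasurable.mul
      (by fun_prop : Continuous fun t : ℝ => 1 + t ^ 2).aestronglyMeasurable
    refine h.congr (Eventually.of_forall fun t => ?_)
    have : 1 + t ^ 2 ≠ 0 := by positivity
    simp only [Pi.mul_apply]
    field_simp
  have hnorm : ∀ t, 0 < t → ∫ x, ‖β t * K x t‖ ∂μ = ‖β t‖ * κ t := fun t ht => by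
    rw [← hκ t ht, ← integral_const_mul]
    congr 1
    ext x
    rw [norm_mul, Real.norm_of_nonneg (hpos x t ht)]
  have hκ0 : ∀ t, 0 < t → 0 ≤ κ t := fun t ht => by
    rw [← hκ t ht]; exact integral_nonneg fun x => hpos x t ht
  have hF : Integrable (fun p : ℝ × X => β p.1 * K p.2 p.1)
      ((volume.restrict (Ioi 0)).prod μ) := by
    have hm : AEStronglyMeasurable (fun p : ℝ × X => β p.1 * K p.2 p.1)
        ((volume.restrict (Ioi 0)).prod μ) :=
      hβm.comp_fst.mul (hK.comp measurable_swap).aestronglyMeasurable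
    rw [integrable_prod_iff hm]
    constructor
    · filter_upwards [ae_restrict_mem measurableSet_Ioi] with t ht
      exact (hint t ht).const_mul _
    · refine (hβ.norm.const_mul C).mono' hm.norm.integral_prod_right' ?_
      filter_upwards [ae_restrict_mem measurableSet_Ioi] with t ht
      rw [hnorm t ht, norm_mul, norm_norm, norm_mul, Real.norm_of_nonneg (hκ0 t ht),
        Real.norm_of_nonneg (by positivity : (0 : ℝ) ≤ (1 + t ^ 2)⁻¹)]
      calc ‖β t‖ * κ t ≤ ‖β t‖ * (C * (1 + t ^ 2)⁻¹) := by
            gcongr; exact hC t ht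
        _ = _ := by ring
  refine ⟨hF.integral_prod_right, ?_⟩
  rw [← integral_integral_swap (f := fun t x => β t * K x t) hF]
  refine setIntegral_congr_fun measurableSet_Ioi fun t ht => ?_
  rw [integral_const_mul, hκ t ht]

end Positivity

/-! ### Convexity from symmetric second differences. -/

section Convexity

/-- A continuous function whose upper second symmetric derivative is everywhere nonnegative is
midpoint convex. -/
theorem midpoint_convex_of_symmetric_deriv {g : ℝ → ℝ} (hg : Continuous g)
    (h : ∀ x m δ₀ : ℝ, 0 < m → 0 < δ₀ →
      ∃ δ, 0 < δ ∧ δ < δ₀ ∧ -m * δ ^ 2 < g (x + δ) + g (x - δ) - 2 * g x) (x r : ℝ) (hr : 0 < r) :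
    0 ≤ g (x + r) + g (x - r) - 2 * g x := by
  by_contra! hneg
  set η := -(g (x + r) + g (x - r) - 2 * g x) with hη
  have hη0 : 0 < η := by linarith
  set ε := η / (4 * r ^ 2) with hε
  have hε0 : 0 < ε := by positivity
  have hεr : ε * r ^ 2 = η / 4 := by rw [hε]; field_simp
  -- Subtract the chord and add a parabola that vanishes at both ends. The parabola costs εr² = η/4
  -- at the centre, so f x = η/4 is still positive and f has an interior maximum y. There the second
  -- difference of f is at most 0, so that of g is at most -2εδ², against the hypothesis with m =
  -- 2ε.
  set f : ℝ → ℝ := fun y => g y - (g (x + r) + g (x - r)) / 2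
    - (g (x + r) - g (x - r)) / (2 * r) * (y - x) + ε * ((y - x) ^ 2 - r ^ 2) with hf
  have hfc : Continuous f := by fun_prop
  have hfx : f x = η / 4 := by
    simp only [hf]; rw [sub_self, hη] at *; linarith
  have hfr : f (x + r) = 0 := by
    simp only [hf]; rw [add_sub_cancel_left]; field_simp; ring
  have hfl : f (x - r) = 0 := by
    simp only [hf]; rw [sub_sub_cancel_left]; field_simp; ring
  obtain ⟨y, hy, hmax⟩ := (isCompact_Icc (a := x - r) (b := x + r)).exists_isMaxOn
    ⟨x, by constructor <;> linarith⟩ hfc.continuousOn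
  have hfy : 0 < f y := by
    have := hmax (show x ∈ Icc (x - r) (x + r) by constructor <;> linarith)
    simp only [mem_ofPred_eq] at this
    linarith
  have hy1 : x - r < y := lt_of_le_of_ne hy.1 fun h => by rw [← h, hfl] at hfy; exact hfy.false
  have hy2 : y < x + r := lt_of_le_of_ne hy.2 fun h => by rw [h, hfr] at hfy; exact hfy.false
  obtain ⟨δ, hδ0, hδ, hlt⟩ := h y (2 * ε) (min (y - (x - r)) (x + r - y)) (by positivity)
    (lt_min (by linarith) (by linarith))
  have h1 := hδ.trans_le (min_le_left _ _)
  have h2 := hδ.trans_le (min_le_right _ _)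
  have m1 := hmax (show y + δ ∈ Icc (x - r) (x + r) by constructor <;> linarith)
  have m2 := hmax (show y - δ ∈ Icc (x - r) (x + r) by constructor <;> linarith)
  simp only [mem_ofPred_eq, hf] at m1 m2
  nlinarith

end Convexity

/-! ### Comparison of Abel and Fejér means. -/

section Rajchman

variable {β : ℝ → ℝ}

theorem integrableOn_mul_of_le (hβ : IntegrableOn (fun t => β t * (1 + t ^ 2)⁻¹) (Ioi 0))
    {κ : ℝ → ℝ} (hκm : Measurable κ) {C : ℝ}
    (hC : ∀ t, 0 < t → |κ t| ≤ C * (1 + t ^ 2)⁻¹) :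
    IntegrableOn (fun t => β t * κ t) (Ioi 0) := by
  have h : IntegrableOn (fun t => (κ t * (1 + t ^ 2)) * (β t * (1 + t ^ 2)⁻¹)) (Ioi 0) := by
    refine Integrable.bdd_mul (c := C) hβ (by fun_prop) ?_
    filter_upwards [ae_restrict_mem measurableSet_Ioi] with t ht
    have := hC t ht
    rw [← div_eq_mul_inv, le_div_iff₀ (by positivity)] at this
    rwa [norm_mul, Real.norm_eq_abs, Real.norm_of_nonneg (by positivity)]
  refine h.congr (Eventually.of_forall fun t => ?_)
  have : 1 + t ^ 2 ≠ 0 := by positivity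
  simp only
  field_simp

theorem abs_integral_fejer_le (hβ : IntegrableOn (fun t => β t * (1 + t ^ 2)⁻¹) (Ioi 0)) {δ : ℝ}
    (hδ : δ ≠ 0) : |∫ t in Ioi (0 : ℝ), β t * fejer (δ * t)| ≤
      (1 + 4 / δ ^ 2) * ∫ t in Ioi (0 : ℝ), ‖β t * (1 + t ^ 2)⁻¹‖ := by
  rw [← integral_const_mul, ← Real.norm_eq_abs]
  refine norm_integral_le_of_norm_le (hβ.norm.const_mul _) (Eventually.of_forall fun t => ?_)
  rw [norm_mul, norm_mul, Real.norm_of_nonneg (fejer_nonneg _),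
    Real.norm_of_nonneg (by positivity : (0 : ℝ) ≤ (1 + t ^ 2)⁻¹)]
  calc ‖β t‖ * fejer (δ * t) ≤ ‖β t‖ * ((1 + 4 / δ ^ 2) * (1 + t ^ 2)⁻¹) := by
        gcongr; exact fejer_mul_le hδ t
    _ = _ := by ring

/-- Since `expMean` is the average of e^{-xs} over s in (0, 1], its square at ht is the average of
e^{-h(p₁ + p₂)t} over the unit square. Every parameter h(p₁ + p₂) is at most 2h < h₀, so the lower
bound for the Abel means survives averaging. -/
theorem le_expMean_mean (hβ : IntegrableOn (fun t => β t * (1 + t ^ 2)⁻¹) (Ioi 0)) {a₀ m h₀ : ℝ}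
    (hL : ∀ h, 0 < h → h < h₀ → m ≤ a₀ + ∫ t in Ioi (0 : ℝ), β t * Real.exp (-(h * t)))
    {h : ℝ} (hh : 0 < h) (hh₀ : 2 * h < h₀) :
    m ≤ a₀ + ∫ t in Ioi (0 : ℝ), β t * expMean (h * t) ^ 2 := by
  set μ : Measure (ℝ × ℝ) := (volume.restrict (Ioc 0 1)).prod (volume.restrict (Ioc 0 1)) with hμ
  have hprob : IsProbabilityMeasure (volume.restrict (Ioc (0 : ℝ) 1)) := ⟨by simp⟩
  have hmem : ∀ᵐ p ∂μ, p ∈ Ioc (0 : ℝ) 1 ×ˢ Ioc (0 : ℝ) 1 := by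
    rw [hμ, Measure.prod_restrict]
    exact ae_restrict_mem (measurableSet_Ioc.prod measurableSet_Ioc)
  have hi : ∀ x : ℝ, IntegrableOn (fun s => Real.exp (-(x * s))) (Ioc 0 1) := fun x =>
    (Continuous.integrableOn_Icc (by fun_prop)).mono_set Ioc_subset_Icc_self
  have hK : ∀ t : ℝ, (fun p : ℝ × ℝ => Real.exp (-(h * (p.1 + p.2) * t))) =
      fun p => Real.exp (-(h * t * p.1)) * Real.exp (-(h * t * p.2)) := fun t => by
    ext p; rw [← Real.exp_add]; congr 1; ring
  obtain ⟨hmi, hmix⟩ := integral_mixture (μ := μ) (κ := fun t => expMean (h * t) ^ 2)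
    (K := fun p t => Real.exp (-(h * (p.1 + p.2) * t))) (C := 1 + 1 / h ^ 2) hβ
    (by fun_prop) (fun _ _ _ => (Real.exp_pos _).le)
    (fun t _ => by rw [hK]; exact (hi _).mul_prod (hi _))
    (fun t ht => by
      rw [hK, hμ, integral_prod_mul (fun x => Real.exp (-(h * t * x)))
        (fun x => Real.exp (-(h * t * x))), integral_exp_neg_mul_Ioc (mul_pos hh ht).ne', sq])
    (fun t ht => expMean_sq_mul_le hh ht)
  rw [← hmix]
  have h1 : m - a₀ = ∫ _ : ℝ × ℝ, (m - a₀) ∂μ := by simp [hμ]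
  have h2 : m - a₀ ≤ ∫ p, (∫ t in Ioi (0 : ℝ), β t * Real.exp (-(h * (p.1 + p.2) * t))) ∂μ := by
    rw [h1]
    refine integral_mono_ae (integrable_const _) hmi ?_
    filter_upwards [hmem] with p hp
    have hp1 := hp.1.1
    have hp2 := hp.2.1
    have hp3 : p.1 ≤ 1 := hp.1.2
    have hp4 : p.2 ≤ 1 := hp.2.2
    have := hL (h * (p.1 + p.2)) (by positivity) (by nlinarith)
    linarith
  linarith

/-- The same quantity is an average of Fejér means with step hu, where u has density `mixDensity`.
Steps below δ₀ contribute at most -m; the others are bounded uniformly, and the mass of u ≥ δ₀/h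
vanishes as h → 0. -/
theorem expMean_mean_tendsto_neg
    (hβ : IntegrableOn (fun t => β t * (1 + t ^ 2)⁻¹) (Ioi 0)) {a₀ m δ₀ : ℝ} (hδ₀ : 0 < δ₀)
    (hD : ∀ δ, 0 < δ → δ < δ₀ → a₀ + ∫ t in Ioi (0 : ℝ), β t * fejer (δ * t) ≤ -m) {ε : ℝ}
    (hε : 0 < ε) :
    ∃ h₁ > 0, ∀ h, 0 < h → h < h₁ →
      a₀ + ∫ t in Ioi (0 : ℝ), β t * expMean (h * t) ^ 2 ≤ -m + ε := by
  set I := ∫ t in Ioi (0 : ℝ), ‖β t * (1 + t ^ 2)⁻¹‖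
  set C' := |a₀| + (1 + 4 / δ₀ ^ 2) * I
  -- This majorises the averaged integrand: `hD` is used while hu < δ₀, and the crude bound C'
  -- afterwards.
  set g : ℝ → ℝ → ℝ := fun h u => mixDensity u * if h * u < δ₀ then -m else C'
  have hgm : ∀ h, Measurable (g h) := fun h => measurable_mixDensity.mul
    (Measurable.ite (measurableSet_lt (by fun_prop) (by fun_prop)) (by fun_prop) (by fun_prop))
  have hgb : ∀ h u, ‖g h u‖ ≤ mixDensity u * (|m| + |C'|) := fun h u => by
    rw [norm_mul, Real.norm_of_nonneg (mixDensity_nonneg u)]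
    refine mul_le_mul_of_nonneg_left ?_ (mixDensity_nonneg u)
    split_ifs
    · rw [norm_neg, Real.norm_eq_abs]; linarith [abs_nonneg C']
    · rw [Real.norm_eq_abs]; linarith [abs_nonneg m]
  have hlim : Tendsto (fun h => ∫ u in Ioi (0 : ℝ), g h u) (𝓝[>] 0) (𝓝 (-m)) := by
    have h0 : ∫ u in Ioi (0 : ℝ), mixDensity u * (-m) = -m := by
      rw [integral_mul_const, integral_mixDensity, one_mul]
    rw [← h0]
    refine tendsto_integral_filter_of_dominated_convergence
      (fun u => mixDensity u * (|m| + |C'|))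
      (Eventually.of_forall fun h => (hgm h).aestronglyMeasurable)
      (Eventually.of_forall fun h => Eventually.of_forall (hgb h))
      (integrable_mixDensity.integrableOn.mul_const _) (Eventually.of_forall fun u => ?_)
    refine tendsto_const_nhds.congr' ?_
    have : Tendsto (fun h : ℝ => h * u) (𝓝[>] 0) (𝓝 0) := by
      have : Tendsto (fun h : ℝ => h * u) (𝓝 0) (𝓝 (0 * u)) :=
        Continuous.tendsto (by fun_prop) _
      rw [zero_mul] at this
      exact this.mono_left nhdsWithin_le_nhds
    filter_upwards [this.eventually (gt_mem_nhds hδ₀)] with h hh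
    simp only [g, if_pos hh]
  have hev := hlim.eventually (gt_mem_nhds (show -m < -m + ε by linarith))
  obtain ⟨h₁, hh₁, hsub⟩ := (mem_nhdsGT_iff_exists_Ioo_subset).1 hev
  refine ⟨h₁, hh₁, fun h hh hlt => ?_⟩
  refine le_trans ?_ (show (∫ u in Ioi (0 : ℝ), g h u) < -m + ε from hsub ⟨hh, hlt⟩).le
  obtain ⟨hmi, hmix⟩ := integral_mixture (μ := volume.restrict (Ioi (0 : ℝ)))
    (κ := fun t => expMean (h * t) ^ 2)
    (K := fun u t => fejer (h * t * u) * mixDensity u) (C := 1 + 1 / h ^ 2) hβ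
    ((measurable_fejer.comp (by fun_prop)).mul (measurable_mixDensity.comp measurable_fst))
    (fun _ _ _ => mul_nonneg (fejer_nonneg _) (mixDensity_nonneg _))
    (fun t _ => integrableOn_fejer_mul_mixDensity _)
    (fun t ht => integral_fejer_mul_mixDensity (mul_pos hh ht))
    (fun t ht => expMean_sq_mul_le hh ht)
  -- The density has total mass one, so the constant a₀ can be moved inside the average.
  have ha : a₀ = ∫ u in Ioi (0 : ℝ), a₀ * mixDensity u := by
    rw [integral_const_mul, integral_mixDensity, mul_one]
  rw [← hmix]
  nth_rewrite 1 [ha]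
  rw [← integral_add (integrable_mixDensity.integrableOn.const_mul _) hmi]
  refine integral_mono_ae ((integrable_mixDensity.integrableOn.const_mul _).add hmi)
    ((integrable_mixDensity.integrableOn.mul_const _).mono' (hgm h).aestronglyMeasurable
      (Eventually.of_forall (hgb h))) ?_
  filter_upwards [ae_restrict_mem measurableSet_Ioi] with u hu
  have hhu : 0 < h * u := mul_pos hh hu
  have e : ∫ t in Ioi (0 : ℝ), β t * (fejer (h * t * u) * mixDensity u) =
      (∫ t in Ioi (0 : ℝ), β t * fejer (h * u * t)) * mixDensity u := by
    rw [← integral_mul_const]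
    congr 1
    ext t
    rw [show h * t * u = h * u * t by ring]; ring
  rw [e]
  have : a₀ * mixDensity u + (∫ t in Ioi (0 : ℝ), β t * fejer (h * u * t)) * mixDensity u =
      mixDensity u * (a₀ + ∫ t in Ioi (0 : ℝ), β t * fejer (h * u * t)) := by ring
  rw [this]
  refine mul_le_mul_of_nonneg_left ?_ (mixDensity_nonneg u)
  split_ifs with hc
  · exact hD _ hhu hc
  · push Not at hc
    have h1 := abs_integral_fejer_le hβ hhu.ne'
    have h2 : (1 + 4 / (h * u) ^ 2) * I ≤ (1 + 4 / δ₀ ^ 2) * I := by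
      have : 0 ≤ I := integral_nonneg fun _ => norm_nonneg _
      gcongr
    linarith [le_abs_self a₀, le_abs_self (∫ t in Ioi (0 : ℝ), β t * fejer (h * u * t))]

/-- If the Abel means have nonnegative lower limit, the Fejér means cannot stay below a negative
constant. -/
theorem exists_fejer_mean_gt
    (hβ : IntegrableOn (fun t => β t * (1 + t ^ 2)⁻¹) (Ioi 0)) {a₀ m δ₀ : ℝ}
    (hL : ∀ ε > 0, ∀ᶠ h in 𝓝[>] (0 : ℝ),
      -ε ≤ a₀ + ∫ t in Ioi (0 : ℝ), β t * Real.exp (-(h * t)))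
    (hm : 0 < m) (hδ₀ : 0 < δ₀) :
    ∃ δ, 0 < δ ∧ δ < δ₀ ∧ -m < a₀ + ∫ t in Ioi (0 : ℝ), β t * fejer (δ * t) := by
  by_contra! hD
  -- With both errors equal to m/4, the same mean is at most -3m/4 and at least -m/4.
  obtain ⟨h₁, hh₁, hup⟩ := expMean_mean_tendsto_neg hβ hδ₀ hD (show 0 < m / 4 by positivity)
  obtain ⟨h₀, hh₀, hsub⟩ := mem_nhdsGT_iff_exists_Ioo_subset.1 (hL (m / 4) (by positivity))
  have hh₀ : 0 < h₀ := hh₀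
  set h := min (h₁ / 2) (h₀ / 4)
  have hh : 0 < h := lt_min (by linarith) (by linarith)
  have e1 : h < h₁ := (min_le_left _ _).trans_lt (by linarith)
  have e2 : 2 * h < h₀ := by linarith [min_le_right (h₁ / 2) (h₀ / 4)]
  have := hup h hh e1
  have := le_expMean_mean hβ (m := -(m / 4)) (fun h h0 h1 => hsub ⟨h0, h1⟩) hh e2
  linarith

/-- Nonnegativity of the Fejér means of the cosine transform, given nonnegative Abel limits. -/
theorem fejer_mean_nonneg {k : ℝ → ℝ}
    (hk : IntegrableOn (fun t => k t * (1 + t ^ 2)⁻¹) (Ioi 0)) {a₀ : ℝ}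
    (hL : ∀ w : ℝ, ∀ ε > 0, ∀ᶠ h in 𝓝[>] (0 : ℝ),
      -ε ≤ a₀ + ∫ t in Ioi (0 : ℝ), k t * Real.cos (w * t) * Real.exp (-(h * t)))
    (w : ℝ) {δ : ℝ} (hδ : 0 < δ) :
    0 ≤ a₀ + ∫ t in Ioi (0 : ℝ), k t * Real.cos (w * t) * fejer (δ * t) := by
  have hβ : ∀ w : ℝ,
      IntegrableOn (fun t => k t * Real.cos (w * t) * (1 + t ^ 2)⁻¹) (Ioi 0) := fun w => by
    refine (hk.bdd_mul (c := 1) (f := fun t => Real.cos (w * t)) (by fun_prop)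
      (Eventually.of_forall fun t => Real.abs_cos_le_one _)).congr
      (Eventually.of_forall fun t => ?_)
    simp only
    ring
  -- Formally g'' is the cosine transform a₀ + ∫ k(t) cos(wt) dt. Since (w²/2) fejer(wt) = (1 - cos
  -- wt)/t² for t > 0, the double integration yields an absolutely convergent integral.
  set g : ℝ → ℝ := fun w => a₀ * w ^ 2 / 2 +
    ∫ t in Ioi (0 : ℝ), k t * ((w ^ 2 / 2) * fejer (w * t)) with hgdef
  have hfb : ∀ w t : ℝ, 0 < t → (w ^ 2 / 2) * fejer (w * t) ≤ (w ^ 2 / 2 + 2) * (1 + t ^ 2)⁻¹ :=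
    fun w t ht => by
      rcases eq_or_ne w 0 with rfl | hw
      · simp; positivity
      · calc _ ≤ (w ^ 2 / 2) * ((1 + 4 / w ^ 2) * (1 + t ^ 2)⁻¹) := by
              gcongr; exact fejer_mul_le hw t
          _ = _ := by field_simp; ring
  have hfm : ∀ w : ℝ, Measurable fun t => (w ^ 2 / 2) * fejer (w * t) := fun w =>
    (measurable_fejer.comp (by fun_prop)).const_mul _
  have hfi : ∀ w : ℝ, IntegrableOn (fun t => k t * ((w ^ 2 / 2) * fejer (w * t))) (Ioi 0) :=
    fun w => integrableOn_mul_of_le hk (hfm w) (C := w ^ 2 / 2 + 2) fun t ht => by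
      rw [abs_of_nonneg (mul_nonneg (by positivity) (fejer_nonneg _))]
      exact hfb w t ht
  have hfe : ∀ w t : ℝ, 0 < t → (w ^ 2 / 2) * fejer (w * t) = (1 - Real.cos (w * t)) / t ^ 2 :=
    fun w t ht => by
      rcases eq_or_ne w 0 with rfl | hw
      · simp
      · rw [fejer]; field_simp
  have hgc : Continuous g := by
    refine Continuous.add (by fun_prop) ?_
    rw [continuous_iff_continuousAt]
    intro w
    refine continuousAt_of_dominated (bound := fun t => ‖k t * (1 + t ^ 2)⁻¹‖ * ((|w| + 1) ^ 2 + 2))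
      (Eventually.of_forall fun v => (hfi v).aestronglyMeasurable) ?_ (hk.norm.mul_const _) ?_
    · have hb : ∀ᶠ v in 𝓝 w, |v| < |w| + 1 := continuous_abs.continuousAt.eventually
        (gt_mem_nhds (lt_add_one _))
      filter_upwards [hb] with v hv
      filter_upwards [ae_restrict_mem measurableSet_Ioi] with t ht
      have hvw : v ^ 2 ≤ (|w| + 1) ^ 2 := by
        rw [← sq_abs v]; gcongr
      rw [norm_mul, norm_mul (k t), Real.norm_of_nonneg (by positivity : (0 : ℝ) ≤ (1 + t ^ 2)⁻¹),
        Real.norm_of_nonneg (mul_nonneg (by positivity) (fejer_nonneg _)), mul_assoc]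
      refine mul_le_mul_of_nonneg_left ((hfb v t ht).trans ?_) (norm_nonneg _)
      rw [mul_comm]
      gcongr
      nlinarith
    · filter_upwards [ae_restrict_mem measurableSet_Ioi] with t ht
      have : (fun v : ℝ => k t * ((v ^ 2 / 2) * fejer (v * t))) =
          fun v => k t * ((1 - Real.cos (v * t)) / t ^ 2) := by
        ext v; rw [hfe v t ht]
      rw [this]
      fun_prop
  have hsecond : ∀ w δ : ℝ, 0 < δ → g (w + δ) + g (w - δ) - 2 * g w =
      δ ^ 2 * (a₀ + ∫ t in Ioi (0 : ℝ), k t * Real.cos (w * t) * fejer (δ * t)) :=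
    fun w δ hδ => by
      have e : ∫ t in Ioi (0 : ℝ), k t * Real.cos (w * t) * fejer (δ * t) =
          ∫ t in Ioi (0 : ℝ), (δ ^ 2)⁻¹ * (k t * (((w + δ) ^ 2 / 2) * fejer ((w + δ) * t)) +
            k t * (((w - δ) ^ 2 / 2) * fejer ((w - δ) * t)) -
            2 * (k t * ((w ^ 2 / 2) * fejer (w * t)))) := by
        refine setIntegral_congr_fun measurableSet_Ioi fun t ht => ?_
        have ht : 0 < t := ht
        rw [hfe _ t ht, hfe _ t ht, hfe _ t ht, fejer, add_mul, sub_mul, Real.cos_add,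
          Real.cos_sub]
        field_simp
        ring
      have hadd : IntegrableOn (fun t => k t * (((w + δ) ^ 2 / 2) * fejer ((w + δ) * t)) +
          k t * (((w - δ) ^ 2 / 2) * fejer ((w - δ) * t))) (Ioi 0) := (hfi _).add (hfi _)
      rw [e, integral_const_mul, integral_sub hadd ((hfi _).const_mul 2),
        integral_add (hfi _) (hfi _), integral_const_mul, hgdef]
      field_simp
      ring
  -- The comparison of means gives only some arbitrarily small steps with almost nonnegative second
  -- differences; convexity extends nonnegativity to the given δ.
  have hconv := midpoint_convex_of_symmetric_deriv hgc (fun x m δ₀ hm hδ₀ => ?_) w δ hδ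
  · rw [hsecond w δ hδ] at hconv
    exact nonneg_of_mul_nonneg_right hconv (by positivity)
  · obtain ⟨δ, h0, h1, h2⟩ := exists_fejer_mean_gt (hβ x) (hL x) hm hδ₀
    refine ⟨δ, h0, h1, ?_⟩
    rw [hsecond x δ h0]
    have : 0 < δ ^ 2 := by positivity
    nlinarith

end Rajchman

/-! ### Plancherel and the positivity of autocorrelation forms. -/

section Plancherel

/-- On `L¹ ∩ L²` the Plancherel transform is given by the Fourier integral. -/
theorem fourier_toLp_ae_eq {f : ℝ → ℂ} (hf1 : Integrable f) (hf2 : MemLp f 2) :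
    (𝓕 (hf2.toLp f) : Lp ℂ 2 (volume : Measure ℝ)) =ᵐ[volume] 𝓕 f := by
  have hcont : Continuous (𝓕 f) := VectorFourier.fourierIntegral_continuous
    Real.continuous_fourierChar (by fun_prop) hf1
  -- Both functions are tested against smooth compactly supported g. The L² transform agrees with
  -- the distributional one, and the latter is moved onto f by the multiplication formula.
  refine ae_eq_of_integral_contDiff_smul_eq
    ((Lp.memLp _).locallyIntegrable (by norm_num)) hcont.locallyIntegrable fun g hg hgc => ?_
  have hg₁ : HasCompactSupport (Complex.ofRealCLM ∘ g) := hgc.comp_left rfl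
  have hg₂ : ContDiff ℝ ∞ (Complex.ofRealCLM ∘ g) := by fun_prop
  set φ : 𝓢(ℝ, ℂ) := hg₁.toSchwartzMap hg₂ with hφ
  have hφa : ∀ x, φ x = (g x : ℂ) := fun x => rfl
  have h1 := DFunLike.congr_fun (Lp.fourier_toTemperedDistribution_eq (hf2.toLp f)) φ
  rw [TemperedDistribution.fourier_apply, Lp.toTemperedDistribution_apply,
    Lp.toTemperedDistribution_apply] at h1
  have h2 : ∫ x, (𝓕 φ) x • (hf2.toLp f) x = ∫ x, (𝓕 φ) x • f x := by
    refine integral_congr_ae ?_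
    filter_upwards [hf2.coeFn_toLp] with x hx
    rw [hx]
  have h3 := VectorFourier.integral_fourierIntegral_smul_eq_flip (μ := volume) (ν := volume)
    (L := innerₗ ℝ) (f := f) (g := φ) Real.continuous_fourierChar (by fun_prop) hf1 φ.integrable
  rw [flip_innerₗ] at h3
  have h4 : ∫ x, (𝓕 φ) x • f x = ∫ x, φ x • (𝓕 f) x := by
    simp only [smul_eq_mul] at h3 ⊢
    simp only [mul_comm (φ _)]
    refine Eq.trans ?_ h3.symm
    congr 1
    ext x
    rw [mul_comm]
    rfl
  rw [h2, h4] at h1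
  simp only [hφa] at h1
  simpa using h1.symm

/-- The autocorrelation of a real function is the cosine transform of its power spectrum. -/
theorem autocorrelation_eq {ζ : ℝ → ℝ} (h1 : Integrable ζ) (h2 : MemLp ζ 2) :
    Integrable (fun v => ‖𝓕 (fun t => (ζ t : ℂ)) v‖ ^ 2) ∧
    ∀ r, ∫ t, ζ t * ζ (t - r) =
      ∫ v, Real.cos (2 * Real.pi * v * r) * ‖𝓕 (fun t => (ζ t : ℂ)) v‖ ^ 2 := by
  set f : ℝ → ℂ := fun t => (ζ t : ℂ) with hf
  have hf1 : Integrable f := h1.ofReal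
  have hf2 : MemLp f 2 := h2.ofReal
  have hF := fourier_toLp_ae_eq hf1 hf2
  have hFi : Integrable (fun v => ‖𝓕 f v‖ ^ 2) := by
    have := ((Lp.memLp (𝓕 (hf2.toLp f) : Lp ℂ 2 (volume : Measure ℝ))).ae_eq hF)
    exact (memLp_two_iff_integrable_sq_norm this.aestronglyMeasurable).1 this
  refine ⟨hFi, fun r => ?_⟩
  -- Translation by r multiplies the transform by a phase, so the L² inner product of f with its
  -- translate becomes the integral of that phase against the power spectrum.
  set fr : ℝ → ℂ := f ∘ fun t => t + -r with hfr
  have hr1 : Integrable fr := hf1.comp_add_right (-r)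
  have hr2 : MemLp fr 2 := hf2.comp_measurePreserving (measurePreserving_add_right volume (-r))
  have hFr := fourier_toLp_ae_eq hr1 hr2
  have hinner := Lp.inner_fourier_eq (hr2.toLp fr) (hf2.toLp f)
  rw [L2.inner_def, L2.inner_def] at hinner
  have e1 : ∫ t, inner ℂ ((hr2.toLp fr) t) ((hf2.toLp f) t) =
      ((∫ t, ζ t * ζ (t - r) : ℝ) : ℂ) := by
    rw [← integral_complex_ofReal]
    refine integral_congr_ae ?_
    filter_upwards [hr2.coeFn_toLp, hf2.coeFn_toLp] with t ha hb
    rw [ha, hb]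
    simp [hfr, hf, sub_eq_add_neg]
  have e2 : ∫ v, inner ℂ ((𝓕 (hr2.toLp fr) : Lp ℂ 2 (volume : Measure ℝ)) v)
      ((𝓕 (hf2.toLp f) : Lp ℂ 2 (volume : Measure ℝ)) v) =
      ∫ v, Complex.exp ((2 * Real.pi * v * r : ℝ) * Complex.I) * ((‖𝓕 f v‖ ^ 2 : ℝ) : ℂ) := by
    refine integral_congr_ae ?_
    filter_upwards [hFr, hF] with v ha hb
    have hs : 𝓕 fr v = Complex.exp ((-(2 * Real.pi * v * r) : ℝ) * Complex.I) * 𝓕 f v := by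
      have := congrFun (VectorFourier.fourierIntegral_comp_add_right Real.fourierChar volume
        (innerₗ ℝ) f (-r)) v
      refine this.trans ?_
      simp only [innerₗ_apply_apply, Circle.smul_def, Real.fourierChar_apply, smul_eq_mul]
      congr 2
      simp
      ring
    rw [ha, hb, hs, RCLike.inner_apply, map_mul, ← Complex.exp_conj, ← Complex.normSq_eq_norm_sq,
      ← Complex.mul_conj]
    simp only [map_mul, Complex.conj_ofReal, Complex.conj_I]
    push_cast
    ring_nf
  rw [e1, e2] at hinner
  have h3 := congrArg Complex.re hinner
  rw [Complex.ofReal_re] at h3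
  rw [← h3]
  have hi : Integrable fun v => Complex.exp ((2 * Real.pi * v * r : ℝ) * Complex.I) *
      ((‖𝓕 f v‖ ^ 2 : ℝ) : ℂ) :=
    hFi.ofReal.bdd_mul (c := 1) (by fun_prop) (Eventually.of_forall fun v => by
      rw [Complex.norm_exp_ofReal_mul_I])
  have h4 := integral_re hi
  simp only [RCLike.re_eq_complex_re] at h4
  rw [← h4]
  congr 1
  ext v
  rw [Complex.re_mul_ofReal, Complex.exp_ofReal_mul_I_re]

/-- Inserting the spectral formula and exchanging the integrals turns the form into ∫ p(v)(a₀ + ∫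
b(r) cos(2πvr) dr) dv, where the power spectrum p and the bracket are both nonnegative. -/
theorem autocorrelation_form_nonneg {b : ℝ → ℝ} {a₀ : ℝ} (hb : IntegrableOn b (Ioi 0))
    (hpos : ∀ w : ℝ, 0 ≤ a₀ + ∫ t in Ioi (0 : ℝ), b t * Real.cos (w * t))
    {ζ : ℝ → ℝ} (h1 : Integrable ζ) (h2 : MemLp ζ 2) :
    0 ≤ a₀ * (∫ t, ζ t * ζ t) + ∫ r in Ioi (0 : ℝ), b r * ∫ t, ζ t * ζ (t - r) := by
  obtain ⟨hi, hρ⟩ := autocorrelation_eq h1 h2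
  set p : ℝ → ℝ := fun v => ‖𝓕 (fun t => (ζ t : ℂ)) v‖ ^ 2
  have h0 := hρ 0
  simp only [sub_zero, mul_zero, Real.cos_zero, one_mul] at h0
  simp only [hρ, h0, ← integral_const_mul]
  have hprod : Integrable (fun q : ℝ × ℝ => b q.1 * (Real.cos (2 * Real.pi * q.2 * q.1) * p q.2))
      ((volume.restrict (Ioi 0)).prod volume) := by
    refine ((hb.mul_prod hi).bdd_mul (c := 1)
      (f := fun q : ℝ × ℝ => Real.cos (2 * Real.pi * q.2 * q.1)) (by fun_prop)
      (Eventually.of_forall fun q => Real.abs_cos_le_one _)).congr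
      (Eventually.of_forall fun q => ?_)
    simp only
    ring
  rw [integral_integral_swap (f := fun r v => b r * (Real.cos (2 * Real.pi * v * r) * p v)) hprod,
    ← integral_add (hi.const_mul a₀) hprod.integral_prod_right]
  refine integral_nonneg fun v => ?_
  have e : ∫ r in Ioi (0 : ℝ), b r * (Real.cos (2 * Real.pi * v * r) * p v) =
      (∫ r in Ioi (0 : ℝ), b r * Real.cos (2 * Real.pi * v * r)) * p v := by
    rw [← integral_mul_const]
    simp only [mul_assoc]
  simp only [Pi.zero_apply]
  rw [e, ← add_mul]
  exact mul_nonneg (hpos _) (sq_nonneg _)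

end Plancherel

/-! ### The energy estimate and the uniform bound on the resolvent. -/

section Energy

variable {a₀ : ℝ} {k : ℝ → ℝ}

theorem tendsto_fejer_nhds_zero {t : ℝ} (ht : 0 < t) :
    Tendsto (fun n : ℕ => fejer (1 / ((n : ℝ) + 1) * t)) atTop (𝓝 1) := by
  have e : ∀ x : ℝ, x ≠ 0 → fejer x = Real.sinc (x / 2) ^ 2 := fun x hx => by
    rw [Real.sinc_of_ne_zero (by positivity), fejer, div_pow, Real.sin_sq_eq_half_sub,
      mul_div_cancel₀ _ two_ne_zero]
    field_simp
  have h : Tendsto (fun n : ℕ => Real.sinc (1 / ((n : ℝ) + 1) * t / 2) ^ 2) atTop (𝓝 1) := by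
    have h0 : Tendsto (fun n : ℕ => 1 / ((n : ℝ) + 1) * t / 2) atTop (𝓝 0) := by
      simpa using (tendsto_one_div_add_atTop_nhds_zero_nat (𝕜 := ℝ)).mul_const t |>.div_const 2
    have := ((Real.continuous_sinc.tendsto 0).comp h0).pow 2
    simpa using this
  refine h.congr fun n => ?_
  rw [e _ (by positivity)]

/-- The quadratic form of the memory term is nonnegative. -/
theorem integral_memoryTerm_mul_nonneg (hk : ∀ s t, IntervalIntegrable k volume s t)
    (hk' : IntegrableOn (fun t => k t * (1 + t ^ 2)⁻¹) (Ioi 0))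
    (hL : ∀ w : ℝ, ∀ ε > 0, ∀ᶠ h in 𝓝[>] (0 : ℝ),
      -ε ≤ a₀ + ∫ t in Ioi (0 : ℝ), k t * Real.cos (w * t) * Real.exp (-(h * t)))
    {z : ℝ → ℝ} (hz : Continuous z) {T : ℝ} (hT : 0 ≤ T) :
    0 ≤ ∫ t in (0 : ℝ)..T, memoryTerm a₀ k z t * z t := by
  -- With z cut off to (0, T] and ρ its autocorrelation, the form equals a₀ρ(0) + ∫ k ρ.
  set ζ := indicator (Ioc 0 T) z with hζ
  obtain ⟨C, hC⟩ := (isCompact_Icc (a := 0) (b := T)).exists_bound_of_continuousOn hz.continuousOn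
  have hC0 : 0 ≤ C := (norm_nonneg _).trans (hC 0 ⟨le_rfl, hT⟩)
  have hζb : ∀ t, ‖ζ t‖ ≤ C := fun t => by
    by_cases ht : t ∈ Ioc 0 T
    · rw [hζ, indicator_of_mem ht]; exact hC t ⟨ht.1.le, ht.2⟩
    · rw [hζ, indicator_of_notMem ht, norm_zero]; exact hC0
  have hζm : Measurable ζ := hz.measurable.indicator measurableSet_Ioc
  have hζ1 : Integrable ζ :=
    (integrable_indicator_iff measurableSet_Ioc).2 (hz.intervalIntegrable 0 T).1
  have hζ2 : MemLp ζ 2 := by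
    rw [memLp_two_iff_integrable_sq hζm.aestronglyMeasurable]
    refine (hζ1.bdd_mul hζm.aestronglyMeasurable (Eventually.of_forall hζb)).congr
      (Eventually.of_forall fun t => ?_)
    simp only
    ring
  set ρ : ℝ → ℝ := fun r => ∫ t, ζ t * ζ (t - r) with hρ
  have hρm : Measurable ρ := by
    have : Measurable fun p : ℝ × ℝ => ζ p.2 * ζ (p.2 - p.1) := by fun_prop
    exact this.stronglyMeasurable.integral_prod_right'.measurable
  have hρb : ∀ r, |ρ r| ≤ C * ∫ t, ‖ζ t‖ := fun r => by
    rw [← integral_const_mul, ← Real.norm_eq_abs]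
    refine norm_integral_le_of_norm_le (hζ1.norm.const_mul C) (Eventually.of_forall fun t => ?_)
    rw [norm_mul, mul_comm]
    exact mul_le_mul_of_nonneg_right (hζb _) (norm_nonneg _)
  have hρ0 : ∀ r, T < r → ρ r = 0 := fun r hr => by
    rw [hρ]
    refine integral_eq_zero_of_ae (Eventually.of_forall fun t => ?_)
    simp only [Pi.zero_apply, hζ]
    by_cases ht : t ∈ Ioc 0 T
    · rw [indicator_of_notMem (show t - r ∉ Ioc 0 T from fun h => by linarith [h.1, ht.2]),
        mul_zero]
    · rw [indicator_of_notMem ht, zero_mul]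
  -- The regularised kernel k(r) fejer(δr) is integrable on the half line, and its cosine transform
  -- plus a₀ is a Fejér mean, hence nonnegative.
  have hstep : ∀ n : ℕ, 0 ≤ a₀ * ρ 0 +
      ∫ r in Ioi (0 : ℝ), k r * fejer (1 / ((n : ℝ) + 1) * r) * ρ r := fun n => by
    have hδ : (0 : ℝ) < 1 / ((n : ℝ) + 1) := by positivity
    have hb := integrableOn_mul_of_le hk'
      (κ := fun t => fejer (1 / ((n : ℝ) + 1) * t)) (measurable_fejer.comp (by fun_prop))
      (fun t _ => by
        rw [abs_of_nonneg (fejer_nonneg _)]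
        exact fejer_mul_le hδ.ne' t)
    have := autocorrelation_form_nonneg hb (a₀ := a₀) (fun w => ?_) hζ1 hζ2
    · simpa [hρ] using this
    · refine (fejer_mean_nonneg hk' hL w hδ).trans (le_of_eq ?_)
      congr 2
      ext t
      ring
  have hkT : Integrable (indicator (Ioc 0 T) k) :=
    (integrable_indicator_iff measurableSet_Ioc).2 (hk 0 T).1
  have hkm : AEStronglyMeasurable k (volume.restrict (Ioi 0)) := by
    refine (hk'.aestronglyMeasurable.mul (g := fun t => 1 + t ^ 2) (by fun_prop)).congr
      (Eventually.of_forall fun t => ?_)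
    have : 1 + t ^ 2 ≠ 0 := by positivity
    simp only [Pi.mul_apply]
    field_simp
  have hlim : Tendsto (fun n : ℕ => a₀ * ρ 0 +
      ∫ r in Ioi (0 : ℝ), k r * fejer (1 / ((n : ℝ) + 1) * r) * ρ r) atTop
      (𝓝 (a₀ * ρ 0 + ∫ r in Ioi (0 : ℝ), k r * ρ r)) := by
    -- Since ρ vanishes beyond T and fejer ≤ 1, the restriction of |k| to (0, T], times a bound for
    -- ρ, dominates as δ → 0.
    refine tendsto_const_nhds.add (tendsto_integral_of_dominated_convergence
      (fun r => ‖indicator (Ioc 0 T) k r‖ * (C * ∫ t, ‖ζ t‖))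
      (fun n => (hkm.mul (measurable_fejer.comp (by fun_prop)).aestronglyMeasurable).mul
        hρm.aestronglyMeasurable) (hkT.norm.mul_const _).integrableOn (fun n => ?_) ?_)
    · filter_upwards [ae_restrict_mem measurableSet_Ioi] with r hr
      by_cases hrT : r ≤ T
      · rw [indicator_of_mem (show r ∈ Ioc 0 T from ⟨hr, hrT⟩), norm_mul, norm_mul,
          Real.norm_of_nonneg (fejer_nonneg _)]
        gcongr
        · exact mul_le_of_le_one_right (norm_nonneg _) (fejer_le_one _)
        · exact hρb r
      · rw [hρ0 r (not_le.1 hrT), mul_zero, norm_zero]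
        exact mul_nonneg (norm_nonneg _) ((abs_nonneg _).trans (hρb 0))
    · filter_upwards [ae_restrict_mem measurableSet_Ioi] with r hr
      simpa using ((tendsto_fejer_nhds_zero hr).const_mul (k r)).mul_const (ρ r)
  have hlim0 := ge_of_tendsto' hlim hstep
  refine hlim0.trans (le_of_eq ?_)
  have hconv : ∀ t, ζ t * causalConv k z t = ∫ r, indicator (Ioc 0 T) k r * (ζ t * ζ (t - r)) :=
    fun t => by
      by_cases ht : t ∈ Ioc 0 T
      · rw [causalConv, intervalIntegral.integral_of_le ht.1.le, integral_Ioc_eq_integral_Ioo,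
          ← integral_const_mul, ← integral_indicator measurableSet_Ioo]
        congr 1
        ext r
        by_cases hr : r ∈ Ioo 0 t
        · rw [indicator_of_mem hr, indicator_of_mem (show r ∈ Ioc 0 T from
            ⟨hr.1, hr.2.le.trans ht.2⟩), hζ, indicator_of_mem (show t - r ∈ Ioc 0 T from
            ⟨by linarith [hr.2], by linarith [hr.1, ht.2]⟩), smul_eq_mul]
          ring
        · rw [indicator_of_notMem hr]
          by_cases hr0 : 0 < r
          · rw [hζ, indicator_of_notMem (show t - r ∉ Ioc 0 T from
              fun h => hr ⟨hr0, by linarith [h.1]⟩), mul_zero, mul_zero]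
          · rw [indicator_of_notMem (show r ∉ Ioc 0 T from fun h => hr0 h.1), zero_mul]
      · simp [hζ, indicator_of_notMem ht]
  have hint : Integrable (fun p : ℝ × ℝ =>
      indicator (Ioc 0 T) k p.2 * (ζ p.1 * ζ (p.1 - p.2))) (volume.prod volume) := by
    refine ((hkT.convolution_integrand (ContinuousLinearMap.mul ℝ ℝ) hζ1).bdd_mul (c := C)
      (f := fun p : ℝ × ℝ => ζ p.1) (hζm.comp measurable_fst).aestronglyMeasurable
      (Eventually.of_forall fun p => hζb _)).congr (Eventually.of_forall fun p => ?_)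
    simp only [ContinuousLinearMap.mul_apply']
    ring
  have e1 : ∫ r in Ioi (0 : ℝ), k r * ρ r = ∫ t in (0 : ℝ)..T, causalConv k z t * z t := by
    have e2 : ∫ r in Ioi (0 : ℝ), k r * ρ r = ∫ r, ∫ t, indicator (Ioc 0 T) k r *
        (ζ t * ζ (t - r)) := by
      rw [← integral_indicator measurableSet_Ioi]
      congr 1
      ext r
      rw [integral_const_mul]
      by_cases hr : r ∈ Ioi (0 : ℝ)
      · rw [indicator_of_mem hr]
        by_cases hrT : r ≤ T
        · rw [indicator_of_mem (show r ∈ Ioc 0 T from ⟨hr, hrT⟩)]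
        · have h0 := hρ0 r (not_le.1 hrT)
          rw [h0]
          simp only [hρ] at h0
          rw [h0, mul_zero, mul_zero]
      · rw [indicator_of_notMem hr, indicator_of_notMem (show r ∉ Ioc 0 T from
          fun h => hr h.1), zero_mul]
    rw [e2, ← integral_integral_swap (f := fun t r => indicator (Ioc 0 T) k r *
        (ζ t * ζ (t - r))) hint, intervalIntegral.integral_of_le hT,
      ← integral_indicator measurableSet_Ioc]
    simp only [← hconv]
    congr 1
    ext t
    by_cases ht : t ∈ Ioc 0 T
    · rw [hζ, indicator_of_mem ht, indicator_of_mem ht, mul_comm]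
    · rw [hζ, indicator_of_notMem ht, indicator_of_notMem ht, zero_mul]
  have e3 : ρ 0 = ∫ t in (0 : ℝ)..T, z t * z t := by
    rw [intervalIntegral.integral_of_le hT, ← integral_indicator measurableSet_Ioc, hρ]
    simp only [sub_zero]
    congr 1
    ext t
    by_cases ht : t ∈ Ioc 0 T
    · rw [hζ, indicator_of_mem ht, indicator_of_mem ht]
    · rw [hζ, indicator_of_notMem ht, indicator_of_notMem ht, zero_mul]
  have hcc := continuous_causalConv hk hz
  rw [e1, e3, ← intervalIntegral.integral_const_mul, ← intervalIntegral.integral_add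
    (Continuous.intervalIntegrable (by fun_prop) _ _)
    (Continuous.intervalIntegrable (by fun_prop) _ _)]
  congr 1
  ext t
  rw [memoryTerm, smul_eq_mul]
  ring

/-- The solution of the scalar equation is bounded by one. -/
theorem abs_resolvent_le_one (hk : ∀ s t, IntervalIntegrable k volume s t)
    (hk' : IntegrableOn (fun t => k t * (1 + t ^ 2)⁻¹) (Ioi 0))
    (hL : ∀ w : ℝ, ∀ ε > 0, ∀ᶠ h in 𝓝[>] (0 : ℝ),
      -ε ≤ a₀ + ∫ t in Ioi (0 : ℝ), k t * Real.cos (w * t) * Real.exp (-(h * t)))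
    {l : ℝ} (hl : 0 ≤ l) (t : ℝ) : |resolvent a₀ k l t| ≤ 1 := by
  have hmain : ∀ T, 0 ≤ T → |resolvent a₀ k l T| ≤ 1 := fun T hT => by
    set z := resolvent a₀ k l with hz
    have hzc : Continuous z := continuous_resolvent_right hk l
    have hm := continuous_memoryTerm a₀ hk hzc
    -- Energy identity: the integrand is the derivative of z². With z(0) = 1, l ≥ 0 and a
    -- nonnegative form, z(T)² ≤ 1 follows.
    have hint : ∫ t in (0 : ℝ)..T, -(2 * l) * (memoryTerm a₀ k z t * z t) =
        z T ^ 2 - z 0 ^ 2 := by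
      refine intervalIntegral.integral_eq_sub_of_hasDerivAt_of_le hT (f := fun t => z t ^ 2)
        (by fun_prop) (fun t ht => ?_) (Continuous.intervalIntegrable (by fun_prop) _ _)
      refine ((hasDerivAt_resolvent hk l ht.1).pow 2).congr_deriv ?_
      simp only [hz]
      ring
    rw [intervalIntegral.integral_const_mul, hz, resolvent_zero_right hk, ← hz] at hint
    have := integral_memoryTerm_mul_nonneg hk hk' hL hzc hT
    rw [← sq_le_one_iff_abs_le_one]
    nlinarith
  rcases le_total 0 t with ht | ht
  · exact hmain t ht
  · have : resolvent a₀ k l t = resolvent a₀ k l 0 := by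
      rw [resolvent, resolvent, max_eq_right ht, max_self]
    rw [this]
    exact hmain 0 le_rfl

end Energy

/-! ### From the hypotheses on the kernel to the analytic conditions used above. -/

section Admissible

variable {a : ℝ → ℝ}

/-- The kernel extended by zero to the nonpositive half line. -/
noncomputable def extendedKernel (a : ℝ → ℝ) : ℝ → ℝ := indicator (Ioi 0) a

/-- The weight is bounded near 0, where the kernel is integrable, and integrable at infinity, where
the kernel is bounded; one weighted condition thus captures all of admissibility needed for the
Fejér means. -/
theorem integrable_extendedKernel (ha : IsAdmissibleKernel a) :
    Integrable fun t => extendedKernel a t * (1 + t ^ 2)⁻¹ := by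
  have hr : IntegrableOn (fun t => a t * (1 + t ^ 2)⁻¹) (Ioi 0) := by
    have hu : Ioi (0 : ℝ) = Ioo 0 1 ∪ Ici 1 := (Ioo_union_Ici_eq_Ioi zero_lt_one).symm
    rw [hu]
    refine IntegrableOn.union ?_ ?_
    · refine Integrable.mul_bdd (c := 1) ha.integrableOn (by fun_prop)
        (Eventually.of_forall fun t => ?_)
      rw [norm_inv, Real.norm_of_nonneg (by positivity)]
      exact inv_le_one_of_one_le₀ (by nlinarith [sq_nonneg t])
    · obtain ⟨C, hC⟩ := ha.bounded 1 one_pos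
      exact integrable_inv_one_add_sq.integrableOn.bdd_mul (c := C)
        (ha.aestronglyMeasurable.mono_measure (Measure.restrict_mono
          (fun t (ht : 1 ≤ t) => zero_lt_one.trans_le ht) le_rfl)) hC
  refine ((integrable_indicator_iff measurableSet_Ioi).2 hr).congr
    (Eventually.of_forall fun t => ?_)
  by_cases ht : t ∈ Ioi (0 : ℝ) <;> simp [extendedKernel, ht]

theorem intervalIntegrable_extendedKernel (ha : IsAdmissibleKernel a) (s t : ℝ) :
    IntervalIntegrable (extendedKernel a) volume s t := by
  have h := (integrable_extendedKernel ha).intervalIntegrable (a := s) (b := t)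
  refine (h.mul_continuousOn (g := fun t => 1 + t ^ 2) (by fun_prop)).congr
    fun t _ => ?_
  have : 1 + t ^ 2 ≠ 0 := by positivity
  field_simp

/-- Only an eventual lower bound is kept, so a limit equal to +∞ needs no separate treatment. -/
theorem boundary_limit_extendedKernel (ha : IsAdmissibleKernel a) {a₀ : ℝ}
    (hpos : NonnegBoundaryLimit a₀ a) (w ε : ℝ) (hε : 0 < ε) :
    ∀ᶠ h in 𝓝[>] (0 : ℝ), -ε ≤ a₀ +
      ∫ t in Ioi (0 : ℝ), extendedKernel a t * Real.cos (w * t) * Real.exp (-(h * t)) := by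
  obtain ⟨L, hL, hlim⟩ := hpos w
  have hlt : ((-ε : ℝ) : EReal) < L := lt_of_lt_of_le (by exact_mod_cast neg_lt_zero.2 hε) hL
  filter_upwards [hlim.eventually (lt_mem_nhds hlt), self_mem_nhdsWithin] with h hh h0
  have h0 : 0 < h := h0
  have hh := (EReal.coe_lt_coe_iff.1 hh).le
  refine hh.trans (le_of_eq ?_)
  congr 1
  have hi : IntegrableOn (fun t : ℝ => Complex.exp (-(Complex.I * w + h) * t) * (a t : ℂ))
      (Ioi 0) := by
    have hw : IntegrableOn (fun t => ((extendedKernel a t * (1 + t ^ 2)⁻¹ : ℝ) : ℂ)) (Ioi 0) :=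
      (integrable_extendedKernel ha).ofReal.integrableOn
    -- The constant comes from 1 + t² ≤ (1 + 2/h²)e^{ht}, a consequence of the quadratic lower bound
    -- for the exponential.
    refine (Integrable.bdd_mul (c := 1 + 2 / h ^ 2)
      (f := fun t : ℝ => Complex.exp (-(Complex.I * w + h) * t) * ((1 + t ^ 2 : ℝ) : ℂ)) hw
      (by fun_prop) ?_).congr ?_
    · filter_upwards [ae_restrict_mem measurableSet_Ioi] with t ht
      have ht : 0 < t := ht
      have hre : (-(Complex.I * w + h) * t).re = -(h * t) := by simp
      rw [norm_mul, Complex.norm_exp, hre, Complex.norm_real,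
        Real.norm_of_nonneg (by positivity), Real.exp_neg, ← div_eq_inv_mul,
        div_le_iff₀ (Real.exp_pos _)]
      have hq := Real.quadratic_le_exp_of_nonneg (mul_pos h0 ht).le
      calc 1 + t ^ 2 ≤ (1 + 2 / h ^ 2) * (1 + h * t + (h * t) ^ 2 / 2) := by
            have : (2 / h ^ 2) * ((h * t) ^ 2 / 2) = t ^ 2 := by field_simp
            have h1 : 0 ≤ (2 / h ^ 2) * (1 + h * t) := by positivity
            have h2 : 0 ≤ h * t + (h * t) ^ 2 / 2 := by positivity
            nlinarith
        _ ≤ _ := by gcongr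
    · filter_upwards [ae_restrict_mem measurableSet_Ioi] with t ht
      have : ((1 + t ^ 2 : ℝ) : ℂ) ≠ 0 := by
        exact_mod_cast (by positivity : (1 + t ^ 2 : ℝ) ≠ 0)
      simp only [extendedKernel, indicator_of_mem ht, Complex.ofReal_mul, Complex.ofReal_inv]
      field_simp
  have hre := integral_re hi
  simp only [RCLike.re_eq_complex_re] at hre
  rw [laplaceTransform, ← hre]
  refine setIntegral_congr_fun measurableSet_Ioi fun t ht => ?_
  rw [extendedKernel, indicator_of_mem ht]
  have : -(Complex.I * w + h) * t = ((-(h * t) : ℝ) : ℂ) + ((-(w * t) : ℝ) : ℂ) * Complex.I := by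
    push_cast; ring
  rw [this, Complex.exp_add, ← Complex.ofReal_exp, Complex.re_mul_ofReal,
    Complex.re_ofReal_mul, Complex.exp_ofReal_mul_I_re, Real.cos_neg]
  ring

end Admissible

/-! ### Existence and uniqueness for the scalar Volterra equation. -/

section ScalarEquation

variable {a₀ : ℝ} {a : ℝ → ℝ}

theorem integratedKernel_extendedKernel {r : ℝ} (hr : 0 ≤ r) :
    integratedKernel a₀ (extendedKernel a) r = integratedKernel a₀ a r := by
  rw [integratedKernel, integratedKernel, intervalIntegral.integral_of_le hr,
    intervalIntegral.integral_of_le hr]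
  congr 1
  refine setIntegral_congr_fun measurableSet_Ioc fun t ht => ?_
  rw [extendedKernel, indicator_of_mem (mem_Ioi.2 ht.1)]

theorem continuous_comp_max {F : Type*} [TopologicalSpace F] {y : ℝ → F}
    (hy : ContinuousOn y (Ici 0)) : Continuous fun t => y (max t 0) :=
  hy.comp_continuous (by fun_prop) fun t => le_max_right t 0

theorem integral_integratedKernel_mul (ha : IsAdmissibleKernel a) {y : ℝ → ℝ}
    (hy : ContinuousOn y (Ici 0)) {t : ℝ} (ht : 0 ≤ t) :
    ∫ τ in (0 : ℝ)..t, integratedKernel a₀ a (t - τ) * y τ =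
      volterraOp a₀ (extendedKernel a) (fun t => y (max t 0)) t := by
  rw [volterraOp_eq_integral (intervalIntegrable_extendedKernel ha) (continuous_comp_max hy) ht]
  refine intervalIntegral.integral_congr fun τ hτ => ?_
  rw [uIcc_of_le ht] at hτ
  simp only [smul_eq_mul]
  rw [integratedKernel_extendedKernel (by linarith [hτ.2]), max_eq_left hτ.1]

theorem isScalarSolution_resolvent (ha : IsAdmissibleKernel a) (l : ℝ) :
    IsScalarSolution a₀ a l (resolvent a₀ (extendedKernel a) l) := by
  have hk := intervalIntegrable_extendedKernel ha
  have hc := continuous_resolvent_right (a₀ := a₀) hk l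
  refine ⟨hc.continuousOn, fun t ht => ?_⟩
  rw [integral_integratedKernel_mul ha hc.continuousOn ht, volterraOp_congr ht
    (Y := resolvent a₀ (extendedKernel a) l) fun s hs => by rw [max_eq_left hs.1]]
  exact resolvent_add_volterraOp hk l ht

theorem IsScalarSolution.eqOn (ha : IsAdmissibleKernel a) {l : ℝ} {y : ℝ → ℝ}
    (hy : IsScalarSolution a₀ a l y) :
    EqOn y (resolvent a₀ (extendedKernel a) l) (Ici 0) := fun t ht => by
  have hk := intervalIntegrable_extendedKernel ha
  have ht : 0 ≤ t := ht
  have key : (fun t => y (max t 0)) t = resolvent a₀ (extendedKernel a) l t := by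
    refine eq_of_add_volterraOp_eq (a₀ := a₀) hk l (continuous_comp_max hy.1)
      (continuous_resolvent_right (a₀ := a₀) hk l) (fun s hs => ?_) ht
    rw [resolvent_add_volterraOp hk l hs]
    rw [max_eq_left hs, ← integral_integratedKernel_mul ha hy.1 hs]
    exact hy.2 s hs
  simpa only [max_eq_left ht] using key

end ScalarEquation

/-! ### Sobolev distributions as square integrable densities in frequency. -/

section SobolevDensity

variable {E : Type*} [NormedAddCommGroup E] [InnerProductSpace ℝ E]

/-- The symbol `(1 + ‖ξ‖²) ^ (s / 2)` of the Bessel potential. -/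
noncomputable def besselWeight (s : ℝ) (ξ : E) : ℝ := (1 + ‖ξ‖ ^ 2) ^ (s / 2)

theorem hasTemperateGrowth_besselWeight (s : ℝ) :
    (fun ξ : E => (besselWeight s ξ : ℂ)).HasTemperateGrowth := by
  unfold besselWeight
  fun_prop

variable [FiniteDimensional ℝ E] [MeasurableSpace E] [BorelSpace E]

/-- The Schwartz function against which the density of an `H^s` distribution is integrated. -/
noncomputable def sobolevTest (s : ℝ) : 𝓢(E, ℂ) →L[ℂ] 𝓢(E, ℂ) :=
  (SchwartzMap.smulLeftCLM ℂ fun ξ : E => (besselWeight (-s) ξ : ℂ)) ∘L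
    FourierTransform.fourierInvCLM ℂ 𝓢(E, ℂ)

theorem sobolevTest_apply (s : ℝ) (φ : 𝓢(E, ℂ)) (ξ : E) :
    sobolevTest s φ ξ = (besselWeight (-s) ξ : ℂ) * 𝓕⁻ φ ξ := by
  rw [sobolevTest, ContinuousLinearMap.comp_apply, SchwartzMap.smulLeftCLM_apply_apply
    (hasTemperateGrowth_besselWeight _)]
  rfl

/-- The Fourier transform of `T` is `(1 + ‖ξ‖²) ^ (-s / 2)` times the square integrable
function `G`. -/
structure HasSobolevDensity (s : ℝ) (T : 𝓢'(E, ℂ)) (G : E → ℂ) : Prop where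
  memLp : MemLp G 2
  apply_eq : ∀ φ : 𝓢(E, ℂ), T φ = ∫ ξ, sobolevTest s φ ξ * G ξ

theorem HasSobolevDensity.congr {s : ℝ} {T : 𝓢'(E, ℂ)} {G H : E → ℂ}
    (h : HasSobolevDensity s T G) (hGH : G =ᵐ[volume] H) : HasSobolevDensity s T H := by
  refine ⟨h.memLp.ae_eq hGH, fun φ => ?_⟩
  rw [h.apply_eq]
  refine integral_congr_ae ?_
  filter_upwards [hGH] with ξ hξ
  rw [hξ]

/-- Write T as the Bessel potential of order -s of U; moving the multiplier and the transform onto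
the test function leaves the density 𝓕 U. -/
theorem hasSobolevDensity_of_besselPotential {s : ℝ} {T : 𝓢'(E, ℂ)}
    {U : Lp ℂ 2 (volume : Measure E)}
    (h : TemperedDistribution.besselPotential E ℂ s T = (U : 𝓢'(E, ℂ))) :
    HasSobolevDensity s T (𝓕 U : Lp ℂ 2 (volume : Measure E)) := by
  refine ⟨Lp.memLp _, fun φ => ?_⟩
  rw [← (TemperedDistribution.besselPotential_neg_apply_eq_iff s _ _).2 h,
    TemperedDistribution.besselPotential, TemperedDistribution.fourierMultiplierCLM_apply_apply,
    ← TemperedDistribution.fourier_apply, Lp.fourier_toTemperedDistribution_eq,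
    Lp.toTemperedDistribution_apply]
  rfl

theorem integrable_schwartz_mul (φ : 𝓢(E, ℂ)) {G : E → ℂ} (hG : MemLp G 2) :
    Integrable fun ξ => φ ξ * G ξ :=
  (φ.memLp 2).integrable_mul hG

/-- The bilinear pairing of two square integrable functions. -/
noncomputable def pairing :
    Lp ℂ 2 (volume : Measure E) →L[ℂ] Lp ℂ 2 (volume : Measure E) →L[ℂ] ℂ :=
  (ContinuousLinearMap.mul ℂ ℂ).lpPairing volume 2 2

theorem pairing_toLp (φ : 𝓢(E, ℂ)) (U : Lp ℂ 2 (volume : Measure E)) :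
    pairing (φ.toLp 2) U = ∫ ξ, φ ξ * U ξ := by
  rw [pairing, ContinuousLinearMap.lpPairing_eq_integral]
  refine integral_congr_ae ?_
  filter_upwards [φ.coeFn_toLp 2] with ξ hξ
  rw [hξ, ContinuousLinearMap.mul_apply']

/-- The action of a test function on the density of an `H^s` distribution. -/
noncomputable def sobolevPairing (s : ℝ) (φ : 𝓢(E, ℂ)) : Lp ℂ 2 (volume : Measure E) →L[ℂ] ℂ :=
  pairing (E := E) ((sobolevTest s φ).toLp 2 (volume : Measure E))

theorem sobolevPairing_apply (s : ℝ) (φ : 𝓢(E, ℂ)) (U : Lp ℂ 2 (volume : Measure E)) :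
    sobolevPairing s φ U = ∫ ξ, sobolevTest s φ ξ * U ξ :=
  pairing_toLp _ _

theorem norm_sobolevPairing_le (s : ℝ) (φ : 𝓢(E, ℂ)) (U : Lp ℂ 2 (volume : Measure E)) :
    ‖sobolevPairing s φ U‖ ≤ ‖pairing (E := E)‖ *
      ‖(sobolevTest s φ).toLp 2 (volume : Measure E)‖ * ‖U‖ :=
  ContinuousLinearMap.le_opNorm₂ _ _ _

theorem continuous_sobolevPairing (s : ℝ) (U : Lp ℂ 2 (volume : Measure E)) :
    Continuous fun φ : 𝓢(E, ℂ) => sobolevPairing s φ U :=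
  ((pairing (E := E)).continuous.comp
    (SchwartzMap.continuous_toLp.comp (sobolevTest s).continuous)).clm_apply continuous_const

/-- The two normalisations differ by a dilation by 2π; its Jacobian is the power of 2π. -/
theorem fourierInv_angularFourier (φ : 𝓢(E, ℂ)) (ξ : E) :
    𝓕⁻ (angularFourier φ) ξ =
      ((2 * Real.pi) ^ Module.finrank ℝ E : ℝ) • φ ((2 * Real.pi) • ξ) := by
  have hpi : (0 : ℝ) < 2 * Real.pi := by positivity
  have h1 : ∀ x, angularFourier φ x = 𝓕 φ ((2 * Real.pi)⁻¹ • x) := fun x => rfl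
  rw [SchwartzMap.fourierInv_coe, Real.fourierInv_eq']
  simp only [h1]
  have h2 := Measure.integral_comp_smul (volume : Measure E)
    (fun x => Complex.exp ((2 * Real.pi * inner ℝ x ((2 * Real.pi) • ξ) : ℝ) * Complex.I) •
      𝓕 φ x) (2 * Real.pi)⁻¹
  have h3 : ∀ x : E, inner ℝ ((2 * Real.pi)⁻¹ • x) ((2 * Real.pi) • ξ) = inner ℝ x ξ := fun x => by
    rw [inner_smul_left, inner_smul_right]
    simp only [conj_trivial]
    field_simp
  simp only [h3] at h2
  rw [h2, inv_pow, inv_inv, abs_of_pos (by positivity)]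
  congr 1
  have h4 := congrArg (fun f : 𝓢(E, ℂ) => f ((2 * Real.pi) • ξ))
    (FourierTransform.fourierInv_fourier_eq (F := 𝓢(E, ℂ)) φ)
  simp only [SchwartzMap.fourierInv_coe, Real.fourierInv_eq'] at h4
  exact h4

/-- A distribution with a Sobolev density has a function as Fourier transform. -/
theorem HasSobolevDensity.hasFourierTransform {s : ℝ} {T : 𝓢'(E, ℂ)} {G : E → ℂ}
    (h : HasSobolevDensity s T G) :
    HasFourierTransform T fun ξ =>
      (besselWeight (-s) ((2 * Real.pi)⁻¹ • ξ) : ℂ) * G ((2 * Real.pi)⁻¹ • ξ) := fun φ => by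
  have hpi : (0 : ℝ) < 2 * Real.pi := by positivity
  set f : E → ℂ := fun ξ => (besselWeight (-s) ((2 * Real.pi)⁻¹ • ξ) : ℂ) *
    G ((2 * Real.pi)⁻¹ • ξ) * φ ξ with hf
  have he : ∀ ξ, sobolevTest s (angularFourier φ) ξ * G ξ =
      ((2 * Real.pi) ^ Module.finrank ℝ E : ℝ) • f ((2 * Real.pi) • ξ) := fun ξ => by
    rw [sobolevTest_apply, fourierInv_angularFourier, hf]
    simp only [inv_smul_smul₀ hpi.ne']
    simp only [Complex.real_smul]
    ring
  have hi := integrable_schwartz_mul (sobolevTest s (angularFourier φ)) h.memLp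
  simp only [he] at hi
  rw [integrable_fun_smul_iff (by positivity : ((2 * Real.pi) ^ Module.finrank ℝ E : ℝ) ≠ 0),
    integrable_comp_smul_iff _ _ hpi.ne'] at hi
  refine ⟨hi, ?_⟩
  rw [h.apply_eq]
  simp only [he]
  rw [integral_smul, Measure.integral_comp_smul, abs_of_pos (by positivity), smul_smul,
    mul_inv_cancel₀ (by positivity), one_smul]

/-- The Laplacian becomes multiplication by `-(2π‖ξ‖)²`. -/
theorem fourierInv_laplacian (φ : 𝓢(E, ℂ)) (ξ : E) :
    𝓕⁻ (Δ φ) ξ = (-(2 * Real.pi * ‖ξ‖) ^ 2 : ℝ) • 𝓕⁻ φ ξ := by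
  -- The inverse transform at ξ is the transform at -ξ, and the symbol is even.
  have h1 : 𝓕 (Δ φ) (-ξ) = (-(2 * Real.pi * ‖ξ‖) ^ 2 : ℝ) • 𝓕 φ (-ξ) := by
    have h2 : 𝓕 (Δ φ) = (-(2 * Real.pi) ^ 2 : ℝ) •
        SchwartzMap.smulLeftCLM ℂ (fun ξ : E => ‖ξ‖ ^ 2) (𝓕 φ) := by
      rw [SchwartzMap.laplacian_eq_fourierMultiplierCLM, SchwartzMap.fourierMultiplierCLM_apply,
        FourierTransform.fourier_smul, FourierTransform.fourier_fourierInv_eq]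
    rw [h2, smul_apply, SchwartzMap.smulLeftCLM_apply_apply (by fun_prop), smul_smul,
      norm_neg]
    congr 1
    ring
  exact h1

end SobolevDensity

/-! ### Fubini for the memory term of the weak equation. -/

section TailIntegral

variable {k : ℝ → ℝ}

/-- Exchange of the order of integration in the memory term of the weak equation. -/
theorem integral_tail_swap (hk : ∀ s t, IntervalIntegrable k volume s t) {Q : ℝ → ℝ → ℂ}
    (hQ : Continuous (Function.uncurry Q)) {T : ℝ} (hT : 0 ≤ T)
    (hQT : ∀ s t, T ≤ t → Q s t = 0) :
    IntegrableOn (fun s => ∫ t in Ioi s, (k (t - s) : ℂ) * Q s t) (Ioi 0) ∧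
      ∫ s in Ioi (0 : ℝ), (∫ t in Ioi s, (k (t - s) : ℂ) * Q s t) =
        ∫ t in (0 : ℝ)..T, (∫ r in (0 : ℝ)..t, (k r : ℂ) * Q (t - r) t) ∧
      IntervalIntegrable (fun t => ∫ r in (0 : ℝ)..t, (k r : ℂ) * Q (t - r) t) volume 0 T := by
  -- The cut-offs in t - s and in s give an integrable convolution integrand, and clamping both
  -- arguments of Q to [0, T] by c makes that factor bounded. The support of y contains 0 because r
  -- = t corresponds to s = 0.
  set κ : ℝ → ℂ := indicator (Ioc 0 T) fun r => (k r : ℂ) with hκ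
  set y : ℝ → ℂ := indicator (Ico 0 T) fun _ => 1 with hy
  set c : ℝ → ℝ := fun s => max 0 (min s T) with hc
  have hcc : Continuous c := by fun_prop
  have hcI : ∀ {s}, 0 ≤ s → s ≤ T → c s = s := fun h0 h1 => by
    simp only [hc, min_eq_left h1, max_eq_right h0]
  have hcT : ∀ {s}, T ≤ s → c s = T := fun h => by
    simp only [hc, min_eq_right h, max_eq_right hT]
  have hcmem : ∀ s, c s ∈ Icc 0 T := fun s =>
    ⟨le_max_left _ _, max_le hT (min_le_right _ _)⟩
  have hκi : Integrable κ := by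
    have := (intervalIntegrable_iff_integrableOn_Ioc_of_le hT).1 (hk 0 T)
    exact (integrable_indicator_iff measurableSet_Ioc).2 this.ofReal
  have hyi : Integrable y :=
    (integrable_indicator_iff measurableSet_Ico).2 (by simp [integrableOn_const_iff])
  obtain ⟨M, hM⟩ := (isCompact_Icc.prod isCompact_Icc :
    IsCompact (Icc (0 : ℝ) T ×ˢ Icc (0 : ℝ) T)).exists_bound_of_continuousOn hQ.continuousOn
  set f : ℝ × ℝ → ℂ := fun p => Q (c p.2) (c p.1) * (y p.2 * κ (p.1 - p.2)) with hf
  have hfi : Integrable f (volume.prod volume) := by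
    have h1 := hyi.convolution_integrand (ContinuousLinearMap.mul ℂ ℂ) hκi
    refine Integrable.bdd_mul (c := M) h1 ?_ (ae_of_all _ fun p => ?_)
    · exact (hQ.comp (f := fun p : ℝ × ℝ => (c p.2, c p.1)) (by fun_prop)).aestronglyMeasurable
    · exact hM (c p.2, c p.1) ⟨hcmem _, hcmem _⟩
  have hs : ∀ s ∈ Ici (0 : ℝ),
      (∫ t in Ioi s, (k (t - s) : ℂ) * Q s t) = ∫ t, f (t, s) := fun s hs0 => by
    have hs0 : 0 ≤ s := hs0
    rw [← integral_indicator measurableSet_Ioi]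
    congr 1
    ext t
    by_cases hst : s < t
    · rw [indicator_of_mem (mem_Ioi.2 hst)]
      simp only [hf]
      rcases le_or_gt T t with htT | htT
      · rw [hQT s t htT, hcT htT, hQT _ _ le_rfl, mul_zero, zero_mul]
      · rw [hcI hs0 (by linarith), hcI (by linarith) htT.le, hy,
          indicator_of_mem (mem_Ico.2 ⟨hs0, by linarith⟩), hκ,
          indicator_of_mem (mem_Ioc.2 ⟨by linarith, by linarith⟩), one_mul, mul_comm]
    · rw [indicator_of_notMem (by simpa using hst)]
      simp only [hf, hκ]
      rw [indicator_of_notMem (fun h => hst (by linarith [h.1])), mul_zero, mul_zero]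
  have hs' : ∀ s ∉ Ici (0 : ℝ), (∫ t, f (t, s)) = 0 := fun s hs0 => by
    have h1 : y s = 0 := indicator_of_notMem (fun h => hs0 h.1) _
    simp only [hf, h1, zero_mul, mul_zero, integral_zero]
  have ht : ∀ t ∈ Ioc 0 T, (∫ s, f (t, s)) = ∫ r in (0 : ℝ)..t, (k r : ℂ) * Q (t - r) t :=
      fun t ht => by
    rw [intervalIntegral.integral_of_le ht.1.le, ← integral_indicator measurableSet_Ioc,
      ← integral_sub_left_eq_self _ volume t]
    congr 1
    ext r
    simp only [hf, sub_sub_cancel]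
    by_cases hr : r ∈ Ioc 0 t
    · rw [indicator_of_mem hr, hcI (by linarith [hr.2]) (by linarith [hr.1, ht.2]),
        hcI ht.1.le ht.2, hy,
        indicator_of_mem (mem_Ico.2 ⟨by linarith [hr.2], by linarith [hr.1, ht.2]⟩), hκ,
        indicator_of_mem (mem_Ioc.2 ⟨hr.1, by linarith [hr.2, ht.2]⟩), one_mul, mul_comm]
    · rw [indicator_of_notMem hr]
      by_cases h0 : 0 < r
      · have : ¬ r ≤ t := fun h => hr ⟨h0, h⟩
        rw [hy, indicator_of_notMem fun h => this (by linarith [h.1]), zero_mul, mul_zero]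
      · rw [hκ, indicator_of_notMem fun h => h0 h.1, mul_zero, mul_zero]
  have ht' : ∀ t ∉ Ioc 0 T, (∫ s, f (t, s)) = 0 := fun t ht => by
    refine integral_eq_zero_of_ae (ae_of_all _ fun s => ?_)
    simp only [hf, Pi.zero_apply]
    by_cases h0 : 0 < t
    · have : T ≤ t := by
        by_contra h
        exact ht ⟨h0, (not_le.1 h).le⟩
      rw [hcT this, hQT _ _ le_rfl, zero_mul]
    · by_cases hs0 : 0 ≤ s
      · rw [hκ, indicator_of_notMem fun h => h0 (by linarith [h.1]), mul_zero, mul_zero]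
      · rw [hy, indicator_of_notMem fun h => hs0 h.1, zero_mul, mul_zero]
  have hswap := integral_integral_swap (f := fun t s => f (t, s)) hfi
  have hsi : Integrable fun s => ∫ t, f (t, s) := hfi.integral_prod_right
  refine ⟨?_, ?_, ?_⟩
  · rw [← integrableOn_Ici_iff_integrableOn_Ioi]
    exact (integrableOn_congr_fun hs measurableSet_Ici).2 hsi.integrableOn
  · rw [← integral_Ici_eq_integral_Ioi, setIntegral_congr_fun measurableSet_Ici hs,
      setIntegral_eq_integral_of_forall_compl_eq_zero hs', ← hswap,
      ← setIntegral_eq_integral_of_forall_compl_eq_zero ht', setIntegral_congr_fun measurableSet_Ioc ht,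
      intervalIntegral.integral_of_le hT]
  · rw [intervalIntegrable_iff_integrableOn_Ioc_of_le hT]
    exact (integrableOn_congr_fun ht measurableSet_Ioc).1 hfi.integral_prod_left.integrableOn

end TailIntegral

/-! ### Time slices of test functions: uniform decay and differentiability. -/

section Slice

variable {E : Type*} [NormedAddCommGroup E] [InnerProductSpace ℝ E]

theorem exists_slice_eq_zero (Φ : 𝓓((⊤ : TopologicalSpace.Opens (E × ℝ)), ℂ)) :
    ∃ T : ℝ, 0 < T ∧ ∀ t, T ≤ t → slice Φ t = 0 := by
  obtain ⟨R, hR⟩ := Φ.hasCompactSupport.isCompact.isBounded.exists_norm_le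
  refine ⟨max R 0 + 1, by positivity, fun t ht => ?_⟩
  ext x
  rw [slice_apply]
  by_contra h
  have h1 := hR _ (subset_tsupport _ (Function.mem_support.2 h))
  have h2 : ‖t‖ ≤ ‖(x, t)‖ := norm_snd_le (x, t)
  have h3 := le_abs_self t
  rw [Real.norm_eq_abs] at h2
  linarith [le_max_left R 0]

/-- A slice is a translate composed with the inclusion x ↦ (x, 0) of norm at most one, and ‖x‖ ≤
‖(x, t)‖. Hence all slices lie in one bounded subset of the Schwartz space. -/
theorem seminorm_slice_le (Φ : 𝓓((⊤ : TopologicalSpace.Opens (E × ℝ)), ℂ)) (k n : ℕ) (t : ℝ) :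
    SchwartzMap.seminorm ℝ k n (slice Φ t) ≤
      SchwartzMap.seminorm ℝ k n (Φ.hasCompactSupport.toSchwartzMap Φ.contDiff) := by
  refine SchwartzMap.seminorm_le_bound ℝ k n _ (apply_nonneg _ _) fun x => ?_
  have h1 : ⇑(slice Φ t) =
      (fun p : E × ℝ => Φ (p + (0, t))) ∘ ContinuousLinearMap.inl ℝ E ℝ := by
    ext x
    simp
  have h2 : ContDiff ℝ ∞ fun p : E × ℝ => Φ (p + (0, t)) :=
    Φ.contDiff.comp (contDiff_id.add contDiff_const)
  have h3 : ‖iteratedFDeriv ℝ n (slice Φ t) x‖ ≤ ‖iteratedFDeriv ℝ n Φ (x, t)‖ := by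
    rw [h1, ContinuousLinearMap.iteratedFDeriv_comp_right _ h2 _ (mod_cast le_top),
      iteratedFDeriv_comp_add_right]
    refine (ContinuousMultilinearMap.norm_compContinuousLinearMap_le _ _).trans ?_
    have h4 : ∏ _i : Fin n, ‖ContinuousLinearMap.inl ℝ E ℝ‖ ≤ 1 :=
      Finset.prod_le_one (fun _ _ => by positivity)
        fun _ _ => ContinuousLinearMap.norm_inl_le_one ℝ E ℝ
    refine (mul_le_of_le_one_right (norm_nonneg _) h4).trans_eq ?_
    simp
  calc ‖x‖ ^ k * ‖iteratedFDeriv ℝ n (slice Φ t) x‖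
      ≤ ‖(x, t)‖ ^ k * ‖iteratedFDeriv ℝ n Φ (x, t)‖ := by
        gcongr
        exact norm_fst_le (x, t)
    _ ≤ _ := SchwartzMap.le_seminorm ℝ k n
        (Φ.hasCompactSupport.toSchwartzMap Φ.contDiff) (x, t)

/-- The slices of a test function have uniform decay after a continuous operator. -/
theorem exists_bound_map_slice (L : 𝓢(E, ℂ) →L[ℂ] 𝓢(E, ℂ))
    (Φ : 𝓓((⊤ : TopologicalSpace.Opens (E × ℝ)), ℂ)) (r : ℕ) :
    ∃ C : ℝ, 0 ≤ C ∧ ∀ t x, ‖L (slice Φ t) x‖ ≤ C * (1 + ‖x‖) ^ (-(r : ℝ)) := by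
  have h1 : Bornology.IsVonNBounded ℝ (range (slice Φ)) := by
    rw [(schwartz_withSeminorms ℝ E ℂ).isVonNBounded_iff_seminorm_bounded]
    rintro ⟨k, n⟩
    refine ⟨SchwartzMap.seminorm ℝ k n (Φ.hasCompactSupport.toSchwartzMap Φ.contDiff) + 1,
      by positivity, ?_⟩
    rintro _ ⟨t, rfl⟩
    exact (seminorm_slice_le Φ k n t).trans_lt (lt_add_one _)
  -- A continuous linear map sends the bounded set of slices to a bounded set, so one seminorm bound
  -- serves all t.
  have h2 := h1.image (L.restrictScalars ℝ)
  rw [(schwartz_withSeminorms ℝ E ℂ).isVonNBounded_iff_finset_seminorm_bounded] at h2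
  obtain ⟨C, hC, h⟩ := h2 (Finset.Iic (r, 0))
  refine ⟨2 ^ r * C, by positivity, fun t x => ?_⟩
  have h3 := SchwartzMap.one_add_le_sup_seminorm_apply (𝕜 := ℝ) (m := (r, 0)) le_rfl le_rfl
    (L (slice Φ t)) x
  rw [norm_iteratedFDeriv_zero] at h3
  have h4 := h _ (mem_image_of_mem _ (mem_range_self t))
  rw [Real.rpow_neg (by positivity), Real.rpow_natCast, ← div_eq_mul_inv,
    le_div_iff₀ (by positivity), mul_comm]
  refine h3.trans ?_
  gcongr
  exact h4.le

theorem hasDerivAt_slice_apply (Φ : 𝓓((⊤ : TopologicalSpace.Opens (E × ℝ)), ℂ)) (t : ℝ) (x : E) :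
    HasDerivAt (fun t => slice Φ t x) (slice (∂_{((0 : E), (1 : ℝ))} Φ) t x) t := by
  have h1 : DifferentiableAt ℝ Φ (x, t) := Φ.contDiff.differentiable (by simp) _
  have h2 : slice (∂_{((0 : E), (1 : ℝ))} Φ) t x = fderiv ℝ Φ (x, t) (0, 1) := by
    rw [slice_apply, TestFunction.lineDerivOp_eq_lineDerivCLM (𝕜 := ℝ), TestFunction.lineDerivCLM_apply,
      if_pos (by simp), h1.lineDeriv_eq_fderiv]
  rw [h2]
  exact h1.hasFDerivAt.comp_hasDerivAt t ((hasDerivAt_const t x).prodMk (hasDerivAt_id t))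

variable [FiniteDimensional ℝ E] [MeasurableSpace E] [BorelSpace E]

variable (E) in
/-- An integrable and square integrable bound for the slices of test functions. -/
noncomputable def decay (x : E) : ℝ := (1 + ‖x‖) ^ (-((Module.finrank ℝ E + 1 : ℕ) : ℝ))

theorem decay_nonneg (x : E) : 0 ≤ decay E x := Real.rpow_nonneg (by positivity) _

theorem integrable_decay : Integrable (decay E) :=
  integrable_one_add_norm (by push_cast; linarith)

theorem continuous_decay : Continuous (decay E) :=
  Continuous.rpow_const (by fun_prop) fun x => Or.inl (by positivity)

theorem memLp_decay : MemLp (decay E) 2 := by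
  rw [memLp_two_iff_integrable_sq continuous_decay.aestronglyMeasurable]
  refine integrable_decay.mono' (continuous_decay.pow 2).aestronglyMeasurable
    (ae_of_all _ fun x => ?_)
  have h1 : decay E x ≤ 1 :=
    Real.rpow_le_one_of_one_le_of_nonpos (by linarith [norm_nonneg x])
      (neg_nonpos.2 (Nat.cast_nonneg _))
  rw [Real.norm_of_nonneg (by positivity), sq]
  exact mul_le_of_le_one_left (decay_nonneg x) h1

/-- Uniform decay of the slices of the time derivative allows differentiation under the integral.
Differentiability at each frequency suffices; none is needed in the Schwartz topology. -/
theorem hasDerivAt_fourierInv_slice (Φ : 𝓓((⊤ : TopologicalSpace.Opens (E × ℝ)), ℂ)) (t : ℝ)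
    (ξ : E) :
    HasDerivAt (fun t => 𝓕⁻ (slice Φ t) ξ) (𝓕⁻ (slice (∂_{((0 : E), (1 : ℝ))} Φ) t) ξ) t := by
  simp only [SchwartzMap.fourierInv_coe, Real.fourierInv_eq']
  obtain ⟨C, -, hC⟩ := exists_bound_map_slice (ContinuousLinearMap.id ℂ _)
    (∂_{((0 : E), (1 : ℝ))} Φ) (Module.finrank ℝ E + 1)
  have he : ∀ x : E, ‖Complex.exp ((2 * Real.pi * inner ℝ x ξ : ℝ) * Complex.I)‖ = 1 :=
    fun x => Complex.norm_exp_ofReal_mul_I _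
  have hm : ∀ t, AEStronglyMeasurable (fun x : E =>
      Complex.exp ((2 * Real.pi * inner ℝ x ξ : ℝ) * Complex.I) • slice Φ t x) := fun t =>
    (by fun_prop : Continuous fun x : E =>
      Complex.exp ((2 * Real.pi * inner ℝ x ξ : ℝ) * Complex.I) • slice Φ t x).aestronglyMeasurable
  have hm' : AEStronglyMeasurable (fun x : E =>
      Complex.exp ((2 * Real.pi * inner ℝ x ξ : ℝ) * Complex.I) •
        slice (∂_{((0 : E), (1 : ℝ))} Φ) t x) :=
    (by fun_prop : Continuous fun x : E =>
      Complex.exp ((2 * Real.pi * inner ℝ x ξ : ℝ) * Complex.I) •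
        slice (∂_{((0 : E), (1 : ℝ))} Φ) t x).aestronglyMeasurable
  refine (hasDerivAt_integral_of_dominated_loc_of_deriv_le (F' := fun t x =>
      Complex.exp ((2 * Real.pi * inner ℝ x ξ : ℝ) * Complex.I) •
        slice (∂_{((0 : E), (1 : ℝ))} Φ) t x) (Metric.ball_mem_nhds t one_pos)
    (Eventually.of_forall hm) ?_ hm' (bound := fun x => C * decay E x) (ae_of_all _ fun x s _ => ?_)
    (integrable_decay.const_mul C) (ae_of_all _ fun x s _ => ?_)).2
  · refine ((slice Φ t).integrable (μ := volume)).norm.mono' (hm t) (ae_of_all _ fun x => ?_)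
    rw [norm_smul, he, one_mul]
  · rw [norm_smul, he, one_mul]
    exact hC s x
  · exact (hasDerivAt_slice_apply Φ s x).const_smul
      (Complex.exp ((2 * Real.pi * inner ℝ x ξ : ℝ) * Complex.I))

theorem hasDerivAt_sobolevTest_slice (σ : ℝ) (Φ : 𝓓((⊤ : TopologicalSpace.Opens (E × ℝ)), ℂ))
    (t : ℝ) (ξ : E) :
    HasDerivAt (fun t => sobolevTest σ (slice Φ t) ξ)
      (sobolevTest σ (slice (∂_{((0 : E), (1 : ℝ))} Φ) t) ξ) t := by
  simp only [sobolevTest_apply]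
  exact (hasDerivAt_fourierInv_slice Φ t ξ).const_mul _

theorem sobolevTest_laplacian (σ : ℝ) (φ : 𝓢(E, ℂ)) (ξ : E) :
    sobolevTest σ (Δ φ) ξ = (-(2 * Real.pi * ‖ξ‖) ^ 2 : ℝ) • sobolevTest σ φ ξ := by
  rw [sobolevTest_apply, sobolevTest_apply, fourierInv_laplacian, mul_smul_comm]

end Slice

/-- Dominated convergence applies to the squared difference, with majorant (2‖F‖)². -/
theorem continuous_toLp_of_dominated {X : Type*} [MeasurableSpace X] {μ : Measure X}
    {f : ℝ → X → ℂ} (hf : ∀ t, MemLp (f t) 2 μ) {F : X → ℂ} (hF : MemLp F 2 μ)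
    (hb : ∀ t x, ‖f t x‖ ≤ ‖F x‖) (hc : ∀ x, Continuous fun t => f t x) :
    Continuous fun t => (hf t).toLp := by
  rw [continuous_iff_continuousAt]
  intro t₀
  rw [ContinuousAt, Lp.tendsto_Lp_iff_tendsto_eLpNorm'']
  have h1 : ∀ t, eLpNorm (f t - f t₀) 2 μ =
      ENNReal.ofReal ((∫ x, ‖f t x - f t₀ x‖ ^ (2 : ℝ) ∂μ) ^ (2⁻¹ : ℝ)) := fun t => by
    rw [((hf t).sub (hf t₀)).eLpNorm_eq_integral_rpow_norm (by simp) (by simp)]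
    simp
  simp only [h1]
  have hF2 : Integrable (fun x => (2 * ‖F x‖) ^ (2 : ℝ)) μ := by
    have := (memLp_two_iff_integrable_sq_norm hF.1).1 hF
    refine (this.const_mul 4).congr (ae_of_all _ fun x => ?_)
    simp only [Real.rpow_two]
    ring
  have h2 : Tendsto (fun t => ∫ x, ‖f t x - f t₀ x‖ ^ (2 : ℝ) ∂μ) (𝓝 t₀)
      (𝓝 (∫ x, ‖f t₀ x - f t₀ x‖ ^ (2 : ℝ) ∂μ)) := by
    refine tendsto_integral_filter_of_dominated_convergence _ (Eventually.of_forall fun t => ?_)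
      (Eventually.of_forall fun t => ae_of_all _ fun x => ?_) hF2 (ae_of_all _ fun x => ?_)
    · exact (((hf t).1.sub (hf t₀).1).norm.aemeasurable.pow_const _).aestronglyMeasurable
    · rw [Real.norm_of_nonneg (by positivity)]
      refine Real.rpow_le_rpow (norm_nonneg _) ((norm_sub_le _ _).trans ?_) (by norm_num)
      linarith [hb t x, hb t₀ x]
    · have : Continuous fun t => ‖f t x - f t₀ x‖ ^ (2 : ℝ) :=
        Continuous.rpow_const (((hc x).sub continuous_const).norm) fun _ => Or.inr (by norm_num)
      exact this.continuousAt
  have h3 := ENNReal.tendsto_ofReal (h2.rpow_const (p := 2⁻¹) (Or.inr (by norm_num)))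
  simpa using h3

/-! ### Construction of the solution in frequency space. -/

section Evolution

variable {E : Type*} [NormedAddCommGroup E] [InnerProductSpace ℝ E]

/-- The density at time `t` of the solution whose initial density is `F`. -/
noncomputable def evolve (a₀ : ℝ) (k : ℝ → ℝ) (F : E → ℂ) (t : ℝ) (ξ : E) : ℂ :=
  (resolvent a₀ k ((2 * Real.pi * ‖ξ‖) ^ 2) t : ℂ) * F ξ

variable {a₀ : ℝ} {k : ℝ → ℝ}

theorem evolve_zero (hk : ∀ s t, IntervalIntegrable k volume s t) (F : E → ℂ) :
    evolve a₀ k F 0 = F := by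
  ext ξ
  rw [evolve, resolvent_zero_right hk, Complex.ofReal_one, one_mul]

theorem norm_evolve_le (hz : ∀ l, 0 ≤ l → ∀ t, |resolvent a₀ k l t| ≤ 1) (F : E → ℂ) (t : ℝ)
    (ξ : E) : ‖evolve a₀ k F t ξ‖ ≤ ‖F ξ‖ := by
  rw [evolve, norm_mul, Complex.norm_real, Real.norm_eq_abs]
  exact mul_le_of_le_one_left (norm_nonneg _) (hz _ (sq_nonneg _) t)

theorem continuous_evolve (hk : ∀ s t, IntervalIntegrable k volume s t) (F : E → ℂ) (ξ : E) :
    Continuous fun t => evolve a₀ k F t ξ :=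
  (Complex.continuous_ofReal.comp (continuous_resolvent_right hk _)).mul continuous_const

theorem continuous_symbol (hk : ∀ s t, IntervalIntegrable k volume s t) :
    Continuous fun p : E × ℝ => (resolvent a₀ k ((2 * Real.pi * ‖p.1‖) ^ 2) p.2 : ℂ) :=
  Complex.continuous_ofReal.comp ((continuous_resolvent hk).comp
    (by fun_prop : Continuous fun p : E × ℝ => ((2 * Real.pi * ‖p.1‖) ^ 2, p.2)))

variable [FiniteDimensional ℝ E] [MeasurableSpace E] [BorelSpace E]

theorem memLp_evolve (hk : ∀ s t, IntervalIntegrable k volume s t)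
    (hz : ∀ l, 0 ≤ l → ∀ t, |resolvent a₀ k l t| ≤ 1) {F : E → ℂ} (hF : MemLp F 2) (t : ℝ) :
    MemLp (evolve a₀ k F t) 2 := by
  refine hF.of_le ?_ (ae_of_all _ (norm_evolve_le hz F t))
  exact ((continuous_symbol (a₀ := a₀) (E := E) hk).comp
    (by fun_prop : Continuous fun ξ : E => (ξ, t))).aestronglyMeasurable.mul hF.1

/-- Two distributions with the same Sobolev density agree. -/
theorem HasSobolevDensity.unique {s : ℝ} {S T : 𝓢'(E, ℂ)} {G : E → ℂ}
    (hS : HasSobolevDensity s S G) (hT : HasSobolevDensity s T G) : S = T := by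
  ext φ
  rw [hS.apply_eq, hT.apply_eq]

/-- The bound |z| ≤ 1 dominates all densities by ‖F‖, so continuity of z in t at each frequency
becomes L² continuity, and the Fourier isometry transports it to the Bessel potentials of u. -/
theorem exists_sobolev_evolution (hk : ∀ s t, IntervalIntegrable k volume s t)
    (hz : ∀ l, 0 ≤ l → ∀ t, |resolvent a₀ k l t| ≤ 1) {s : ℝ} {u₀ : 𝓢'(E, ℂ)}
    (hu₀ : TemperedDistribution.MemSobolev s 2 u₀) :
    ∃ (F : E → ℂ) (u : ℝ → 𝓢'(E, ℂ)), ContinuousInSobolev s u ∧ u 0 = u₀ ∧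
      ∀ t, HasSobolevDensity s (u t) (evolve a₀ k F t) := by
  obtain ⟨U₀, hU₀⟩ := hu₀
  have h0 := hasSobolevDensity_of_besselPotential hU₀
  set F : E → ℂ := ((𝓕 U₀ : Lp ℂ 2 (volume : Measure E)) : E → ℂ) with hF
  have hm := memLp_evolve hk hz h0.memLp
  set W : ℝ → Lp ℂ 2 (volume : Measure E) := fun t => 𝓕⁻ ((hm t).toLp) with hW
  set u : ℝ → 𝓢'(E, ℂ) := fun t =>
    TemperedDistribution.besselPotential E ℂ (-s) (W t : 𝓢'(E, ℂ)) with hu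
  have hb : ∀ t, TemperedDistribution.besselPotential E ℂ s (u t) = (W t : 𝓢'(E, ℂ)) := fun t =>
    (TemperedDistribution.besselPotential_neg_apply_eq_iff s _ _).1 rfl
  have hd : ∀ t, HasSobolevDensity s (u t) (evolve a₀ k F t) := fun t => by
    have h1 := hasSobolevDensity_of_besselPotential (hb t)
    rw [hW] at h1
    simp only [FourierTransform.fourier_fourierInv_eq] at h1
    exact h1.congr (hm t).coeFn_toLp
  refine ⟨F, u, ⟨W, Continuous.continuousOn ?_, fun t _ => hb t⟩, ?_, hd⟩
  · have h1 := continuous_toLp_of_dominated hm h0.memLp (norm_evolve_le hz F)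
      (continuous_evolve hk F)
    exact (Lp.fourierTransformₗᵢ E ℂ).symm.continuous.comp h1
  · have h1 := hd 0
    rw [evolve_zero hk] at h1
    exact h1.unique h0

end Evolution

/-! ### The evolved densities under the memory operator. -/

section WeakForm

variable {E : Type*} [NormedAddCommGroup E] [InnerProductSpace ℝ E]
variable {a₀ : ℝ} {k : ℝ → ℝ}

theorem causalConv_evolve (F : E → ℂ) (t : ℝ) (ξ : E) :
    causalConv k (fun t => evolve a₀ k F t ξ) t =
      ((causalConv k (resolvent a₀ k ((2 * Real.pi * ‖ξ‖) ^ 2)) t : ℝ) : ℂ) * F ξ := by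
  rw [causalConv, causalConv, ← intervalIntegral.integral_ofReal,
    ← intervalIntegral.integral_mul_const]
  congr 1
  ext r
  rw [evolve, Complex.real_smul, smul_eq_mul, Complex.ofReal_mul]
  ring

theorem memoryTerm_evolve (F : E → ℂ) (t : ℝ) (ξ : E) :
    memoryTerm a₀ k (fun t => evolve a₀ k F t ξ) t =
      ((memoryTerm a₀ k (resolvent a₀ k ((2 * Real.pi * ‖ξ‖) ^ 2)) t : ℝ) : ℂ) * F ξ := by
  rw [memoryTerm, memoryTerm, causalConv_evolve, evolve, Complex.real_smul, smul_eq_mul,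
    Complex.ofReal_add, Complex.ofReal_mul]
  ring

theorem hasDerivAt_evolve (hk : ∀ s t, IntervalIntegrable k volume s t) (F : E → ℂ) {t : ℝ}
    (ht : 0 < t) (ξ : E) :
    HasDerivAt (fun t => evolve a₀ k F t ξ)
      ((-(2 * Real.pi * ‖ξ‖) ^ 2 : ℝ) • memoryTerm a₀ k (fun t => evolve a₀ k F t ξ) t) t := by
  have h := ((hasDerivAt_resolvent (a₀ := a₀) hk ((2 * Real.pi * ‖ξ‖) ^ 2) ht).ofReal_comp).mul_const
    (F ξ)
  rw [memoryTerm_evolve]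
  refine h.congr_deriv ?_
  rw [Complex.real_smul]
  push_cast
  ring

theorem norm_memoryTerm_evolve_le (hk : ∀ s t, IntervalIntegrable k volume s t)
    (hz : ∀ l, 0 ≤ l → ∀ t, |resolvent a₀ k l t| ≤ 1) (F : E → ℂ) {t T : ℝ} (ht : 0 ≤ t)
    (htT : t ≤ T) (ξ : E) :
    ‖memoryTerm a₀ k (fun t => evolve a₀ k F t ξ) t‖ ≤ memoryBound a₀ k T * ‖F ξ‖ :=
  norm_memoryTerm_le hk ht htT fun _ _ => norm_evolve_le hz F _ ξ

/-- Continuity in ξ is used for measurability; |z| ≤ 1 lets |k| dominate the convolution integral.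
-/
theorem continuous_memoryTerm_symbol (hk : ∀ s t, IntervalIntegrable k volume s t)
    (hz : ∀ l, 0 ≤ l → ∀ t, |resolvent a₀ k l t| ≤ 1) (t : ℝ) :
    Continuous fun ξ : E => memoryTerm a₀ k (resolvent a₀ k ((2 * Real.pi * ‖ξ‖) ^ 2)) t := by
  have hr : ∀ t, Continuous fun ξ : E => resolvent a₀ k ((2 * Real.pi * ‖ξ‖) ^ 2) t := fun t =>
    (continuous_resolvent hk).comp
      (by fun_prop : Continuous fun ξ : E => ((2 * Real.pi * ‖ξ‖) ^ 2, t))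
  refine ((hr t).const_smul a₀).add ?_
  refine intervalIntegral.continuous_of_dominated_interval (bound := fun r => |k r|)
    (fun ξ => ?_) (fun ξ => ae_of_all _ fun r _ => ?_) (hk 0 t).abs
    (ae_of_all _ fun r _ => (hr (t - r)).const_smul (k r))
  · exact (intervalIntegrable_iff.1 (hk 0 t)).aestronglyMeasurable.smul
      ((continuous_resolvent_right hk _).comp (by fun_prop)).aestronglyMeasurable
  · rw [norm_smul, Real.norm_eq_abs]
    exact mul_le_of_le_one_right (abs_nonneg _) (hz _ (sq_nonneg _) _)

variable [FiniteDimensional ℝ E] [MeasurableSpace E] [BorelSpace E]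

theorem integrable_decay_mul_norm {F : E → ℂ} (hF : MemLp F 2) :
    Integrable fun ξ => decay E ξ * ‖F ξ‖ :=
  memLp_decay.integrable_mul hF.norm

theorem integrable_mul_evolve (hk : ∀ s t, IntervalIntegrable k volume s t)
    (hz : ∀ l, 0 ≤ l → ∀ t, |resolvent a₀ k l t| ≤ 1) {F : E → ℂ} (hF : MemLp F 2)
    (φ : 𝓢(E, ℂ)) (t : ℝ) : Integrable fun ξ => φ ξ * evolve a₀ k F t ξ :=
  integrable_schwartz_mul φ (memLp_evolve hk hz hF t)

theorem memLp_memoryTerm_evolve (hk : ∀ s t, IntervalIntegrable k volume s t)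
    (hz : ∀ l, 0 ≤ l → ∀ t, |resolvent a₀ k l t| ≤ 1) {F : E → ℂ} (hF : MemLp F 2) {t : ℝ}
    (ht : 0 ≤ t) : MemLp (fun ξ => memoryTerm a₀ k (fun t => evolve a₀ k F t ξ) t) 2 := by
  refine (hF.norm.const_mul (memoryBound a₀ k t)).of_le ?_ (ae_of_all _ fun ξ => ?_)
  · simp only [memoryTerm_evolve]
    exact (Complex.continuous_ofReal.comp
      (continuous_memoryTerm_symbol hk hz t)).aestronglyMeasurable.mul hF.1
  · exact (norm_memoryTerm_evolve_le hk hz F ht le_rfl ξ).trans (le_abs_self _)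

theorem memLp_causalConv_evolve (hk : ∀ s t, IntervalIntegrable k volume s t)
    (hz : ∀ l, 0 ≤ l → ∀ t, |resolvent a₀ k l t| ≤ 1) {F : E → ℂ} (hF : MemLp F 2) {t : ℝ}
    (ht : 0 ≤ t) : MemLp (fun ξ => causalConv k (fun t => evolve a₀ k F t ξ) t) 2 := by
  have h := (memLp_memoryTerm_evolve hk hz hF ht).sub ((memLp_evolve hk hz hF t).const_smul a₀)
  refine h.ae_eq (ae_of_all _ fun ξ => ?_)
  simp only [Pi.sub_apply, Pi.smul_apply, memoryTerm, add_sub_cancel_left]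

theorem continuous_integral_mul_evolve (hk : ∀ s t, IntervalIntegrable k volume s t)
    (hz : ∀ l, 0 ≤ l → ∀ t, |resolvent a₀ k l t| ≤ 1) {F : E → ℂ} (hF : MemLp F 2)
    {f : ℝ → 𝓢(E, ℂ)} {C : ℝ} (hf : ∀ ξ, Continuous fun t => f t ξ)
    (hC : ∀ t ξ, ‖f t ξ‖ ≤ C * decay E ξ) :
    Continuous fun p : ℝ × ℝ => ∫ ξ, f p.2 ξ * evolve a₀ k F p.1 ξ := by
  refine continuous_of_dominated (bound := fun ξ => C * (decay E ξ * ‖F ξ‖))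
    (fun p => (integrable_mul_evolve hk hz hF _ _).1) (fun p => ae_of_all _ fun ξ => ?_)
    ((integrable_decay_mul_norm hF).const_mul C) (ae_of_all _ fun ξ => ?_)
  · rw [norm_mul, ← mul_assoc]
    exact mul_le_mul (hC _ _) (norm_evolve_le hz F _ ξ) (norm_nonneg _)
      ((norm_nonneg _).trans (hC p.2 ξ))
  · exact ((hf ξ).comp continuous_snd).mul ((continuous_evolve hk F ξ).comp continuous_fst)

/-- Fubini in r and ξ, with majorant |k(r)| ‖φ(ξ) F(ξ)‖ by the bound |z| ≤ 1. -/
theorem integral_kernel_mul_evolve (hk : ∀ s t, IntervalIntegrable k volume s t)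
    (hz : ∀ l, 0 ≤ l → ∀ t, |resolvent a₀ k l t| ≤ 1) {F : E → ℂ} (hF : MemLp F 2)
    (φ : 𝓢(E, ℂ)) {t : ℝ} (ht : 0 ≤ t) :
    ∫ r in (0 : ℝ)..t, (k r : ℂ) * ∫ ξ, φ ξ * evolve a₀ k F (t - r) ξ =
      ∫ ξ, φ ξ * causalConv k (fun t => evolve a₀ k F t ξ) t := by
  have hi : Integrable (Function.uncurry fun (r : ℝ) (ξ : E) =>
      (k r : ℂ) * (φ ξ * evolve a₀ k F (t - r) ξ)) ((volume.restrict (Ioc 0 t)).prod volume) := by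
    have h1 : Integrable (fun r => (k r : ℂ)) (volume.restrict (Ioc 0 t)) :=
      ((intervalIntegrable_iff_integrableOn_Ioc_of_le ht).1 (hk 0 t)).ofReal
    have h2 := h1.mul_prod (integrable_schwartz_mul φ hF)
    refine h2.mono ?_ (ae_of_all _ fun p => ?_)
    · have h3 : AEStronglyMeasurable (fun p : ℝ × E =>
          (resolvent a₀ k ((2 * Real.pi * ‖p.2‖) ^ 2) (t - p.1) : ℂ))
          ((volume.restrict (Ioc 0 t)).prod volume) :=
        ((continuous_symbol (a₀ := a₀) (E := E) hk).comp
          (by fun_prop : Continuous fun p : ℝ × E => (p.2, t - p.1))).aestronglyMeasurable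
      refine (h3.mul h2.1).congr (ae_of_all _ fun p => ?_)
      simp only [Function.uncurry, evolve, Pi.mul_apply]
      ring
    · simp only [Function.uncurry, norm_mul]
      gcongr
      exact norm_evolve_le hz F _ _
  rw [intervalIntegral.integral_of_le ht]
  simp only [← integral_const_mul]
  rw [integral_integral_swap hi]
  congr 1
  ext ξ
  rw [causalConv, intervalIntegral.integral_of_le ht, ← integral_const_mul]
  congr 1
  ext r
  rw [Complex.real_smul]
  ring

end WeakForm

/-! ### The evolution solves the weak equation. -/

section WeakSolution

variable {E : Type*} [NormedAddCommGroup E] [InnerProductSpace ℝ E]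
  [FiniteDimensional ℝ E] [MeasurableSpace E] [BorelSpace E]
variable {a₀ : ℝ} {k : ℝ → ℝ}

theorem continuous_sobolevTest_slice (σ : ℝ) (Φ : 𝓓((⊤ : TopologicalSpace.Opens (E × ℝ)), ℂ))
    (ξ : E) : Continuous fun t => sobolevTest σ (slice Φ t) ξ :=
  continuous_iff_continuousAt.2 fun t => (hasDerivAt_sobolevTest_slice σ Φ t ξ).continuousAt

theorem continuous_sobolevTest_laplacian_slice (σ : ℝ)
    (Φ : 𝓓((⊤ : TopologicalSpace.Opens (E × ℝ)), ℂ)) (ξ : E) :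
    Continuous fun t => sobolevTest σ (Δ (slice Φ t)) ξ := by
  simp only [sobolevTest_laplacian]
  exact (continuous_sobolevTest_slice σ Φ ξ).const_smul (-(2 * Real.pi * ‖ξ‖) ^ 2 : ℝ)

theorem exists_bound_sobolevTest_slice (σ : ℝ)
    (Φ : 𝓓((⊤ : TopologicalSpace.Opens (E × ℝ)), ℂ)) :
    ∃ C, 0 ≤ C ∧ ∀ t ξ, ‖sobolevTest σ (slice Φ t) ξ‖ ≤ C * decay E ξ :=
  exists_bound_map_slice (sobolevTest σ) Φ _

theorem exists_bound_sobolevTest_laplacian_slice (σ : ℝ)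
    (Φ : 𝓓((⊤ : TopologicalSpace.Opens (E × ℝ)), ℂ)) :
    ∃ C, 0 ≤ C ∧ ∀ t ξ, ‖sobolevTest σ (Δ (slice Φ t)) ξ‖ ≤ C * decay E ξ := by
  simpa only [ContinuousLinearMap.comp_apply, SchwartzMap.laplacianCLM_eq, decay] using
    exists_bound_map_slice (sobolevTest σ ∘L LineDeriv.laplacianCLM ℂ E 𝓢(E, ℂ)) Φ _

/-- At each frequency the integrand is the time derivative of the test function times the evolved
density, because the Laplacian on the test side supplies the factor -(2π‖ξ‖)² of the evolution
equation. Only the boundary term at 0 survives. -/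
theorem integral_deriv_slice_mul_evolve (hk : ∀ s t, IntervalIntegrable k volume s t)
    (hz : ∀ l, 0 ≤ l → ∀ t, |resolvent a₀ k l t| ≤ 1) {F : E → ℂ} (hF : MemLp F 2) (σ : ℝ)
    (Φ : 𝓓((⊤ : TopologicalSpace.Opens (E × ℝ)), ℂ)) {T : ℝ} (hT : 0 ≤ T)
    (hΦ : slice Φ T = 0) :
    ∫ t in (0 : ℝ)..T, ∫ ξ, (sobolevTest σ (slice (∂_{((0 : E), (1 : ℝ))} Φ) t) ξ *
        evolve a₀ k F t ξ + sobolevTest σ (Δ (slice Φ t)) ξ *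
          memoryTerm a₀ k (fun t => evolve a₀ k F t ξ) t) =
      -∫ ξ, sobolevTest σ (slice Φ 0) ξ * F ξ := by
  set g : ℝ → E → ℂ := fun t ξ => sobolevTest σ (slice (∂_{((0 : E), (1 : ℝ))} Φ) t) ξ *
        evolve a₀ k F t ξ + sobolevTest σ (Δ (slice Φ t)) ξ *
          memoryTerm a₀ k (fun t => evolve a₀ k F t ξ) t with hg
  obtain ⟨C₁, hC₁, hb₁⟩ := exists_bound_sobolevTest_slice σ (∂_{((0 : E), (1 : ℝ))} Φ)
  obtain ⟨C₂, hC₂, hb₂⟩ := exists_bound_sobolevTest_laplacian_slice σ Φ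
  have hgc : ∀ ξ, Continuous fun t => g t ξ := fun ξ =>
    ((continuous_sobolevTest_slice σ _ ξ).mul (continuous_evolve hk F ξ)).add
      ((continuous_sobolevTest_laplacian_slice σ Φ ξ).mul
        (continuous_memoryTerm a₀ hk (continuous_evolve hk F ξ)))
  have hi : Integrable (Function.uncurry g) ((volume.restrict (Ioc 0 T)).prod volume) := by
    have h1 : Integrable (fun _ : ℝ => C₁ + C₂ * memoryBound a₀ k T)
        (volume.restrict (Ioc 0 T)) := by simp
    have h2 := h1.mul_prod (integrable_decay_mul_norm hF)
    refine h2.mono' ?_ ?_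
    · have hz' : ∀ ξ : E, Continuous (resolvent a₀ k ((2 * Real.pi * ‖ξ‖) ^ 2)) := fun ξ =>
        continuous_resolvent_right hk _
      -- F is only almost everywhere measurable, so it is split off; the remaining factor is
      -- continuous in each variable separately, hence jointly measurable.
      have h3 := stronglyMeasurable_uncurry_of_continuous_of_stronglyMeasurable
        (u := fun (t : ℝ) (ξ : E) => sobolevTest σ (slice (∂_{((0 : E), (1 : ℝ))} Φ) t) ξ *
          (resolvent a₀ k ((2 * Real.pi * ‖ξ‖) ^ 2) t : ℂ) + sobolevTest σ (Δ (slice Φ t)) ξ *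
          ((memoryTerm a₀ k (resolvent a₀ k ((2 * Real.pi * ‖ξ‖) ^ 2)) t : ℝ) : ℂ))
        (fun ξ => ((continuous_sobolevTest_slice σ _ ξ).mul
            (Complex.continuous_ofReal.comp (hz' ξ))).add
          ((continuous_sobolevTest_laplacian_slice σ Φ ξ).mul
            (Complex.continuous_ofReal.comp (continuous_memoryTerm a₀ hk (hz' ξ)))))
        (fun t => (((SchwartzMap.continuous _).mul ((continuous_symbol hk).comp
            (by fun_prop : Continuous fun ξ : E => (ξ, t)))).add
          ((SchwartzMap.continuous _).mul (Complex.continuous_ofReal.comp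
            (continuous_memoryTerm_symbol hk hz t)))).stronglyMeasurable)
      refine (h3.aestronglyMeasurable.mul hF.1.comp_snd).congr (ae_of_all _ ?_)
      rintro ⟨t, ξ⟩
      simp only [Function.uncurry, hg, Pi.mul_apply]
      rw [memoryTerm_evolve, evolve]
      ring
    · have h4 : ∀ᵐ p : ℝ × E ∂((volume.restrict (Ioc 0 T)).prod volume), p.1 ∈ Ioc 0 T :=
        Measure.quasiMeasurePreserving_fst.ae (ae_restrict_mem measurableSet_Ioc)
      filter_upwards [h4] with p hp
      have h5 := norm_memoryTerm_evolve_le hk hz F hp.1.le hp.2 p.2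
      refine (norm_add_le _ _).trans ?_
      rw [norm_mul, norm_mul]
      calc _ ≤ C₁ * decay E p.2 * ‖F p.2‖ +
            C₂ * decay E p.2 * (memoryBound a₀ k T * ‖F p.2‖) := by
            gcongr
            · exact mul_nonneg hC₁ (decay_nonneg _)
            · exact hb₁ _ _
            · exact norm_evolve_le hz F _ _
            · exact mul_nonneg hC₂ (decay_nonneg _)
            · exact hb₂ _ _
        _ = _ := by ring
  rw [intervalIntegral.integral_of_le hT, integral_integral_swap hi, ← integral_neg]
  congr 1
  ext ξ
  rw [← intervalIntegral.integral_of_le hT]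
  have h6 := intervalIntegral.integral_eq_sub_of_hasDerivAt_of_le hT
    (f := fun t => sobolevTest σ (slice Φ t) ξ * evolve a₀ k F t ξ) (f' := fun t => g t ξ)
    ((continuous_sobolevTest_slice σ Φ ξ).mul (continuous_evolve hk F ξ)).continuousOn
    (fun t ht => ?_) ((hgc ξ).intervalIntegrable _ _)
  · rw [h6, hΦ, evolve_zero hk, map_zero, zero_apply, zero_mul, zero_sub]
  · refine ((hasDerivAt_sobolevTest_slice σ Φ t ξ).mul
      (hasDerivAt_evolve hk F ht.1 ξ)).congr_deriv ?_
    simp only [hg, sobolevTest_laplacian, Complex.real_smul]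
    ring

theorem slice_terms_eq_integral (hk : ∀ s t, IntervalIntegrable k volume s t)
    (hz : ∀ l, 0 ≤ l → ∀ t, |resolvent a₀ k l t| ≤ 1) {F : E → ℂ} (hF : MemLp F 2)
    (φ ψ : 𝓢(E, ℂ)) {t : ℝ} (ht : 0 ≤ t) :
    ((∫ ξ, φ ξ * evolve a₀ k F t ξ) + (a₀ : ℂ) * ∫ ξ, ψ ξ * evolve a₀ k F t ξ) +
        (∫ r in (0 : ℝ)..t, (k r : ℂ) * ∫ ξ, ψ ξ * evolve a₀ k F (t - r) ξ) =
      ∫ ξ, (φ ξ * evolve a₀ k F t ξ +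
        ψ ξ * memoryTerm a₀ k (fun t => evolve a₀ k F t ξ) t) := by
  have h1 : Integrable fun ξ => φ ξ * evolve a₀ k F t ξ + (a₀ : ℂ) * (ψ ξ * evolve a₀ k F t ξ) :=
    (integrable_mul_evolve hk hz hF φ t).add ((integrable_mul_evolve hk hz hF ψ t).const_mul _)
  rw [integral_kernel_mul_evolve hk hz hF ψ ht, ← integral_const_mul,
    ← integral_add (integrable_mul_evolve hk hz hF φ t)
      ((integrable_mul_evolve hk hz hF ψ t).const_mul _),
    ← integral_add h1 (integrable_schwartz_mul ψ (memLp_causalConv_evolve hk hz hF ht))]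
  congr 1
  ext ξ
  rw [memoryTerm, Complex.real_smul]
  ring

theorem laplacian_zero : Δ (0 : 𝓢(E, ℂ)) = 0 := map_zero (LineDeriv.laplacianCLM ℝ E 𝓢(E, ℂ))

/-- Reduction of the weak equation to a finite time interval, for a continuous family of
distributions. -/
theorem weakForm_eq_integral {a : ℝ → ℝ} (ha : IsAdmissibleKernel a) {u : ℝ → 𝓢'(E, ℂ)}
    {p q : ℝ → 𝓢(E, ℂ)}
    (hp : Continuous fun x : ℝ × ℝ => u (max x.1 0) (p x.2))
    (hq : Continuous fun x : ℝ × ℝ => u (max x.1 0) (q x.2))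
    {T : ℝ} (hT : 0 ≤ T) (hpT : ∀ t, T ≤ t → p t = 0) (hqT : ∀ t, T ≤ t → q t = 0) :
    ∫ s in Ioi (0 : ℝ), (u s (p s + (a₀ : ℂ) • q s) +
        ∫ t in Ioi s, (a (t - s) : ℂ) * u s (q t)) =
      ∫ t in (0 : ℝ)..T, ((u t (p t) + (a₀ : ℂ) * u t (q t)) +
        ∫ r in (0 : ℝ)..t, (extendedKernel a r : ℂ) * u (t - r) (q t)) := by
  have hk := intervalIntegrable_extendedKernel ha
  set P : ℝ → ℂ := fun s => u (max s 0) (p s) + (a₀ : ℂ) * u (max s 0) (q s) with hP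
  have hPc : Continuous P :=
    (hp.comp (by fun_prop : Continuous fun s : ℝ => (s, s))).add
      (continuous_const.mul (hq.comp (by fun_prop : Continuous fun s : ℝ => (s, s))))
  obtain ⟨htail, hswap, hswapi⟩ := integral_tail_swap hk (Q := fun s t => u (max s 0) (q t)) hq hT
    fun s t ht => by rw [hqT t ht, map_zero]
  have hP0 : ∀ s ∈ Ioi (0 : ℝ) \ Ioc 0 T, P s = 0 := fun s hs => by
    have hsT : T ≤ s := by
      by_contra h
      exact hs.2 ⟨hs.1, (not_le.1 h).le⟩
    simp only [hP, hpT s hsT, hqT s hsT, map_zero, mul_zero, add_zero]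
  have hPi : IntegrableOn P (Ioi 0) :=
    ((hPc.integrableOn_Ioc (a := 0) (b := T)).of_forall_sdiff_eq_zero measurableSet_Ioi hP0)
  have h1 : ∀ s ∈ Ioi (0 : ℝ), (u s (p s + (a₀ : ℂ) • q s) +
      ∫ t in Ioi s, (a (t - s) : ℂ) * u s (q t)) =
        P s + ∫ t in Ioi s, (extendedKernel a (t - s) : ℂ) * u (max s 0) (q t) := fun s hs => by
    rw [map_add, map_smul, smul_eq_mul]
    simp only [hP, max_eq_left (mem_Ioi.1 hs).le]
    congr 1
    refine setIntegral_congr_fun measurableSet_Ioi fun t ht => ?_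
    rw [extendedKernel, indicator_of_mem (mem_Ioi.2 (sub_pos.2 ht))]
  rw [setIntegral_congr_fun measurableSet_Ioi h1, integral_add hPi htail, hswap,
    setIntegral_eq_of_subset_of_forall_sdiff_eq_zero
      measurableSet_Ioi Ioc_subset_Ioi_self hP0, ← intervalIntegral.integral_of_le hT,
    ← intervalIntegral.integral_add (hPc.intervalIntegrable _ _) hswapi]
  refine intervalIntegral.integral_congr fun t ht => ?_
  rw [uIcc_of_le hT] at ht
  simp only [hP, max_eq_left ht.1]
  congr 1
  refine intervalIntegral.integral_congr fun r hr => ?_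
  rw [uIcc_of_le ht.1] at hr
  simp only [max_eq_left (sub_nonneg.2 hr.2)]

theorem solvesWeakly_of_density {a : ℝ → ℝ} (ha : IsAdmissibleKernel a)
    (hz : ∀ l, 0 ≤ l → ∀ t, |resolvent a₀ (extendedKernel a) l t| ≤ 1) {σ : ℝ} {F : E → ℂ}
    {u : ℝ → 𝓢'(E, ℂ)} (hu : ∀ t, HasSobolevDensity σ (u t) (evolve a₀ (extendedKernel a) F t)) :
    SolvesWeakly a₀ a u := fun Φ => by
  have hk := intervalIntegrable_extendedKernel ha
  have hF : MemLp F 2 := by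
    have := (hu 0).memLp
    rwa [evolve_zero hk] at this
  obtain ⟨T₁, hT₁, hΦ₁⟩ := exists_slice_eq_zero Φ
  obtain ⟨T₂, -, hΦ₂⟩ := exists_slice_eq_zero (∂_{((0 : E), (1 : ℝ))} Φ)
  have hT : 0 ≤ max T₁ T₂ := hT₁.le.trans (le_max_left _ _)
  obtain ⟨C₁, -, hb₁⟩ := exists_bound_sobolevTest_slice σ (∂_{((0 : E), (1 : ℝ))} Φ)
  obtain ⟨C₂, -, hb₂⟩ := exists_bound_sobolevTest_laplacian_slice σ Φ
  have hmax : Continuous fun x : ℝ × ℝ => (max x.1 0, x.2) := by fun_prop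
  have hq := (continuous_integral_mul_evolve hk hz hF
    (continuous_sobolevTest_laplacian_slice σ Φ) hb₂).comp hmax
  have hp := (continuous_integral_mul_evolve hk hz hF
    (continuous_sobolevTest_slice σ (∂_{((0 : E), (1 : ℝ))} Φ)) hb₁).comp hmax
  rw [weakForm_eq_integral ha (p := slice (∂_{((0 : E), (1 : ℝ))} Φ))
    (q := fun t => Δ (slice Φ t)) (T := max T₁ T₂) ?_ ?_ hT
    (fun t ht => hΦ₂ t ((le_max_right _ _).trans ht)) fun t ht => by
      rw [hΦ₁ t ((le_max_left _ _).trans ht), laplacian_zero]]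
  · simp only [(hu _).apply_eq]
    rw [intervalIntegral.integral_congr (g := fun t => ∫ ξ,
      (sobolevTest σ (slice (∂_{((0 : E), (1 : ℝ))} Φ) t) ξ *
        evolve a₀ (extendedKernel a) F t ξ + sobolevTest σ (Δ (slice Φ t)) ξ *
          memoryTerm a₀ (extendedKernel a) (fun t => evolve a₀ (extendedKernel a) F t ξ) t))
      fun t ht => ?_, integral_deriv_slice_mul_evolve hk hz hF σ Φ hT (hΦ₁ _ (le_max_left _ _)),
      evolve_zero hk, neg_add_cancel]
    rw [uIcc_of_le hT] at ht
    exact slice_terms_eq_integral hk hz hF _ _ ht.1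
  · simpa only [(hu _).apply_eq] using! hp
  · simpa only [(hu _).apply_eq] using! hq

end WeakSolution

/-! ### Density of compactly supported functions, and primitives as test functions. -/

section Density

variable {E : Type*} [NormedAddCommGroup E] [InnerProductSpace ℝ E] [FiniteDimensional ℝ E]

theorem exists_bound_iteratedFDeriv_one_sub_bump (χ : ContDiffBump (0 : E)) (i : ℕ) :
    ∃ B : ℝ, 0 ≤ B ∧ ∀ y, ‖iteratedFDeriv ℝ i (fun x => 1 - χ x) y‖ ≤ B := by
  have hc : Continuous fun y => iteratedFDeriv ℝ i (fun x => 1 - χ x) y :=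
    (contDiff_const.sub (χ.contDiff (n := ⊤))).continuous_iteratedFDeriv (mod_cast le_top)
  have hs : HasCompactSupport fun y => iteratedFDeriv ℝ i χ y := χ.hasCompactSupport.iteratedFDeriv i
  have hc' : Continuous fun y => iteratedFDeriv ℝ i χ y :=
    (χ.contDiff (n := ⊤)).continuous_iteratedFDeriv (mod_cast le_top)
  obtain ⟨B, hB⟩ := hs.exists_bound_of_continuous hc'
  refine ⟨B + 1, by linarith [(norm_nonneg _).trans (hB 0)], fun y => ?_⟩
  have h1 : iteratedFDeriv ℝ i (fun x => 1 - χ x) y =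
      iteratedFDeriv ℝ i (fun _ : E => (1 : ℝ)) y - iteratedFDeriv ℝ i χ y :=
    iteratedFDeriv_sub_apply contDiff_const.contDiffAt (χ.contDiff (n := i)).contDiffAt
  have h2 : ‖iteratedFDeriv ℝ i (fun _ : E => (1 : ℝ)) y‖ ≤ 1 := by
    rcases Nat.eq_zero_or_pos i with rfl | hi
    · simp
    · rw [iteratedFDeriv_const_of_ne hi.ne']
      simp
  rw [h1]
  linarith [norm_sub_le (iteratedFDeriv ℝ i (fun _ : E => (1 : ℝ)) y) (iteratedFDeriv ℝ i χ y),
    hB y]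

theorem norm_iteratedFDeriv_comp_smul_le {f : E → ℝ} (hf : ContDiff ℝ ∞ f) {c : ℝ} (hc : |c| ≤ 1)
    (i : ℕ) (x : E) :
    ‖iteratedFDeriv ℝ i (fun x => f (c • x)) x‖ ≤ ‖iteratedFDeriv ℝ i f (c • x)‖ := by
  have h1 : (fun x => f (c • x)) = f ∘ (c • ContinuousLinearMap.id ℝ E) := by
    ext x
    simp
  rw [h1, ContinuousLinearMap.iteratedFDeriv_comp_right _ hf _ (mod_cast le_top)]
  refine (ContinuousMultilinearMap.norm_compContinuousLinearMap_le _ _).trans ?_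
  have h2 : ‖c • ContinuousLinearMap.id ℝ E‖ ≤ 1 := by
    rw [norm_smul, Real.norm_eq_abs]
    exact mul_le_one₀ hc (norm_nonneg _) ContinuousLinearMap.norm_id_le
  refine (mul_le_of_le_one_right (norm_nonneg _)
    (Finset.prod_le_one (fun _ _ => norm_nonneg _) fun _ _ => h2)).trans_eq ?_
  simp

/-- Smooth compactly supported functions are dense in the Schwartz space. -/
theorem dense_hasCompactSupport : Dense {φ : 𝓢(E, ℂ) | HasCompactSupport φ} := fun φ => by
  set χ : ContDiffBump (0 : E) := ⟨1, 2, one_pos, one_lt_two⟩ with hχ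
  set c : ℕ → ℝ := fun n => ((n : ℝ) + 1)⁻¹ with hc
  have hc0 : ∀ n, 0 < c n := fun n => by positivity
  have hc1 : ∀ n, c n ≤ 1 := fun n => inv_le_one_of_one_le₀ (by linarith [n.cast_nonneg (α := ℝ)])
  have hs : ∀ n, HasCompactSupport fun x => χ (c n • x) • φ x := fun n => by
    have : HasCompactSupport fun x => χ (c n • x) :=
      χ.hasCompactSupport.comp_homeomorph (Homeomorph.smulOfNeZero (c n) (hc0 n).ne')
    exact this.smul_right
  have hd : ∀ n, ContDiff ℝ ∞ fun x => χ (c n • x) • φ x := fun n =>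
    (χ.contDiff.comp (contDiff_const_smul (c n))).smul (φ.smooth ⊤)
  have hη : ContDiff ℝ ∞ fun x => 1 - χ x := contDiff_const.sub χ.contDiff
  have hηn : ∀ n, ContDiff ℝ ∞ fun x => 1 - χ (c n • x) := fun n =>
    hη.comp (contDiff_const_smul (c n))
  choose B hB0 hB using exists_bound_iteratedFDeriv_one_sub_bump χ
  refine mem_closure_of_tendsto (f := fun n => (hs n).toSchwartzMap (hd n)) (b := atTop) ?_
    (Eventually.of_forall fun n => hs n)
  rw [(schwartz_withSeminorms ℝ E ℂ).tendsto_nhds]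
  rintro ⟨k, m⟩ ε hε
  set K : ℝ := ∑ i ∈ Finset.range (m + 1), (m.choose i : ℝ) * B i *
    SchwartzMap.seminorm ℝ (k + 1) (m - i) φ with hK
  have hK0 : 0 ≤ K := Finset.sum_nonneg fun i _ =>
    mul_nonneg (mul_nonneg (Nat.cast_nonneg _) (hB0 i)) (apply_nonneg _ _)
  have hbound : ∀ n, SchwartzMap.seminorm ℝ k m ((hs n).toSchwartzMap (hd n) - φ) ≤ K * c n :=
      fun n => by
    refine SchwartzMap.seminorm_le_bound ℝ k m _ (mul_nonneg hK0 (hc0 n).le) fun x => ?_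
    have h1 : ⇑((hs n).toSchwartzMap (hd n) - φ) = -fun x => (1 - χ (c n • x)) • φ x := by
      ext x
      simp only [sub_apply, HasCompactSupport.toSchwartzMap_toFun, Pi.neg_apply, sub_smul, one_smul,
        neg_sub]
    rw [h1, iteratedFDeriv_neg, Pi.neg_apply, norm_neg]
    have h2 := norm_iteratedFDeriv_smul_le (hηn n) (φ.smooth ⊤) x (n := m) (mod_cast le_top)
    refine (mul_le_mul_of_nonneg_left h2 (by positivity)).trans ?_
    rw [Finset.mul_sum, hK, Finset.sum_mul]
    refine Finset.sum_le_sum fun i _ => ?_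
    have h3 := norm_iteratedFDeriv_comp_smul_le hη (abs_of_pos (hc0 n) ▸ hc1 n) i x
    -- The cut-off error vanishes for ‖x‖ < 1/c; elsewhere 1 ≤ c‖x‖, so one extra power of ‖x‖ buys
    -- the small factor c.
    have h4 : ‖x‖ ^ k * ‖iteratedFDeriv ℝ i (fun x => 1 - χ (c n • x)) x‖ ≤
        ‖x‖ ^ (k + 1) * (c n * B i) := by
      rcases lt_or_ge ‖c n • x‖ 1 with hx | hx
      · have h5 : (fun x => 1 - χ x) =ᶠ[𝓝 (c n • x)] fun _ => 0 := by
          filter_upwards [Metric.isOpen_ball.mem_nhds (mem_ball_zero_iff.2 hx)] with y hy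
          rw [χ.one_of_mem_closedBall (Metric.ball_subset_closedBall hy), sub_self]
        have h6 : iteratedFDeriv ℝ i (fun x => 1 - χ x) (c n • x) = 0 := by
          rw [(h5.iteratedFDeriv ℝ i).eq_of_nhds]
          exact congrFun (iteratedFDeriv_fun_zero) _
        rw [h6, norm_zero] at h3
        rw [le_antisymm h3 (norm_nonneg _), mul_zero]
        have := hB0 i
        have := hc0 n
        positivity
      · rw [norm_smul, Real.norm_of_nonneg (hc0 n).le] at hx
        calc _ ≤ ‖x‖ ^ k * B i := by
              gcongr
              exact h3.trans (hB i _)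
          _ ≤ ‖x‖ ^ k * B i * (c n * ‖x‖) :=
              le_mul_of_one_le_right (mul_nonneg (by positivity) (hB0 i)) hx
          _ = _ := by ring
    have h7 := SchwartzMap.le_seminorm ℝ (k + 1) (m - i) φ x
    calc _ = (m.choose i : ℝ) * (‖x‖ ^ k * ‖iteratedFDeriv ℝ i (fun x => 1 - χ (c n • x)) x‖) *
          ‖iteratedFDeriv ℝ (m - i) φ x‖ := by ring
      _ ≤ (m.choose i : ℝ) * (‖x‖ ^ (k + 1) * (c n * B i)) * ‖iteratedFDeriv ℝ (m - i) φ x‖ := by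
          gcongr
      _ = (m.choose i : ℝ) * B i * c n * (‖x‖ ^ (k + 1) * ‖iteratedFDeriv ℝ (m - i) φ x‖) := by
          ring
      _ ≤ (m.choose i : ℝ) * B i * c n * SchwartzMap.seminorm ℝ (k + 1) (m - i) φ := by
          have := hB0 i
          have := hc0 n
          gcongr
      _ = _ := by ring
  have hlim : Tendsto (fun n => K * c n) atTop (𝓝 0) := by
    simpa [hc, one_div] using (tendsto_one_div_add_atTop_nhds_zero_nat (𝕜 := ℝ)).const_mul K
  filter_upwards [hlim.eventually_lt_const hε] with n hn
  exact (hbound n).trans_lt hn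

end Density

/-- Every smooth function with compact support agrees on `(0, ∞)` with the derivative of
a smooth compactly supported function on the line. -/
theorem exists_deriv_eq_on_Ioi {g : ℝ → ℝ} (hg : ContDiff ℝ ∞ g) (hgs : HasCompactSupport g) :
    ∃ θ : ℝ → ℝ, ContDiff ℝ ∞ θ ∧ HasCompactSupport θ ∧ ∀ t, 0 < t → deriv θ t = g t := by
  obtain ⟨R, hR⟩ := hgs.isCompact.isBounded.exists_norm_le
  set B := max R 0 with hB
  have hB0 : 0 ≤ B := le_max_right _ _
  have hgB : ∀ t, B < t → g t = 0 := fun t ht => by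
    by_contra h
    have h1 := hR t (subset_tsupport _ (Function.mem_support.2 h))
    rw [Real.norm_eq_abs] at h1
    linarith [le_abs_self t, le_max_left R 0]
  -- Integrating from the right end B makes the primitive vanish beyond B. The cut-off χ is
  -- therefore active only at negative times, where nothing is claimed.
  set G : ℝ → ℝ := fun t => ∫ s in B..t, g s with hG
  have hGd : ∀ t, HasDerivAt G (g t) t := fun t =>
    (hg.continuous.integral_hasStrictDerivAt B t).hasDerivAt
  have hGc : ContDiff ℝ ∞ G := by
    rw [contDiff_infty_iff_deriv]
    refine ⟨fun t => (hGd t).differentiableAt, ?_⟩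
    rwa [show deriv G = g from funext fun t => (hGd t).deriv]
  have hGB : ∀ t, B ≤ t → G t = 0 := fun t ht => by
    rw [hG]
    simp only
    rw [intervalIntegral.integral_of_le ht]
    exact setIntegral_eq_zero_of_forall_eq_zero fun s hs => hgB s hs.1
  set χ : ContDiffBump (0 : ℝ) := ⟨B + 1, B + 2, by linarith, by linarith⟩ with hχ
  have hχc : ContDiff ℝ ∞ χ := χ.contDiff (n := ⊤)
  refine ⟨fun t => χ t * G t, hχc.mul hGc, χ.hasCompactSupport.mul_right, fun t ht => ?_⟩
  have hd : HasDerivAt (fun t => χ t * G t) (deriv χ t * G t + χ t * g t) t :=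
    (hχc.differentiable (by simp) t).hasDerivAt.mul (hGd t)
  rw [hd.deriv]
  rcases lt_or_ge t (B + 1) with h | h
  · have h1 : χ =ᶠ[𝓝 t] fun _ => 1 := by
      have : t ∈ Metric.ball (0 : ℝ) (B + 1) := by
        rw [mem_ball_zero_iff, Real.norm_of_nonneg ht.le]
        exact h
      filter_upwards [Metric.isOpen_ball.mem_nhds this] with s hs
      exact χ.one_of_mem_closedBall (Metric.ball_subset_closedBall hs)
    rw [h1.deriv_eq, h1.eq_of_nhds, deriv_const, zero_mul, one_mul, zero_add]
  · rw [hGB t (by linarith), hgB t (by linarith), mul_zero, mul_zero, zero_add]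

/-- A continuous function that is orthogonal on `(0, ∞)` to the derivatives of all test functions
vanishes there. -/
theorem eq_zero_of_integral_deriv_smul {r : ℝ → ℂ} (hr : Continuous r)
    (h : ∀ θ : ℝ → ℝ, ContDiff ℝ ∞ θ → HasCompactSupport θ →
      ∫ t in Ioi (0 : ℝ), deriv θ t • r t = 0) {t : ℝ} (ht : 0 < t) : r t = 0 := by
  have h1 : ∀ᵐ t, t ∈ Ioi (0 : ℝ) → r t = 0 := by
    refine isOpen_Ioi.ae_eq_zero_of_integral_contDiff_smul_eq_zero
      (hr.locallyIntegrable.locallyIntegrableOn _) fun g hg hgs hg0 => ?_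
    -- Since θ need not vanish at 0, every test function on (0, ∞) is a derivative there, not only
    -- those of mean zero; hence r is zero rather than merely constant.
    obtain ⟨θ, hθ, hθs, hd⟩ := exists_deriv_eq_on_Ioi hg hgs
    rw [← h θ hθ hθs, ← setIntegral_eq_integral_of_forall_compl_eq_zero (s := Ioi 0)]
    · exact setIntegral_congr_fun measurableSet_Ioi fun t ht => by
        rw [hd t ht]
    · intro t ht
      rw [show g t = 0 from by
        by_contra h
        exact ht (hg0 (subset_tsupport _ (Function.mem_support.2 h))), zero_smul]
  exact Measure.eqOn_open_of_ae_eq (μ := volume) ((ae_restrict_iff' measurableSet_Ioi).2 h1)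
    isOpen_Ioi hr.continuousOn continuousOn_const ht

/-! ### From the weak equation to the time-integrated equation. -/

section MildForm

variable {E : Type*} [NormedAddCommGroup E] [InnerProductSpace ℝ E]
variable {a₀ : ℝ} {a : ℝ → ℝ} {k : ℝ → ℝ}

/-- The test function `(x, t) ↦ θ(t) φ(x)`. -/
noncomputable def productTest (φ : 𝓢(E, ℂ)) (hφ : HasCompactSupport φ) (θ : ℝ → ℝ)
    (hθ : ContDiff ℝ ∞ θ) (hθs : HasCompactSupport θ) :
    𝓓((⊤ : TopologicalSpace.Opens (E × ℝ)), ℂ) where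
  toFun p := θ p.2 • φ p.1
  contDiff' := (hθ.comp contDiff_snd).smul ((φ.smooth ⊤).comp contDiff_fst)
  hasCompactSupport' := by
    refine HasCompactSupport.intro (hφ.isCompact.prod hθs.isCompact) fun p hp => ?_
    rw [mem_prod, not_and_or] at hp
    rcases hp with hp | hp
    · rw [image_eq_zero_of_notMem_tsupport hp, smul_zero]
    · rw [image_eq_zero_of_notMem_tsupport hp, zero_smul]
  tsupport_subset' := fun _ _ => trivial

theorem slice_productTest (φ : 𝓢(E, ℂ)) (hφ : HasCompactSupport φ) (θ : ℝ → ℝ)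
    (hθ : ContDiff ℝ ∞ θ) (hθs : HasCompactSupport θ) (t : ℝ) :
    slice (productTest φ hφ θ hθ hθs) t = (θ t : ℂ) • φ := by
  ext x
  rw [slice_apply, smul_apply]
  exact Complex.coe_smul (θ t) (φ x)

theorem slice_deriv_productTest (φ : 𝓢(E, ℂ)) (hφ : HasCompactSupport φ) (θ : ℝ → ℝ)
    (hθ : ContDiff ℝ ∞ θ) (hθs : HasCompactSupport θ) (t : ℝ) :
    slice (∂_{((0 : E), (1 : ℝ))} (productTest φ hφ θ hθ hθs)) t = ((deriv θ t : ℝ) : ℂ) • φ := by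
  ext x
  have h1 := hasDerivAt_slice_apply (productTest φ hφ θ hθ hθs) t x
  simp only [slice_productTest, smul_apply] at h1
  have h2 := ((hθ.differentiable (by simp) t).hasDerivAt.ofReal_comp).mul_const (φ x)
  exact h1.unique h2

variable [FiniteDimensional ℝ E] [MeasurableSpace E] [BorelSpace E]

theorem continuous_pairing_apply {u : ℝ → 𝓢'(E, ℂ)} {s : ℝ} (hu : ContinuousInSobolev s u) :
    ∃ V : ℝ → Lp ℂ 2 (volume : Measure E), Continuous V ∧
      ∀ t, 0 ≤ t → ∀ φ, u t φ = sobolevPairing s φ (V t) := by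
  obtain ⟨U, hU, h⟩ := hu
  refine ⟨fun t => 𝓕 (U (max t 0)), (Lp.fourierTransformₗᵢ E ℂ).continuous.comp
    (continuous_comp_max hU), fun t ht φ => ?_⟩
  simp only [max_eq_left ht]
  rw [sobolevPairing_apply]
  exact (hasSobolevDensity_of_besselPotential (h t ht)).apply_eq φ

theorem volterraOp_clm {X Y : Type*} [NormedAddCommGroup X] [NormedSpace ℝ X] [CompleteSpace X]
    [NormedAddCommGroup Y] [NormedSpace ℝ Y] [CompleteSpace Y]
    (hk : ∀ s t, IntervalIntegrable k volume s t) (L : X →L[ℝ] Y) {V : ℝ → X} (hV : Continuous V)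
    (t : ℝ) : volterraOp a₀ k (fun s => L (V s)) t = L (volterraOp a₀ k V t) := by
  have h1 : ∀ t, memoryTerm a₀ k (fun s => L (V s)) t = L (memoryTerm a₀ k V t) := fun t => by
    rw [memoryTerm, memoryTerm, causalConv, causalConv, map_add, map_smul,
      ← L.intervalIntegral_comp_comm (causalConv_integrand_intervalIntegrable hk hV t 0 t)]
    simp only [map_smul]
  rw [volterraOp, volterraOp, ← L.intervalIntegral_comp_comm
    ((continuous_memoryTerm a₀ hk hV).intervalIntegrable _ _)]
  simp only [h1]

/-- Test functions θ(t)φ(x) give ∫ (θ'y + θm) + θ(0)y(0) = 0, where m is the memory term of w. As m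
is the derivative of V w, integration by parts leaves ∫ θ'(y - y(0) - V w) = 0 for every θ. -/
theorem volterraOp_of_weak_of_hasCompactSupport (ha : IsAdmissibleKernel a) {u : ℝ → 𝓢'(E, ℂ)}
    (hu : SolvesWeakly a₀ a u) {φ : 𝓢(E, ℂ)} (hφ : HasCompactSupport φ)
    {y w : ℝ → ℂ} (hy : Continuous y) (hw : Continuous w) (hyu : ∀ t, 0 ≤ t → u t φ = y t)
    (hwu : ∀ t, 0 ≤ t → u t (Δ φ) = w t) {t : ℝ} (ht : 0 < t) :
    y t = y 0 + volterraOp a₀ (extendedKernel a) w t := by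
  have hk := intervalIntegrable_extendedKernel ha
  set k := extendedKernel a with hkdef
  set r : ℝ → ℂ := fun t => y t - y 0 - volterraOp a₀ k w t with hrdef
  have hVc := continuous_volterraOp a₀ hk hw
  have hr : Continuous r := (hy.sub continuous_const).sub hVc
  have hmc := continuous_memoryTerm a₀ hk hw
  suffices h : r t = 0 by
    rw [hrdef] at h
    linear_combination h
  refine eq_zero_of_integral_deriv_smul hr (fun θ hθ hθs => ?_) ht
  have hθd : ∀ t, HasDerivAt (fun t => (θ t : ℂ)) ((deriv θ t : ℝ) : ℂ) t := fun t =>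
    (hθ.differentiable (by simp) t).hasDerivAt.ofReal_comp
  have hθ'c : Continuous fun t => ((deriv θ t : ℝ) : ℂ) :=
    Complex.continuous_ofReal.comp (hθ.continuous_deriv (by simp))
  have hθc : Continuous fun t => (θ t : ℂ) := Complex.continuous_ofReal.comp hθ.continuous
  obtain ⟨R, hR⟩ := hθs.isCompact.isBounded.exists_norm_le
  set T := max R 0 + 1 with hTdef
  have hT : 0 ≤ T := by positivity
  have hsupp : ∀ t, T ≤ t → t ∉ tsupport θ := fun t ht h => by
    have h1 := hR t h
    rw [Real.norm_eq_abs] at h1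
    linarith [le_abs_self t, le_max_left R 0]
  have hθT : ∀ t, T ≤ t → θ t = 0 := fun t ht => image_eq_zero_of_notMem_tsupport (hsupp t ht)
  have hθ'T : ∀ t, T ≤ t → deriv θ t = 0 := fun t ht =>
    image_eq_zero_of_notMem_tsupport fun h => hsupp t ht (tsupport_deriv_subset h)
  have hΔ : ∀ (c : ℂ), Δ (c • φ) = c • Δ φ := fun c => by
    rw [← SchwartzMap.laplacianCLM_eq ℂ, map_smul, SchwartzMap.laplacianCLM_eq]
  have hweak := hu (productTest φ hφ θ hθ hθs)
  simp only [slice_productTest, slice_deriv_productTest, hΔ] at hweak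
  rw [weakForm_eq_integral ha (p := fun t => ((deriv θ t : ℝ) : ℂ) • φ)
    (q := fun t => (θ t : ℂ) • Δ φ) ?_ ?_ hT (fun t ht => by rw [hθ'T t ht]; simp)
    (fun t ht => by rw [hθT t ht]; simp)] at hweak
  rotate_left
  · simp only [map_smul, hyu _ (le_max_right _ _)]
    exact (hθ'c.comp continuous_snd).smul (hy.comp (continuous_fst.max continuous_const))
  · simp only [map_smul, hwu _ (le_max_right _ _)]
    exact (hθc.comp continuous_snd).smul (hw.comp (continuous_fst.max continuous_const))
  have h1 : ∀ t ∈ uIcc 0 T, (u t (((deriv θ t : ℝ) : ℂ) • φ) + (a₀ : ℂ) * u t ((θ t : ℂ) • Δ φ)) +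
      (∫ r in (0 : ℝ)..t, (k r : ℂ) * u (t - r) ((θ t : ℂ) • Δ φ)) =
        ((deriv θ t : ℝ) : ℂ) * y t + (θ t : ℂ) * memoryTerm a₀ k w t := fun t ht => by
    rw [uIcc_of_le hT] at ht
    have h2 : (∫ r in (0 : ℝ)..t, (k r : ℂ) * u (t - r) ((θ t : ℂ) • Δ φ)) =
        (θ t : ℂ) * causalConv k w t := by
      rw [causalConv, ← intervalIntegral.integral_const_mul]
      refine intervalIntegral.integral_congr fun r hr => ?_
      rw [uIcc_of_le ht.1] at hr
      simp only [map_smul, hwu _ (sub_nonneg.2 hr.2), Complex.real_smul, smul_eq_mul]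
      ring
    rw [h2, map_smul, map_smul, hyu t ht.1, hwu t ht.1, memoryTerm, Complex.real_smul, smul_eq_mul,
      smul_eq_mul]
    ring
  rw [intervalIntegral.integral_congr h1, map_smul, hyu 0 le_rfl, smul_eq_mul] at hweak
  have h3 := intervalIntegral.integral_eq_sub_of_hasDerivAt
    (f := fun t => (θ t : ℂ) * (y 0 + volterraOp a₀ k w t))
    (f' := fun t => ((deriv θ t : ℝ) : ℂ) * (y 0 + volterraOp a₀ k w t) +
      (θ t : ℂ) * memoryTerm a₀ k w t) (a := 0) (b := T)
    (fun t _ => (hθd t).mul ((hasDerivAt_volterraOp a₀ hk hw t).const_add (y 0)))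
    (((hθ'c.mul (continuous_const.add hVc)).add (hθc.mul hmc)).intervalIntegrable _ _)
  have hV0 : volterraOp a₀ k w 0 = 0 := by rw [volterraOp, intervalIntegral.integral_same]
  rw [hθT T le_rfl, hV0, Complex.ofReal_zero, zero_mul, add_zero, zero_sub] at h3
  have h4 : ∫ t in (0 : ℝ)..T, deriv θ t • r t = 0 := by
    have h5 := intervalIntegral.integral_sub
      (((hθ'c.mul hy).add (hθc.mul hmc)).intervalIntegrable (μ := volume)
        (u := fun t => ((deriv θ t : ℝ) : ℂ) * y t + (θ t : ℂ) * memoryTerm a₀ k w t) 0 T)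
      (((hθ'c.mul (continuous_const.add hVc)).add (hθc.mul hmc)).intervalIntegrable
        (μ := volume) (u := fun t => ((deriv θ t : ℝ) : ℂ) * (y 0 + volterraOp a₀ k w t) +
      (θ t : ℂ) * memoryTerm a₀ k w t) 0 T)
    rw [h3] at h5
    have h6 : ∫ t in (0 : ℝ)..T, deriv θ t • r t =
        (∫ t in (0 : ℝ)..T, ((deriv θ t : ℝ) : ℂ) * y t + (θ t : ℂ) * memoryTerm a₀ k w t) -
          -((θ 0 : ℂ) * y 0) := by
      refine Eq.trans ?_ h5
      refine intervalIntegral.integral_congr fun t _ => ?_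
      simp only [hrdef, Complex.real_smul]
      ring
    rw [h6, sub_neg_eq_add]
    exact hweak
  rw [← h4, intervalIntegral.integral_of_le hT]
  refine setIntegral_eq_of_subset_of_forall_sdiff_eq_zero measurableSet_Ioi
    Ioc_subset_Ioi_self fun t ht => ?_
  have : T ≤ t := by
    by_contra h
    exact ht.2 ⟨ht.1, (not_le.1 h).le⟩
  rw [hθ'T t this, zero_smul]

end MildForm

/-! ### Uniqueness by band-limited test functions. -/

section Uniqueness

variable {E : Type*} [NormedAddCommGroup E] [InnerProductSpace ℝ E]
  [FiniteDimensional ℝ E] [MeasurableSpace E] [BorelSpace E]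
variable {a₀ s : ℝ} {a : ℝ → ℝ}

theorem continuous_laplacian : Continuous fun φ : 𝓢(E, ℂ) => Δ φ :=
  (LineDeriv.laplacianCLM ℝ E 𝓢(E, ℂ)).continuous

theorem isClosed_integrated_equation (s : ℝ) (U V W : Lp ℂ 2 (volume : Measure E)) :
    IsClosed {φ : 𝓢(E, ℂ) | sobolevPairing s φ U =
      sobolevPairing s φ V + sobolevPairing s (Δ φ) W} :=
  isClosed_eq (continuous_sobolevPairing s U) ((continuous_sobolevPairing s V).add
    ((continuous_sobolevPairing s W).comp continuous_laplacian))

theorem volterraOp_sobolevPairing {k : ℝ → ℝ} (hk : ∀ s t, IntervalIntegrable k volume s t)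
    (φ : 𝓢(E, ℂ)) {V : ℝ → Lp ℂ 2 (volume : Measure E)} (hV : Continuous V) (t : ℝ) :
    volterraOp a₀ k (fun r => sobolevPairing s φ (V r)) t =
      sobolevPairing s φ (volterraOp a₀ k V t) :=
  volterraOp_clm hk ((sobolevPairing s φ).restrictScalars ℝ) hV t

/-- A weak solution satisfies the time-integrated equation tested with Schwartz functions. -/
theorem IsSobolevSolution.exists_integrated (ha : IsAdmissibleKernel a) {u₀ : 𝓢'(E, ℂ)}
    {u : ℝ → 𝓢'(E, ℂ)} (hu : IsSobolevSolution s a₀ a u₀ u) :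
    ∃ V : ℝ → Lp ℂ 2 (volume : Measure E), Continuous V ∧
      (∀ t, 0 ≤ t → ∀ φ, u t φ = sobolevPairing s φ (V t)) ∧
      ∀ t, 0 ≤ t → ∀ φ : 𝓢(E, ℂ), u t φ = u₀ φ +
        sobolevPairing s (Δ φ) (volterraOp a₀ (extendedKernel a) V t) := by
  have hk := intervalIntegrable_extendedKernel ha
  obtain ⟨V, hV, hVu⟩ := continuous_pairing_apply hu.continuous
  refine ⟨V, hV, hVu, fun t ht φ => ?_⟩
  have h0 : u₀ φ = sobolevPairing s φ (V 0) := by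
    rw [← hVu 0 le_rfl φ, hu.initial]
  rw [hVu t ht φ, h0]
  rcases ht.eq_or_lt with rfl | ht'
  · rw [volterraOp, intervalIntegral.integral_same, map_zero, add_zero]
  -- Both sides are continuous in φ for the Schwartz topology, so compactly supported φ suffice. The
  -- extension is needed because band-limited functions do not in general have compact support.
  refine dense_hasCompactSupport.induction (fun φ hφ => ?_) (isClosed_integrated_equation s _ _ _) φ
  have hc : ∀ ψ : 𝓢(E, ℂ), Continuous fun t => sobolevPairing s ψ (V t) :=
    fun ψ => (sobolevPairing s ψ).continuous.comp hV
  have h1 := volterraOp_of_weak_of_hasCompactSupport ha hu.weak hφ (hc φ) (hc (Δ φ))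
    (fun t ht => hVu t ht φ) (fun t ht => hVu t ht _) ht'
  rw [volterraOp_sobolevPairing hk _ hV t] at h1
  exact h1

theorem norm_toLp_sobolevTest_laplacian_le {φ : 𝓢(E, ℂ)} {R : ℝ}
    (hφ : ∀ ξ, R < ‖ξ‖ → 𝓕⁻ φ ξ = 0) :
    ‖(sobolevTest s (Δ φ)).toLp 2 (volume : Measure E)‖ ≤
      (2 * Real.pi * R) ^ 2 * ‖(sobolevTest s φ).toLp 2 (volume : Measure E)‖ := by
  refine Lp.norm_le_mul_norm_of_ae_le_mul ?_
  filter_upwards [(sobolevTest s (Δ φ)).coeFn_toLp 2 (volume : Measure E),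
    (sobolevTest s φ).coeFn_toLp 2 (volume : Measure E)] with ξ h1 h2
  rw [h1, h2, sobolevTest_laplacian, norm_smul, norm_neg, Real.norm_of_nonneg (by positivity)]
  rcases le_or_gt ‖ξ‖ R with h | h
  · gcongr
  · rw [sobolevTest_apply, hφ ξ h, mul_zero, norm_zero, mul_zero, mul_zero]

/-- The pairing of the difference with φ is the Volterra image of its pairing with Δφ. If 𝓕⁻ φ is
supported in the ball of radius R, each Laplacian costs at most (2πR)², so the factorial estimate
applies to the chain Δⁿφ. -/
theorem IsSobolevSolution.eqOn (ha : IsAdmissibleKernel a) {u₀ : 𝓢'(E, ℂ)}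
    {u v : ℝ → 𝓢'(E, ℂ)} (hu : IsSobolevSolution s a₀ a u₀ u)
    (hv : IsSobolevSolution s a₀ a u₀ v) : EqOn v u (Ici 0) := by
  have hk := intervalIntegrable_extendedKernel ha
  obtain ⟨U, hU, hUu, hUm⟩ := hu.exists_integrated ha
  obtain ⟨V, hV, hVv, hVm⟩ := hv.exists_integrated ha
  set W : ℝ → Lp ℂ 2 (volume : Measure E) := fun t => V t - U t with hW
  have hWc : Continuous W := hV.sub hU
  set y : 𝓢(E, ℂ) → ℝ → ℂ := fun φ t => sobolevPairing s φ (W t) with hy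
  have hyV : ∀ φ t, 0 ≤ t → y φ t = v t φ - u t φ := fun φ t ht => by
    rw [hVv t ht, hUu t ht, ← map_sub]
  have hyeq : ∀ φ t, 0 ≤ t → y φ t = volterraOp a₀ (extendedKernel a) (y (Δ φ)) t :=
      fun φ t ht => by
    rw [hyV φ t ht, hVm t ht, hUm t ht, add_sub_add_left_eq_sub, ← map_sub,
      ← volterraOp_sub hk hV hU]
    exact (volterraOp_sobolevPairing hk _ hWc t).symm
  have hband : ∀ ψ : 𝓢(E, ℂ), HasCompactSupport ψ → ∀ t, 0 ≤ t → y (𝓕 ψ) t = 0 :=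
      fun ψ hψ t ht => by
    obtain ⟨R, hR⟩ := hψ.isCompact.isBounded.exists_norm_le
    set φ : ℕ → 𝓢(E, ℂ) := fun n => (fun f : 𝓢(E, ℂ) => Δ f)^[n] (𝓕 ψ) with hφ
    have hsucc : ∀ n, φ (n + 1) = Δ (φ n) := fun n => Function.iterate_succ_apply' _ _ _
    have hsupp : ∀ n ξ, R < ‖ξ‖ → 𝓕⁻ (φ n) ξ = 0 := fun n => by
      induction n with
      | zero =>
        intro ξ hξ
        have h1 : 𝓕⁻ (φ 0) = ψ := FourierTransform.fourierInv_fourier_eq (F := 𝓢(E, ℂ)) ψ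
        rw [h1]
        exact image_eq_zero_of_notMem_tsupport fun h => hξ.not_ge (hR ξ h)
      | succ n ih =>
        intro ξ hξ
        rw [hsucc, fourierInv_laplacian, ih ξ hξ, smul_zero]
    have hnorm : ∀ n, ‖(sobolevTest s (φ n)).toLp 2 (volume : Measure E)‖ ≤
        ‖(sobolevTest s (φ 0)).toLp 2 (volume : Measure E)‖ * ((2 * Real.pi * R) ^ 2) ^ n :=
        fun n => by
      induction n with
      | zero => simp
      | succ n ih =>
        rw [hsucc]
        refine (norm_toLp_sobolevTest_laplacian_le (hsupp n)).trans ?_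
        refine (mul_le_mul_of_nonneg_left ih (sq_nonneg _)).trans_eq ?_
        rw [pow_succ]
        ring
    obtain ⟨M, hM⟩ := isCompact_Icc.exists_bound_of_continuousOn
      (s := Icc 0 t) hWc.continuousOn
    have hM0 : 0 ≤ M := (norm_nonneg _).trans (hM 0 ⟨le_rfl, ht⟩)
    refine eq_zero_of_eq_volterraOp (a₀ := a₀) (Y := fun n => y (φ n)) hk
      (C := ‖pairing (E := E)‖ *
        ‖(sobolevTest s (φ 0)).toLp 2 (volume : Measure E)‖ * M) (by positivity)
      (sq_nonneg (2 * Real.pi * R)) (fun n r hr => ?_) (fun n r hr => ?_) (T := t) ⟨ht, le_rfl⟩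
    · simp only [hsucc]
      exact hyeq _ r hr.1
    · refine (norm_sobolevPairing_le s _ _).trans ?_
      calc _ ≤ ‖pairing (E := E)‖ *
            (‖(sobolevTest s (φ 0)).toLp 2 (volume : Measure E)‖ *
              ((2 * Real.pi * R) ^ 2) ^ n) * M := by
            gcongr
            · exact hnorm n
            · exact hM r hr
        _ = _ := by ring
  intro t ht
  ext φ
  -- Band-limited functions are the transforms of compactly supported ones, and the transform is
  -- continuous on the Schwartz space, so the vanishing extends to all test functions.
  have key : ∀ ψ : 𝓢(E, ℂ), y (𝓕 ψ) t = 0 := fun ψ =>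
    dense_hasCompactSupport.induction (P := fun ψ => y (𝓕 ψ) t = 0)
      (fun ψ hψ => hband ψ hψ t ht)
      (isClosed_eq ((continuous_sobolevPairing s (W t)).comp
        (FourierTransform.fourierCLM ℂ 𝓢(E, ℂ)).continuous) continuous_const) ψ
  have h1 := key (𝓕⁻ φ)
  rw [FourierTransform.fourier_fourierInv_eq, hyV φ t ht] at h1
  exact sub_eq_zero.1 h1

end Uniqueness

end VolterraDiffusion

theorem proposition4p1 (n : ℕ) (a₀ : ℝ) (a : ℝ → ℝ) (ha₀ : 0 ≤ a₀)
    (ha : VolterraDiffusion.IsAdmissibleKernel a)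
    (hpos : VolterraDiffusion.NonnegBoundaryLimit a₀ a)
    (s : ℝ) (u₀ : 𝓢'(EuclideanSpace ℝ (Fin n), ℂ))
    (hu₀ : TemperedDistribution.MemSobolev s 2 u₀) :
    ∃ z : ℝ → ℝ → ℝ,
      (∀ l : ℝ, 0 ≤ l → VolterraDiffusion.IsScalarSolution a₀ a l (z l) ∧
        ∀ y : ℝ → ℝ, VolterraDiffusion.IsScalarSolution a₀ a l y → EqOn y (z l) (Ici 0)) ∧
      ∃ u : ℝ → 𝓢'(EuclideanSpace ℝ (Fin n), ℂ),
        VolterraDiffusion.IsSobolevSolution s a₀ a u₀ u ∧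
        (∀ v : ℝ → 𝓢'(EuclideanSpace ℝ (Fin n), ℂ),
          VolterraDiffusion.IsSobolevSolution s a₀ a u₀ v → EqOn v u (Ici 0)) ∧
        ∃ g : EuclideanSpace ℝ (Fin n) → ℂ,
          VolterraDiffusion.HasFourierTransform u₀ g ∧
          ∀ t : ℝ, 0 ≤ t →
            VolterraDiffusion.HasFourierTransform (u t)
              (fun ξ => (z (‖ξ‖ ^ 2) t : ℂ) * g ξ) := by
  open VolterraDiffusion in
  have hk := intervalIntegrable_extendedKernel ha
  have hz : ∀ l, 0 ≤ l → ∀ t, |resolvent a₀ (extendedKernel a) l t| ≤ 1 := fun l hl t =>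
    abs_resolvent_le_one hk (integrable_extendedKernel ha).integrableOn
      (boundary_limit_extendedKernel ha hpos) hl t
  obtain ⟨F, u, huc, hu0, hud⟩ := exists_sobolev_evolution hk hz hu₀
  have hsol : IsSobolevSolution s a₀ a u₀ u :=
    ⟨huc, solvesWeakly_of_density ha hz hud, hu0⟩
  have hF : ∀ t, HasFourierTransform (u t) fun ξ =>
      (resolvent a₀ (extendedKernel a) (‖ξ‖ ^ 2) t : ℂ) *
        ((besselWeight (-s) ((2 * Real.pi)⁻¹ • ξ) : ℂ) * F ((2 * Real.pi)⁻¹ • ξ)) := fun t => by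
    convert (hud t).hasFourierTransform using 2 with ξ
    -- The dilation by (2π)⁻¹ turns the symbol (2π‖ξ‖)² into ‖ξ‖².
    have h1 : 2 * Real.pi * ‖(2 * Real.pi)⁻¹ • ξ‖ = ‖ξ‖ := by
      rw [norm_smul, Real.norm_of_nonneg (by positivity), mul_inv_cancel_left₀ (by positivity)]
    rw [evolve, h1]
    ring
  refine ⟨resolvent a₀ (extendedKernel a),
    fun l _ => ⟨isScalarSolution_resolvent ha l, fun y hy => hy.eqOn ha⟩,
    u, hsol, fun v hv => hsol.eqOn ha hv, _, ?_, fun t _ => hF t⟩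
  -- The function g is the transform at time 0, where z = 1.
  have h0 := hF 0
  simpa only [hu0, resolvent_zero_right hk, Complex.ofReal_one, one_mul] using h0
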